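/- Let $M$ be a connected smooth $2$-manifold, let $\mathbf{x}\colon M\to\mathbb{R}^3$ be a smooth immersion with Gaussian curvature $K\colon M\to\mathbb{R}$, and assume that $M$ has no non-empty open subset on which $\operatorname{grad}K=0$. For $k\in\mathbb{R}$ put $M_k=\{p\in M : K(p)=k\}$; these sets are the $K$-contours. Let $P\subset\mathbb{R}^3$ be a plane, $o\in P$ a point and $\pi\colon\mathbb{R}^3\to P$ the orthogonal projection. Assume: 1. (Concentric $K$-contours.) For every $k$, each connected component of $M_k$ is mapped by $\pi\circ\mathbf{x}$ into a circle of $P$ with centre $o$ (arcs of circles, and the one-point circle $\{o\}$, are allowed). 2. (The area element $dA$ is invariant along each $K$-contour.) For one of the orientations of $P$, let $R_t$ be the rotation of $P$ about $o$ by the angle $t$. Near every point of $M$ the rotations $R_t$ are induced by motions along the $K$-contours that preserve $dA$: every $p\in M$ has an open neighbourhood $U$ for which there are $\varepsilon>0$ and a smooth map $(-\varepsilon,\varepsilon)\times U\to M$, $(t,q)\mapsto\varphi_t(q)$, with $\varphi_0=\mathrm{id}_U$ and, for all $|t|<\varepsilon$, $$\pi\circ\mathbf{x}\circ\varphi_t=R_t\circ\pi\circ\mathbf{x},\qquad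 K\circ\varphi_t=K,\qquad |\varphi_t^*\,dA|=|dA| \quad\text{on } U .$$ (Where $(r,\theta)$, polar coordinates of $P$ about $o$, are local coordinates of $M$, so that $\mathbf{x}$ is a graph over $P$ and $dA=\varDelta\,dr\wedge d\theta$, and where $K$ is a function of $r$ only, this says that $\varDelta$ is a function of $r$ only.) Then at least one of the following holds. (a) $\mathbf{x}$ is a helicoidal surface or an open part of one: there is a one-parameter group $\{g_t\}$ of screw motions of $\mathbb{R}^3$ ($g_t$ is the rotation by the angle $t$ about a fixed line followed by the translation by $ht$ along that line, where $h\in\mathbb{R}$ is a constant, and $h=0$ is allowed) that leaves $\mathbf{x}$ locally invariant, that is, every point of $M$ has an open neighbourhood $U$ for which there are $\varepsilon>0$ and a smooth map $(-\varepsilon,\varepsilon)\times U\to M$, $(t,q)\mapsto\psi_t(q)$, with $\psi_0=\mathrm{id}_U$ and $\mathbf{x}\circ\psi_t=g_t\circ\mathbf{x}$ on $U$ for all $|t|<\varepsilon$. (b) There are real numbers $m\notin\{0,1\}$ and $c\neq0$ such that $\mathbf{x}$ is locally congruent to the surface $$\mathbf{x}_{m,c}(r,\theta)=(r\cos\theta,\;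 r\sin\theta,\; c\,r^m\cos m\theta),\qquad r>0,\ \theta\in\mathbb{R},$$ which for a positive integer $m$ is understood as the entire graph $\mathbf{x}_{m,c}(z)=(\operatorname{Re}z,\operatorname{Im}z,c\operatorname{Re}z^m)$, $z\in\mathbb{C}$: every point of $M$ has a neighbourhood whose image under $\mathbf{x}$ is carried by an isometry of $\mathbb{R}^3$ into the surface $\mathbf{x}_{m,c}$, smoothly with respect to the parameters of $\mathbf{x}_{m,c}$. -/

import Mathlib

open scoped Manifold ContDiff Topology

noncomputable section

/-- Euclidean 3-space. -/
abbrev E3 := EuclideanSpace ℝ (Fin 3)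

/-- The model space of a 2-manifold. -/
abbrev E2 := EuclideanSpace ℝ (Fin 2)

/-- The vector product of Euclidean 3-space. -/
def cross3 (u v : E3) : E3 := WithLp.toLp 2 (crossProduct u.ofLp v.ofLp)

/-- The partial derivative of a map `E2 → E3` in the `i`-th coordinate direction. -/
def partialD (i : Fin 2) (X : E2 → E3) (y : E2) : E3 :=
  fderiv ℝ X y (EuclideanSpace.single i 1)

/-- The unit normal `X_u × X_v / |X_u × X_v|` of a parametrized surface. -/
def unitNormal (X : E2 → E3) (y : E2) : E3 :=
  ‖cross3 (partialD 0 X y) (partialD 1 X y)‖⁻¹ • cross3 (partialD 0 X y) (partialD 1 X y)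

/-- The coefficients of the first fundamental form. -/
def firstFF (X : E2 → E3) (y : E2) (i j : Fin 2) : ℝ :=
  inner ℝ (partialD i X y) (partialD j X y)

/-- The coefficients of the second fundamental form. -/
def secondFF (X : E2 → E3) (y : E2) (i j : Fin 2) : ℝ :=
  inner ℝ (partialD i (partialD j X) y) (unitNormal X y)

/-- The Gaussian curvature `(L N - M²) / (E G - F²)` of a parametrized surface. -/
def paramGaussianCurvature (X : E2 → E3) (y : E2) : ℝ :=
  (secondFF X y 0 0 * secondFF X y 1 1 - secondFF X y 0 1 ^ 2) /
    (firstFF X y 0 0 * firstFF X y 1 1 - firstFF X y 0 1 ^ 2)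

section Surface

variable {M : Type*} [TopologicalSpace M] [ChartedSpace E2 M]

/-- `x` is a smooth immersion of the 2-manifold `M` into 3-space. -/
def IsImmersedSurface (x : M → E3) : Prop :=
  ContMDiff (𝓡 2) 𝓘(ℝ, E3) ∞ x ∧
    ∀ p : M, Function.Injective (mfderiv (𝓡 2) 𝓘(ℝ, E3) x p)

/-- The Gaussian curvature function `K` of the surface `x`; its value at `p` is computed in the
preferred chart around `p` (the value does not depend on the chart). -/
def gaussianCurvature (x : M → E3) (p : M) : ℝ :=
  paramGaussianCurvature (x ∘ (extChartAt (𝓡 2) p).symm) (extChartAt (𝓡 2) p p)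

/-- The contour `M_k` of the Gaussian curvature. -/
def KContour (x : M → E3) (k : ℝ) : Set M := {p | gaussianCurvature x p = k}

/-- `M` has no (non-empty) open subset on which `grad K = 0`. -/
def NoOpenSetOfCriticalPoints (x : M → E3) : Prop :=
  ∀ U : Set M, IsOpen U → U.Nonempty →
    ∃ p ∈ U, mfderiv (𝓡 2) 𝓘(ℝ, ℝ) (gaussianCurvature x) p ≠ 0

/-- The area element `|dA| (u, v)` of the surface `x` on tangent vectors `u, v` at `p`: the area of
the parallelogram spanned by `dx u` and `dx v`. -/
def areaElement (x : M → E3) (p : M) (u v : TangentSpace (𝓡 2) p) : ℝ :=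
  ‖cross3 (mfderiv (𝓡 2) 𝓘(ℝ, E3) x p u) (mfderiv (𝓡 2) 𝓘(ℝ, E3) x p v)‖

/-- The surface has concentric K-contours with respect to the plane `P` and the centre `o`: the
orthogonal projection to `P` maps every connected component of every contour `M_k` into a circle
of `P` with centre `o`. (A contour may have several components, lying over different circles; an
arc of a circle and the one-point circle of radius `0` are allowed.) -/
def HasConcentricKContours (x : M → E3) (P : AffineSubspace ℝ E3) [Nonempty P] (o : P) : Prop :=
  ∀ k : ℝ, ∀ p ∈ KContour x k, ∃ ρ : ℝ, ∀ q ∈ connectedComponentIn (KContour x k) p,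
    EuclideanGeometry.orthogonalProjection P (x q) ∈ Metric.sphere o ρ

/-- The area element is invariant along the K-contours: near every point, the rotations
of `P` about `o` are induced by a smooth family of local motions `φ_t = Φ (t, ·)` of `M`
with `φ_0 = id`, each of which moves every point along its K-contour and satisfies
`φ_t^* dA = dA`. -/
def AreaElementInvariantAlongKContours (x : M → E3) (P : AffineSubspace ℝ E3) [Nonempty P]
    [Fact (Module.finrank ℝ P.direction = 2)] (o : P) : Prop :=
  ∃ rot : Orientation ℝ P.direction (Fin 2), ∀ p : M, ∃ ε : ℝ, 0 < ε ∧
    ∃ U : Set M, IsOpen U ∧ p ∈ U ∧ ∃ Φ : ℝ × M → M,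
      ContMDiffOn (𝓘(ℝ, ℝ).prod (𝓡 2)) (𝓡 2) ∞ Φ (Set.Ioo (-ε) ε ×ˢ U) ∧
      (∀ q ∈ U, Φ (0, q) = q) ∧
      ∀ t ∈ Set.Ioo (-ε) ε, ∀ q ∈ U,
        EuclideanGeometry.orthogonalProjection P (x (Φ (t, q))) -ᵥ o =
          rot.rotation (t : Real.Angle)
            (EuclideanGeometry.orthogonalProjection P (x q) -ᵥ o) ∧
        gaussianCurvature x (Φ (t, q)) = gaussianCurvature x q ∧
        ∀ u v : TangentSpace (𝓡 2) q,
          areaElement x (Φ (t, q))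
              (mfderiv (𝓡 2) (𝓡 2) (fun q' => Φ (t, q')) q u)
              (mfderiv (𝓡 2) (𝓡 2) (fun q' => Φ (t, q')) q v) =
            areaElement x q u v

/-- The screw motion with the third coordinate axis as its axis, with angle `t` and with
translation `h * t` along the axis. For fixed pitch `h` these form a one-parameter group;
`h = 0` gives the rotations about the axis. -/
def standardScrew (h t : ℝ) (y : E3) : E3 :=
  !₂[Real.cos t * y 0 - Real.sin t * y 1, Real.sin t * y 0 + Real.cos t * y 1, y 2 + h * t]

/-- `x` is a helicoidal surface (or an open part of one): there is a one-parameter group of screw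
motions `g_t = A⁻¹ ∘ standardScrew h t ∘ A` of 3-space, one and the same for all of `M`, that
leaves the surface invariant. As `M` need not be complete, invariance is meant for small
motions: near every point there is a smooth family of local motions `ψ_t = Ψ (t, ·)`
of `M` with `ψ_0 = id` and `x ∘ ψ_t = g_t ∘ x`. -/
def IsHelicoidalSurface (x : M → E3) : Prop :=
  ∃ (A : E3 ≃ᵃⁱ[ℝ] E3) (h : ℝ), ∀ p : M, ∃ ε : ℝ, 0 < ε ∧
    ∃ U : Set M, IsOpen U ∧ p ∈ U ∧ ∃ Ψ : ℝ × M → M,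
      ContMDiffOn (𝓘(ℝ, ℝ).prod (𝓡 2)) (𝓡 2) ∞ Ψ (Set.Ioo (-ε) ε ×ˢ U) ∧
      (∀ q ∈ U, Ψ (0, q) = q) ∧
      ∀ t ∈ Set.Ioo (-ε) ε, ∀ q ∈ U, x (Ψ (t, q)) = A.symm (standardScrew h t (A (x q)))

/-- The surface `x_{m,c}` in polar coordinates, `r > 0` and `θ ∈ ℝ` (for a real exponent `m`
this is a surface on the universal cover of the punctured plane). -/
def xmcPolar (m c : ℝ) (w : ℝ × ℝ) : E3 :=
  !₂[w.1 * Real.cos w.2, w.1 * Real.sin w.2, c * w.1 ^ m * Real.cos (m * w.2)]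

/-- The surface `x_{n,c}` for a positive integer `n`, an entire graph over the plane
(which includes the origin). -/
def xmcEntire (n : ℕ) (c : ℝ) (z : ℂ) : E3 :=
  !₂[z.re, z.im, c * (z ^ n).re]

/-- Near `p`, the surface `x` is congruent to the surface `y` with parameter domain `D`:
an isometry of 3-space carries a neighbourhood of `p` to a piece of `y`. -/
def IsCongruentNear {N : Type*} [NormedAddCommGroup N] [NormedSpace ℝ N]
    (x : M → E3) (p : M) (y : N → E3) (D : Set N) : Prop :=
  ∃ A : E3 ≃ᵃⁱ[ℝ] E3, ∃ U : Set M, IsOpen U ∧ p ∈ U ∧ ∃ ψ : M → N,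
    ContMDiffOn (𝓡 2) 𝓘(ℝ, N) ∞ ψ U ∧ Set.MapsTo ψ U D ∧ ∀ q ∈ U, A (x q) = y (ψ q)

/-- `x` is locally congruent to `x_{m,c}`, which lives on the universal cover of the punctured
plane, and on the entire plane if `m` is a positive integer. -/
def IsLocallyCongruentToXmc (x : M → E3) (m c : ℝ) : Prop :=
  ∀ p : M, IsCongruentNear x p (xmcPolar m c) {w : ℝ × ℝ | 0 < w.1} ∨
    ∃ n : ℕ, 0 < n ∧ (n : ℝ) = m ∧ IsCongruentNear x p (xmcEntire n c) Set.univ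

end Surface

end

/-!
After a motion of space, `P` is the horizontal plane and `o` is the origin. Where the surface is a
graph over the punctured plane, write its height `f` in the logarithmic polar coordinates `(τ, θ)`,
`r = exp τ`. The local motions are then translations in `θ`. The area element of a graph determines
the squared length `g = f_τ² + f_θ²` of the gradient, and together with `g` the Gaussian curvature
determines `k = (f_ττ - f_τ) (f_θθ + f_τ) - (f_τθ - f_θ)²`; so `g` and `k` do not depend on `θ`.

As `g` is constant along circles, the `θ`-derivative of the gradient is a multiple `A` of the
gradient rotated by a right angle, and `k = (1 + A) (g_τ / 2 - g)`. Where `k ≠ 0`, this shows that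
`A` does not depend on `θ` (`pd_one_gradTurn`), and equality of mixed third derivatives shows that
`A` is locally constant where it is not zero (`pd_zero_gradTurn`). With `m = -A` there are two
cases.

* If `m ≠ 0`, then `f` satisfies the equations of a power (`isPowerJet_of_gradTurn_ne_zero`), whose
  solutions are `z₀ + c r ^ m cos (m θ + b)` (`eq_power_of_isPowerJet`); here `m ≠ 1`, because
  `m = 1` gives `k = 0`.
* If `m = 0`, then `f_θ` is stationary (`pd_pd_one_eq_zero`).

The generic points (off the axis, with non-vertical tangent plane and `K ≠ 0`), to which this
applies, are dense: a surface whose tangent planes are all vertical is flat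
(`paramGaussianCurvature_eq_zero_of_vertical`), and the hypothesis on `grad K` excludes open flat
pieces.

Suppose that the first case occurs somewhere, with the values `m` and `c`. The class of the points
with these values is open; off the axis it is also closed, because the slope `|c m| r ^ (m - 1)` and
the differential relations pass to limits (`isPowerPoint_of_mem_closure`). On the axis, limits with
`m < 0` are excluded by the continuity of the first two derivatives of the height under the local
motions, and limits with `0 < m < 1` by that of the Gaussian curvature (`one_lt_of_mem_closure`). If
`m > 1`, the surface is a graph around the limit point, the punctured neighbourhood belongs to the
class, and since the height is a single-valued function around the axis, `m` is an integer
(`isCongruentNear_entire_of_mem_closure`). By connectedness the closure of the class is the whole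
surface (`isLocallyCongruentToXmc_of_isPowerPoint`).

Otherwise the second case holds at all generic points. The rate at which the local motions change
the height has then zero derivative on a dense set, hence everywhere, so that it is constant
(`eventually_heightRate_eq`), and the local motions are restrictions of screw motions of one pitch
(`exists_screw`).
-/

noncomputable section

/-! ### Coordinate partial derivatives -/

/-- The partial derivative of a map on `E2` in the `i`-th coordinate direction, for values in any
normed space; for maps into `E3` it is definitionally `partialD`. -/
def pd {F : Type*} [NormedAddCommGroup F] [NormedSpace ℝ F] (i : Fin 2) (f : E2 → F) (y : E2) : F :=
  fderiv ℝ f y (EuclideanSpace.single i 1)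

section PartialDerivatives

variable {F G : Type*} [NormedAddCommGroup F] [NormedSpace ℝ F]
  [NormedAddCommGroup G] [NormedSpace ℝ G]

theorem e2_eq_sum_single (v : E2) :
    v = v 0 • EuclideanSpace.single 0 1 + v 1 • EuclideanSpace.single 1 1 := by
  ext i; fin_cases i <;> simp

theorem fderiv_eq_pd (f : E2 → F) (y v : E2) :
    fderiv ℝ f y v = v 0 • pd 0 f y + v 1 • pd 1 f y := by
  conv_lhs => rw [e2_eq_sum_single v]
  simp [pd]

theorem pd_congr {f g : E2 → F} {y : E2} (h : f =ᶠ[𝓝 y] g) (i : Fin 2) : pd i f y = pd i g y := by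
  unfold pd; rw [h.fderiv_eq]

theorem pd_congr_eventually {f g : E2 → F} {y : E2} (h : f =ᶠ[𝓝 y] g) (i : Fin 2) :
    pd i f =ᶠ[𝓝 y] pd i g :=
  h.eventuallyEq_nhds.mono fun _ hy => pd_congr hy i

theorem ContDiffOn.pd {f : E2 → F} {O : Set E2} (hf : ContDiffOn ℝ ∞ f O) (hO : IsOpen O)
    (i : Fin 2) : ContDiffOn ℝ ∞ (pd i f) O :=
  (hf.fderiv_of_isOpen hO (by simp)).clm_apply contDiffOn_const

theorem ContDiffOn.differentiableAt_of_isOpen {f : E2 → F} {O : Set E2} (hf : ContDiffOn ℝ ∞ f O)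
    (hO : IsOpen O) {y : E2} (hy : y ∈ O) : DifferentiableAt ℝ f y :=
  (hf.contDiffAt (hO.mem_nhds hy)).differentiableAt (by simp)

theorem pd_comm {f : E2 → F} {O : Set E2} (hf : ContDiffOn ℝ ∞ f O) (hO : IsOpen O) {y : E2}
    (hy : y ∈ O) (i j : Fin 2) : pd i (pd j f) y = pd j (pd i f) y := by
  have h2 : ContDiffAt ℝ ∞ f y := hf.contDiffAt (hO.mem_nhds hy)
  have hs : IsSymmSndFDerivAt ℝ f y := h2.isSymmSndFDerivAt (by simpa using ENat.LEInfty.out)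
  have hd : DifferentiableAt ℝ (fderiv ℝ f) y :=
    ((hf.fderiv_of_isOpen hO (m := ∞) (by simp)).contDiffAt (hO.mem_nhds hy)).differentiableAt
      (by simp)
  have key : ∀ a b : Fin 2, _root_.pd a (_root_.pd b f) y =
      fderiv ℝ (fderiv ℝ f) y (EuclideanSpace.single a 1) (EuclideanSpace.single b 1) := by
    intro a b
    unfold _root_.pd
    rw [fderiv_clm_apply hd (differentiableAt_const _)]
    simp
  rw [key, key]
  exact hs _ _

theorem pd_mul {a b : E2 → ℝ} {y : E2} (ha : DifferentiableAt ℝ a y) (hb : DifferentiableAt ℝ b y)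
    (i : Fin 2) : pd i (fun z => a z * b z) y = a y * pd i b y + b y * pd i a y := by
  unfold pd; rw [fderiv_fun_mul ha hb]; simp

theorem pd_add {a b : E2 → F} {y : E2} (ha : DifferentiableAt ℝ a y) (hb : DifferentiableAt ℝ b y)
    (i : Fin 2) : pd i (fun z => a z + b z) y = pd i a y + pd i b y := by
  unfold pd; rw [fderiv_fun_add ha hb]; simp

theorem pd_sub {a b : E2 → F} {y : E2} (ha : DifferentiableAt ℝ a y) (hb : DifferentiableAt ℝ b y)
    (i : Fin 2) : pd i (fun z => a z - b z) y = pd i a y - pd i b y := by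
  unfold pd; rw [fderiv_fun_sub ha hb]; simp

theorem pd_neg {a : E2 → F} {y : E2} (i : Fin 2) : pd i (fun z => - a z) y = - pd i a y := by
  unfold pd; rw [fderiv_fun_neg]; simp

theorem pd_const (c : F) (y : E2) (i : Fin 2) : pd i (fun _ => c) y = 0 := by
  unfold pd; simp

theorem pd_const_mul {a : E2 → ℝ} {y : E2} (ha : DifferentiableAt ℝ a y) (c : ℝ) (i : Fin 2) :
    pd i (fun z => c * a z) y = c * pd i a y := by
  rw [pd_mul (differentiableAt_const _) ha, pd_const]; ring

theorem pd_smul {a : E2 → ℝ} {b : E2 → F} {y : E2} (ha : DifferentiableAt ℝ a y)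
    (hb : DifferentiableAt ℝ b y) (i : Fin 2) :
    pd i (fun z => a z • b z) y = a y • pd i b y + pd i a y • b y := by
  unfold pd; rw [fderiv_fun_smul ha hb]; simp

theorem pd_comp_coord {φ : ℝ → ℝ} {φ' : ℝ} (i j : Fin 2) {y : E2} (h : HasDerivAt φ φ' (y j)) :
    pd i (fun z : E2 => φ (z j)) y = if i = j then φ' else 0 := by
  have h1 : HasFDerivAt (fun z : E2 => z j) (EuclideanSpace.proj j : E2 →L[ℝ] ℝ) y :=
    (EuclideanSpace.proj j : E2 →L[ℝ] ℝ).hasFDerivAt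
  have := (h.comp_hasFDerivAt y h1).fderiv
  unfold pd
  rw [show (fun z : E2 => φ (z j)) = φ ∘ fun z : E2 => z j from rfl, this]
  fin_cases i <;> fin_cases j <;> simp

/-- A continuous linear map commutes with partial derivatives. -/
theorem pd_clm_comp (L : F →L[ℝ] G) {f : E2 → F} {y : E2} (hf : DifferentiableAt ℝ f y)
    (i : Fin 2) : pd i (fun z => L (f z)) y = L (pd i f y) := by
  unfold pd
  rw [show (fun z => L (f z)) = L ∘ f from rfl, fderiv_comp y L.differentiableAt hf]
  simp

/-- The chain rule for partial derivatives. -/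
theorem pd_comp {X : E2 → F} {ψ : E2 → E2} {y : E2} (hX : DifferentiableAt ℝ X (ψ y))
    (hψ : DifferentiableAt ℝ ψ y) (i : Fin 2) :
    pd i (fun z => X (ψ z)) y =
      (pd i ψ y) 0 • pd 0 X (ψ y) + (pd i ψ y) 1 • pd 1 X (ψ y) := by
  unfold pd
  rw [show (fun z => X (ψ z)) = X ∘ ψ from rfl, fderiv_comp y hX hψ]
  exact fderiv_eq_pd X (ψ y) _

theorem eq_of_pd_eq_zero {h : E2 → ℝ} {O : Set E2} (hO : IsOpen O) (hc : IsPreconnected O)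
    (hd : ∀ y ∈ O, DifferentiableAt ℝ h y) (h0 : ∀ y ∈ O, pd 0 h y = 0)
    (h1 : ∀ y ∈ O, pd 1 h y = 0) {y z : E2} (hy : y ∈ O) (hz : z ∈ O) : h y = h z := by
  refine hO.is_const_of_fderiv_eq_zero (𝕜 := ℝ) hc
    (fun y hy => (hd y hy).differentiableWithinAt) (fun y hy => ?_) hy hz
  ext v
  rw [fderiv_eq_pd, h0 y hy, h1 y hy]; simp

/-- A function which is locally invariant under translations in the direction of the `i`-th axis has
a vanishing `i`-th partial derivative. -/
theorem pd_eq_zero_of_invariant {h : E2 → ℝ} {y : E2} (hd : DifferentiableAt ℝ h y) (i : Fin 2)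
    (hinv : ∀ᶠ t : ℝ in 𝓝 0, h (y + t • EuclideanSpace.single i 1) = h y) : pd i h y = 0 := by
  have h1 : HasDerivAt (fun t : ℝ => y + t • (EuclideanSpace.single i 1 : E2))
      (EuclideanSpace.single i 1) 0 := by
    simpa using ((hasDerivAt_id (0 : ℝ)).smul_const (EuclideanSpace.single i 1 : E2)).const_add y
  have hd' : HasFDerivAt h (fderiv ℝ h y) (y + (0 : ℝ) • (EuclideanSpace.single i 1 : E2)) := by
    simpa using hd.hasFDerivAt
  have h2 := hd'.comp_hasDerivAt (0 : ℝ) h1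
  have h3 : HasDerivAt (fun _ : ℝ => h y) 0 0 := hasDerivAt_const _ _
  exact (h2.congr_of_eventuallyEq (hinv.mono fun t ht => ht.symm)).unique h3

end PartialDerivatives

/-! ### Height functions in logarithmic polar coordinates -/

section LogPolar

/-- The squared length of the gradient of `f` in the logarithmic polar coordinates `(τ, θ)`, which
are the coordinates `y 0` and `y 1`. It is `r²` times the squared slope of the graph, where
`r = exp τ`. -/
def gradSq (f : E2 → ℝ) (y : E2) : ℝ := pd 0 f y ^ 2 + pd 1 f y ^ 2

/-- The numerator of the Gaussian curvature of the graph of `f` over the plane, when `f` is given in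
the logarithmic polar coordinates `(τ, θ)`, `r = exp τ`. -/
def curvNum (f : E2 → ℝ) (y : E2) : ℝ :=
  (pd 0 (pd 0 f) y - pd 0 f y) * (pd 1 (pd 1 f) y + pd 0 f y) - (pd 0 (pd 1 f) y - pd 1 f y) ^ 2

/-- The second-order differential equations satisfied by `z₀ + c exp (m τ) cos (m θ + b)`. The first
and the last make `f` harmonic, the first two make its gradient homogeneous of degree `m`. -/
def IsPowerJet (m : ℝ) (f : E2 → ℝ) (y : E2) : Prop :=
  pd 0 (pd 0 f) y = m * pd 0 f y ∧ pd 0 (pd 1 f) y = m * pd 1 f y ∧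
    pd 1 (pd 1 f) y = -m * pd 0 f y

variable {f : E2 → ℝ} {O : Set E2}

theorem ContDiffOn.gradSq (hf : ContDiffOn ℝ ∞ f O) (hO : IsOpen O) :
    ContDiffOn ℝ ∞ (gradSq f) O :=
  ((hf.pd hO 0).pow 2).add ((hf.pd hO 1).pow 2)

theorem ContDiffOn.curvNum (hf : ContDiffOn ℝ ∞ f O) (hO : IsOpen O) :
    ContDiffOn ℝ ∞ (curvNum f) O := by
  have h0 := hf.pd hO 0
  have h1 := hf.pd hO 1
  exact (((h0.pd hO 0).sub h0).mul ((h1.pd hO 1).add h0)).sub (((h1.pd hO 0).sub h1).pow 2)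

theorem pd_gradSq (hf : ContDiffOn ℝ ∞ f O) (hO : IsOpen O) {y : E2} (hy : y ∈ O) (i : Fin 2) :
    pd i (gradSq f) y = 2 * (pd 0 f y * pd i (pd 0 f) y + pd 1 f y * pd i (pd 1 f) y) := by
  have d0 := (hf.pd hO 0).differentiableAt_of_isOpen hO hy
  have d1 := (hf.pd hO 1).differentiableAt_of_isOpen hO hy
  have : gradSq f = fun z => pd 0 f z * pd 0 f z + pd 1 f z * pd 1 f z := by
    funext z; simp [gradSq]; ring
  rw [this, pd_add (d0.fun_mul d0) (d1.fun_mul d1), pd_mul d0 d0, pd_mul d1 d1]; ring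

/-- The derivative in the direction `θ` of the angle between the gradient and the radial direction.
-/
def gradTurn (f : E2 → ℝ) (y : E2) : ℝ :=
  (pd 0 f y * pd 1 (pd 1 f) y - pd 1 f y * pd 0 (pd 1 f) y) / gradSq f y

theorem ContDiffOn.gradTurn (hf : ContDiffOn ℝ ∞ f O) (hO : IsOpen O)
    (hg : ∀ y ∈ O, _root_.gradSq f y ≠ 0) : ContDiffOn ℝ ∞ (gradTurn f) O := by
  have h0 := hf.pd hO 0
  have h1 := hf.pd hO 1
  exact ((h0.mul (h1.pd hO 1)).sub (h1.mul (h1.pd hO 0))).div (hf.gradSq hO) hg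

/-- If the slope does not depend on `θ`, then it vanishes only where the curvature vanishes. -/
theorem gradSq_ne_zero (hf : ContDiffOn ℝ ∞ f O) (hO : IsOpen O)
    (hg1 : ∀ y ∈ O, pd 1 (gradSq f) y = 0) {y : E2} (hy : y ∈ O) (hk : curvNum f y ≠ 0) :
    gradSq f y ≠ 0 := by
  intro h0
  -- At a zero of the gradient the second `θ`-derivative of `gradSq f` is `2 (f_τθ² + f_θθ²)`, so
  -- that all derivatives but `f_ττ` vanish there.
  have e0 : pd 0 f y = 0 := by
    unfold gradSq at h0; nlinarith [sq_nonneg (pd 0 f y), sq_nonneg (pd 1 f y)]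
  have e1 : pd 1 f y = 0 := by
    unfold gradSq at h0; nlinarith [sq_nonneg (pd 0 f y), sq_nonneg (pd 1 f y)]
  have hev : (fun z => pd 0 f z * pd 1 (pd 0 f) z + pd 1 f z * pd 1 (pd 1 f) z) =ᶠ[𝓝 y]
      fun _ => (0 : ℝ) := by
    filter_upwards [hO.mem_nhds hy] with z hz
    have := hg1 z hz
    rw [pd_gradSq hf hO hz] at this; linarith
  have h := pd_congr hev 1
  have f0 := hf.pd hO 0
  have f1 := hf.pd hO 1
  have d0 := f0.differentiableAt_of_isOpen hO hy
  have d1 := f1.differentiableAt_of_isOpen hO hy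
  have d10 := (f0.pd hO 1).differentiableAt_of_isOpen hO hy
  have d11 := (f1.pd hO 1).differentiableAt_of_isOpen hO hy
  rw [pd_const, pd_add (d0.fun_mul d10) (d1.fun_mul d11), pd_mul d0 d10, pd_mul d1 d11, e0, e1] at h
  have hc := pd_comm hf hO hy 1 0
  apply hk
  have a : pd 0 (pd 1 f) y = 0 := by
    rw [← hc]; nlinarith [sq_nonneg (pd 1 (pd 0 f) y), sq_nonneg (pd 1 (pd 1 f) y)]
  have b : pd 1 (pd 1 f) y = 0 := by
    nlinarith [sq_nonneg (pd 1 (pd 0 f) y), sq_nonneg (pd 1 (pd 1 f) y)]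
  simp [curvNum, a, b, e0, e1]

/-- Where the slope does not depend on `θ`, the gradient has constant length along circles, so its
`θ`-derivative is a multiple of the gradient rotated by a right angle. -/
theorem pd_one_grad (hf : ContDiffOn ℝ ∞ f O) (hO : IsOpen O)
    {y : E2} (hy : y ∈ O) (hg1 : pd 1 (gradSq f) y = 0) (hg : gradSq f y ≠ 0) :
    pd 0 (pd 1 f) y = -gradTurn f y * pd 1 f y ∧ pd 1 (pd 1 f) y = gradTurn f y * pd 0 f y := by
  rw [pd_gradSq hf hO hy, pd_comm hf hO hy 1 0] at hg1
  unfold gradTurn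
  constructor
  · field_simp
    unfold gradSq
    linear_combination (1 / 2) * pd 0 f y * hg1
  · field_simp
    unfold gradSq
    linear_combination (1 / 2) * pd 1 f y * hg1

/-- The factor `1 + gradTurn f` is the rate of turning of the gradient relative to fixed directions
of the plane. -/
theorem curvNum_eq (hf : ContDiffOn ℝ ∞ f O) (hO : IsOpen O)
    {y : E2} (hy : y ∈ O) (hg1 : pd 1 (gradSq f) y = 0) (hg : gradSq f y ≠ 0) :
    curvNum f y = (1 + gradTurn f y) * (pd 0 (gradSq f) y / 2 - gradSq f y) := by
  obtain ⟨h1, h2⟩ := pd_one_grad hf hO hy hg1 hg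
  rw [pd_gradSq hf hO hy]
  unfold curvNum gradSq
  rw [h1, h2]; ring

/-- If the curvature does not depend on `θ` either, then neither does the rate at which the gradient
turns, since the second factor in `curvNum_eq` is independent of `θ`. -/
theorem pd_one_gradTurn (hf : ContDiffOn ℝ ∞ f O) (hO : IsOpen O)
    (hg1 : ∀ y ∈ O, pd 1 (gradSq f) y = 0) (hg : ∀ y ∈ O, gradSq f y ≠ 0)
    (hk1 : ∀ y ∈ O, pd 1 (curvNum f) y = 0) {y : E2} (hy : y ∈ O) (hk : curvNum f y ≠ 0) :
    pd 1 (gradTurn f) y = 0 := by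
  have hev : curvNum f =ᶠ[𝓝 y]
      fun z => (1 + gradTurn f z) * (pd 0 (gradSq f) z * (1 / 2) - gradSq f z) := by
    filter_upwards [hO.mem_nhds hy] with z hz
    rw [curvNum_eq hf hO hz (hg1 z hz) (hg z hz)]; ring
  have h := pd_congr hev 1
  have sA := hf.gradTurn hO hg
  have sg := hf.gradSq hO
  have dA := sA.differentiableAt_of_isOpen hO hy
  have dg := sg.differentiableAt_of_isOpen hO hy
  have dg0 := (sg.pd hO 0).differentiableAt_of_isOpen hO hy
  have h01 : pd 1 (pd 0 (gradSq f)) y = 0 := by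
    rw [pd_comm sg hO hy 1 0,
      pd_congr (g := fun _ => (0 : ℝ)) (by filter_upwards [hO.mem_nhds hy] with z hz using hg1 z hz),
      pd_const]
  rw [hk1 y hy, pd_mul ((differentiableAt_const _).fun_add dA) ((dg0.mul_const _).fun_sub dg),
    pd_add (differentiableAt_const _) dA, pd_const,
    pd_sub (dg0.mul_const _) dg, pd_mul dg0 (differentiableAt_const _), pd_const, h01, hg1 y hy] at h
  rw [curvNum_eq hf hO hy (hg1 y hy) (hg y hy)] at hk
  have hk' := right_ne_zero_of_mul hk
  have : (pd 0 (gradSq f) y * (1 / 2) - gradSq f y) * pd 1 (gradTurn f) y = 0 := by linarith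
  rcases mul_eq_zero.1 this with h' | h'
  · exact absurd (by linarith) hk'
  · exact h'

/-- Where the gradient turns relative to the radial direction, the rate of turning is locally
constant. -/
theorem pd_zero_gradTurn (hf : ContDiffOn ℝ ∞ f O) (hO : IsOpen O)
    (hg1 : ∀ y ∈ O, pd 1 (gradSq f) y = 0) (hg : ∀ y ∈ O, gradSq f y ≠ 0)
    (hA1 : ∀ y ∈ O, pd 1 (gradTurn f) y = 0) {y : E2} (hy : y ∈ O) (hA : gradTurn f y ≠ 0) :
    pd 0 (gradTurn f) y = 0 := by
  have sA := hf.gradTurn hO hg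
  have sA0 := sA.pd hO 0
  have s0 := hf.pd hO 0
  have s1 := hf.pd hO 1
  set A := gradTurn f with hAdef
  have h01 : ∀ z ∈ O, pd 0 (pd 1 f) z = -A z * pd 1 f z := fun z hz =>
    (pd_one_grad hf hO hz (hg1 z hz) (hg z hz)).1
  have h11 : ∀ z ∈ O, pd 1 (pd 1 f) z = A z * pd 0 f z := fun z hz =>
    (pd_one_grad hf hO hz (hg1 z hz) (hg z hz)).2
  -- The two third derivatives `f_τθθ` and `f_θθτ` agree.
  have hstar : ∀ z ∈ O, A z * pd 0 (pd 0 f) z + (pd 0 A z + A z * A z) * pd 0 f z = 0 := by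
    intro z hz
    have dA := sA.differentiableAt_of_isOpen hO hz
    have d0 := s0.differentiableAt_of_isOpen hO hz
    have d1 := s1.differentiableAt_of_isOpen hO hz
    have e1 : pd 1 (pd 0 (pd 1 f)) z = -A z * (A z * pd 0 f z) := by
      rw [pd_congr (g := fun z => -A z * pd 1 f z)
        (by filter_upwards [hO.mem_nhds hz] with z hz using h01 z hz) 1,
        pd_mul dA.fun_neg d1, pd_neg, hA1 z hz, h11 z hz]; ring
    have e2 : pd 0 (pd 1 (pd 1 f)) z = A z * pd 0 (pd 0 f) z + pd 0 f z * pd 0 A z := by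
      rw [pd_congr (g := fun z => A z * pd 0 f z)
        (by filter_upwards [hO.mem_nhds hz] with z hz using h11 z hz) 0, pd_mul dA d0]
    have := pd_comm s1 hO hz 1 0
    rw [e1, e2] at this
    linarith
  -- Differentiating this relation along `θ` leaves only the product `A A' f_θ`.
  have hprod : ∀ z ∈ O, A z * pd 0 A z * pd 1 f z = 0 := by
    intro z hz
    have dA := sA.differentiableAt_of_isOpen hO hz
    have dA0 := sA0.differentiableAt_of_isOpen hO hz
    have d0 := s0.differentiableAt_of_isOpen hO hz
    have d1 := s1.differentiableAt_of_isOpen hO hz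
    have d00 := (s0.pd hO 0).differentiableAt_of_isOpen hO hz
    have e := pd_congr (f := fun z => A z * pd 0 (pd 0 f) z + (pd 0 A z + A z * A z) * pd 0 f z)
      (g := fun _ => (0 : ℝ)) (y := z)
      (by filter_upwards [hO.mem_nhds hz] with z hz using hstar z hz) 1
    have hA01 : pd 1 (pd 0 A) z = 0 := by
      rw [pd_comm sA hO hz 1 0, pd_congr (g := fun _ => (0 : ℝ))
        (by filter_upwards [hO.mem_nhds hz] with z hz using hA1 z hz), pd_const]
    have h001 : pd 1 (pd 0 (pd 0 f)) z = -pd 0 A z * pd 1 f z + A z * A z * pd 1 f z := by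
      rw [pd_comm s0 hO hz 1 0, pd_congr (g := fun z => -A z * pd 1 f z)
        (by filter_upwards [hO.mem_nhds hz] with z hz; rw [pd_comm hf hO hz 1 0, h01 z hz]) 0,
        pd_mul dA.fun_neg d1, pd_neg, h01 z hz]; ring
    rw [pd_const, pd_add (dA.fun_mul d00) ((dA0.fun_add (dA.fun_mul dA)).fun_mul d0), pd_mul dA d00,
      pd_mul (dA0.fun_add (dA.fun_mul dA)) d0, pd_add dA0 (dA.fun_mul dA), pd_mul dA dA, hA1 z hz,
      hA01, pd_comm hf hO hz 1 0, h01 z hz, h001] at e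
    linarith
  by_contra hne
  have hev : pd 1 f =ᶠ[𝓝 y] fun _ => (0 : ℝ) := by
    have cA : ContinuousAt A y := (sA.differentiableAt_of_isOpen hO hy).continuousAt
    have cA0 : ContinuousAt (pd 0 A) y := (sA0.differentiableAt_of_isOpen hO hy).continuousAt
    filter_upwards [hO.mem_nhds hy, cA.eventually_ne hA, cA0.eventually_ne hne] with z hz ha hb
    exact (mul_eq_zero.1 (hprod z hz)).resolve_left (mul_ne_zero ha hb)
  have e11 := pd_congr hev 1
  rw [pd_const, h11 y hy] at e11
  have e0 := (mul_eq_zero.1 e11).resolve_left hA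
  exact hg y hy (by simp [gradSq, e0, hev.eq_of_nhds])

/-- If slope and curvature of a graph do not depend on `θ` and the gradient turns relative to the
radial direction, then the graph satisfies the equations of a power, with the rate of turning as the
exponent, up to sign. -/
theorem isPowerJet_of_gradTurn_ne_zero (hf : ContDiffOn ℝ ∞ f O) (hO : IsOpen O)
    (hg1 : ∀ y ∈ O, pd 1 (gradSq f) y = 0) (hk1 : ∀ y ∈ O, pd 1 (curvNum f) y = 0) {y : E2}
    (hy : y ∈ O) (hk : curvNum f y ≠ 0) (hA : gradTurn f y ≠ 0) :
    ∀ᶠ z in 𝓝 y, IsPowerJet (-gradTurn f y) f z ∧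
      gradSq f z = gradSq f y * Real.exp (-2 * gradTurn f y * (z 0 - y 0)) := by
  -- Restrict to a ball on which nothing vanishes.
  have ck : ContinuousAt (curvNum f) y :=
    ((hf.curvNum hO).differentiableAt_of_isOpen hO hy).continuousAt
  obtain ⟨O', hO'sub, hO', hyO'⟩ : ∃ O' ⊆ O, IsOpen O' ∧ y ∈ O' ∧ ∀ z ∈ O', curvNum f z ≠ 0 := by
    obtain ⟨V, hV, hVo, hyV⟩ := eventually_nhds_iff.1 ((ck.eventually_ne hk).and (hO.mem_nhds hy))
    exact ⟨V, fun z hz => (hV z hz).2, hVo, hyV, fun z hz => (hV z hz).1⟩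
  have hg' : ∀ z ∈ O', gradSq f z ≠ 0 := fun z hz =>
    gradSq_ne_zero hf hO hg1 (hO'sub hz) (hyO'.2 z hz)
  have hf' := hf.mono hO'sub
  have sA := hf'.gradTurn hO' hg'
  have cA : ContinuousAt (gradTurn f) y := (sA.differentiableAt_of_isOpen hO' hyO'.1).continuousAt
  obtain ⟨ε, hε, hball⟩ := Metric.eventually_nhds_iff_ball.1
    ((cA.eventually_ne hA).and (hO'.mem_nhds hyO'.1))
  have hA1 : ∀ z ∈ O', pd 1 (gradTurn f) z = 0 := fun z hz =>
    pd_one_gradTurn hf' hO' (fun z hz => hg1 z (hO'sub hz)) hg' (fun z hz => hk1 z (hO'sub hz)) hz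
      (hyO'.2 z hz)
  have hBo : IsOpen (Metric.ball y ε) := Metric.isOpen_ball
  have hBc : IsPreconnected (Metric.ball y ε) := (convex_ball y ε).isPreconnected
  have hyB : y ∈ Metric.ball y ε := Metric.mem_ball_self hε
  have hconst : ∀ z ∈ Metric.ball y ε, gradTurn f z = gradTurn f y := fun z hz =>
    eq_of_pd_eq_zero hBo hBc
      (fun z hz => sA.differentiableAt_of_isOpen hO' (hball z hz).2)
      (fun z hz => pd_zero_gradTurn hf' hO' (fun z hz => hg1 z (hO'sub hz)) hg' hA1 (hball z hz).2
        (hball z hz).1)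
      (fun z hz => hA1 z (hball z hz).2) hz hyB
  set a := gradTurn f y with ha
  have hrel : ∀ z ∈ Metric.ball y ε, pd 0 (pd 1 f) z = -a * pd 1 f z ∧
      pd 1 (pd 1 f) z = a * pd 0 f z := by
    intro z hz
    have := pd_one_grad hf' hO' (hball z hz).2 (hg1 z (hO'sub (hball z hz).2)) (hg' z (hball z hz).2)
    rwa [hconst z hz] at this
  have h00 : ∀ z ∈ Metric.ball y ε, pd 0 (pd 0 f) z = -a * pd 0 f z := by
    intro z hz
    have hzO := hO'sub (hball z hz).2
    have d0 := (hf.pd hO 0).differentiableAt_of_isOpen hO hzO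
    have d1 := (hf.pd hO 1).differentiableAt_of_isOpen hO hzO
    have e1 : pd 1 (pd 0 (pd 1 f)) z = -a * (a * pd 0 f z) := by
      rw [pd_congr (g := fun z => -a * pd 1 f z)
        (by filter_upwards [hBo.mem_nhds hz] with z hz using (hrel z hz).1) 1,
        pd_const_mul d1, (hrel z hz).2]
    have e2 : pd 0 (pd 1 (pd 1 f)) z = a * pd 0 (pd 0 f) z := by
      rw [pd_congr (g := fun z => a * pd 0 f z)
        (by filter_upwards [hBo.mem_nhds hz] with z hz using (hrel z hz).2) 0, pd_const_mul d0]
    have := pd_comm (hf.pd hO 1) hO hzO 1 0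
    rw [e1, e2] at this
    exact mul_left_cancel₀ hA (by linarith)
  filter_upwards [hBo.mem_nhds hyB] with z hz
  refine ⟨⟨h00 z hz, (hrel z hz).1, by rw [(hrel z hz).2]; ring⟩, ?_⟩
  have key := eq_of_pd_eq_zero (h := fun z => gradSq f z * Real.exp (2 * a * z 0)) hBo hBc
    ?_ ?_ ?_ hz hyB
  · have : gradSq f z = gradSq f z * Real.exp (2 * a * z 0) * Real.exp (-(2 * a * z 0)) := by
      rw [mul_assoc, ← Real.exp_add]; simp
    rw [this]
    simp only at key
    rw [key, mul_assoc, ← Real.exp_add]; congr 2; ring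
  · intro z hz
    exact ((hf.gradSq hO).differentiableAt_of_isOpen hO (hO'sub (hball z hz).2)).fun_mul
      (by fun_prop)
  · intro z hz
    have hzO := hO'sub (hball z hz).2
    have := pd_comp_coord (φ := fun s => Real.exp (2 * a * s))
      (φ' := Real.exp (2 * a * z 0) * (2 * a)) 0 0 (y := z)
      (by simpa using ((hasDerivAt_id (z 0)).const_mul (2 * a)).exp)
    rw [pd_mul ((hf.gradSq hO).differentiableAt_of_isOpen hO hzO) (by fun_prop), this,
      pd_gradSq hf hO hzO, h00 z hz, (hrel z hz).1, gradSq]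
    simp; ring
  · intro z hz
    have hzO := hO'sub (hball z hz).2
    have := pd_comp_coord (φ := fun s => Real.exp (2 * a * s))
      (φ' := Real.exp (2 * a * z 0) * (2 * a)) 1 0 (y := z)
      (by simpa using ((hasDerivAt_id (z 0)).const_mul (2 * a)).exp)
    rw [pd_mul ((hf.gradSq hO).differentiableAt_of_isOpen hO hzO) (by fun_prop), this, hg1 z hzO]
    simp

/-- The helicoidal case: if the gradient does not turn relative to the radial direction, then `f_θ`
is stationary. -/
theorem pd_pd_one_eq_zero (hf : ContDiffOn ℝ ∞ f O) (hO : IsOpen O)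
    (hg1 : ∀ y ∈ O, pd 1 (gradSq f) y = 0) {y : E2}
    (hy : y ∈ O) (hk : curvNum f y ≠ 0) (hA : gradTurn f y = 0) (i : Fin 2) :
    pd i (pd 1 f) y = 0 := by
  have := pd_one_grad hf hO hy (hg1 y hy) (gradSq_ne_zero hf hO hg1 hy hk)
  rw [hA] at this
  fin_cases i
  · simpa using this.1
  · simpa using this.2

theorem curvNum_of_isPowerJet {m : ℝ} {y : E2} (h : IsPowerJet m f y) :
    curvNum f y = -(m - 1) ^ 2 * gradSq f y := by
  obtain ⟨h1, h2, h3⟩ := h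
  unfold curvNum gradSq
  rw [h1, h2, h3]; ring

theorem gradTurn_of_isPowerJet {m : ℝ} {y : E2} (h : IsPowerJet m f y) (hg : gradSq f y ≠ 0) :
    gradTurn f y = -m := by
  obtain ⟨h1, h2, h3⟩ := h
  unfold gradTurn
  rw [h2, h3]; field_simp; unfold gradSq; ring

/-- On a connected set, the solutions of the equations of a power are `a exp (m τ) cos (m θ + b)` up
to an additive constant. -/
theorem eq_power_of_isPowerJet {m : ℝ} (hm : m ≠ 0) (hf : ContDiffOn ℝ ∞ f O) (hO : IsOpen O)
    (hc : IsPreconnected O) (hne : O.Nonempty) (h : ∀ y ∈ O, IsPowerJet m f y) :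
    ∃ z₀ a b : ℝ, (∀ y ∈ O, f y = z₀ + a * Real.exp (m * y 0) * Real.cos (m * y 1 + b)) ∧
      0 ≤ a ∧ ∀ y ∈ O, gradSq f y = a ^ 2 * m ^ 2 * Real.exp (2 * m * y 0) := by
  have h0 := hf.pd hO 0
  have h1 := hf.pd hO 1
  have dE : ∀ (k : ℝ) (y : E2) (i : Fin 2), pd i (fun z : E2 => Real.exp (k * z 0)) y =
      if i = 0 then k * Real.exp (k * y 0) else 0 := fun k y i => by
    rw [pd_comp_coord (φ := fun s => Real.exp (k * s)) (φ' := Real.exp (k * y 0) * k) i 0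
      (by simpa using ((hasDerivAt_id (y 0)).const_mul k).exp), mul_comm]
  have dC : ∀ (y : E2) (i : Fin 2), pd i (fun z : E2 => Real.cos (m * z 1)) y =
      if i = 1 then -m * Real.sin (m * y 1) else 0 := fun y i => by
    rw [pd_comp_coord (φ := fun s => Real.cos (m * s)) (φ' := -Real.sin (m * y 1) * m) i 1
      (by simpa using ((hasDerivAt_id (y 1)).const_mul m).cos)]
    congr 1; ring
  have dS : ∀ (y : E2) (i : Fin 2), pd i (fun z : E2 => Real.sin (m * z 1)) y =
      if i = 1 then m * Real.cos (m * y 1) else 0 := fun y i => by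
    rw [pd_comp_coord (φ := fun s => Real.sin (m * s)) (φ' := Real.cos (m * y 1) * m) i 1
      (by simpa using ((hasDerivAt_id (y 1)).const_mul m).sin)]
    congr 1; ring
  obtain ⟨y₀, hy₀⟩ := hne
  -- The additive constant and the two components of the gradient, transported to `τ = θ = 0`, are
  -- first integrals.
  have i1 : ∀ y ∈ O, f y - m⁻¹ * pd 0 f y = f y₀ - m⁻¹ * pd 0 f y₀ := by
    intro y hy
    refine eq_of_pd_eq_zero (h := fun y => f y - m⁻¹ * pd 0 f y) hO hc ?_ ?_ ?_ hy hy₀ <;>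
      intro z hz
    · exact (hf.differentiableAt_of_isOpen hO hz).fun_sub
        ((h0.differentiableAt_of_isOpen hO hz).const_mul _)
    · rw [pd_sub (hf.differentiableAt_of_isOpen hO hz)
        ((h0.differentiableAt_of_isOpen hO hz).const_mul _),
        pd_const_mul (h0.differentiableAt_of_isOpen hO hz), (h z hz).1]; field_simp; ring
    · rw [pd_sub (hf.differentiableAt_of_isOpen hO hz)
        ((h0.differentiableAt_of_isOpen hO hz).const_mul _),
        pd_const_mul (h0.differentiableAt_of_isOpen hO hz), pd_comm hf hO hz 1 0, (h z hz).2.1]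
      field_simp; ring
  have hd0 := fun z hz => h0.differentiableAt_of_isOpen hO (y := z) hz
  have hd1 := fun z hz => h1.differentiableAt_of_isOpen hO (y := z) hz
  have cC : ∀ z : E2, DifferentiableAt ℝ (fun z : E2 => Real.cos (m * z 1)) z := by
    intro z; fun_prop
  have cS : ∀ z : E2, DifferentiableAt ℝ (fun z : E2 => Real.sin (m * z 1)) z := by
    intro z; fun_prop
  have cE : ∀ z : E2, DifferentiableAt ℝ (fun z : E2 => Real.exp (-m * z 0)) z := by
    intro z; fun_prop
  obtain ⟨κ₁, i2⟩ : ∃ κ, ∀ y ∈ O, Real.exp (-m * y 0) *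
      (pd 0 f y * Real.cos (m * y 1) - pd 1 f y * Real.sin (m * y 1)) = κ := by
    refine ⟨_, fun y hy => eq_of_pd_eq_zero (h := fun y => Real.exp (-m * y 0) *
      (pd 0 f y * Real.cos (m * y 1) - pd 1 f y * Real.sin (m * y 1))) hO hc ?_ ?_ ?_ hy hy₀⟩ <;>
      intro z hz
    · exact (cE z).fun_mul (((hd0 z hz).fun_mul (cC z)).fun_sub ((hd1 z hz).fun_mul (cS z)))
    all_goals
      rw [pd_mul (cE z) (((hd0 z hz).fun_mul (cC z)).fun_sub ((hd1 z hz).fun_mul (cS z))), dE,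
        pd_sub ((hd0 z hz).fun_mul (cC z)) ((hd1 z hz).fun_mul (cS z)), pd_mul (hd0 z hz) (cC z),
        pd_mul (hd1 z hz) (cS z), dC, dS]
      obtain ⟨e1, e2, e3⟩ := h z hz
    · rw [e1, e2]; simp; ring
    · rw [pd_comm hf hO hz 1 0, e2, e3]; simp; ring
  obtain ⟨κ₂, i3⟩ : ∃ κ, ∀ y ∈ O, Real.exp (-m * y 0) *
      (pd 0 f y * Real.sin (m * y 1) + pd 1 f y * Real.cos (m * y 1)) = κ := by
    refine ⟨_, fun y hy => eq_of_pd_eq_zero (h := fun y => Real.exp (-m * y 0) *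
      (pd 0 f y * Real.sin (m * y 1) + pd 1 f y * Real.cos (m * y 1))) hO hc ?_ ?_ ?_ hy hy₀⟩ <;>
      intro z hz
    · exact (cE z).fun_mul (((hd0 z hz).fun_mul (cS z)).fun_add ((hd1 z hz).fun_mul (cC z)))
    all_goals
      rw [pd_mul (cE z) (((hd0 z hz).fun_mul (cS z)).fun_add ((hd1 z hz).fun_mul (cC z))), dE,
        pd_add ((hd0 z hz).fun_mul (cS z)) ((hd1 z hz).fun_mul (cC z)), pd_mul (hd0 z hz) (cS z),
        pd_mul (hd1 z hz) (cC z), dC, dS]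
      obtain ⟨e1, e2, e3⟩ := h z hz
    · rw [e1, e2]; simp; ring
    · rw [pd_comm hf hO hz 1 0, e2, e3]; simp; ring
  -- Amplitude and phase of `κ₁ - i κ₂`.
  set κ : ℂ := ⟨κ₁, -κ₂⟩ with hκ
  have hre : ‖κ‖ * Real.cos κ.arg = κ₁ := by rw [Complex.norm_mul_cos_arg]
  have him : ‖κ‖ * Real.sin κ.arg = -κ₂ := by rw [Complex.norm_mul_sin_arg]
  have hE : ∀ y : E2, Real.exp (m * y 0) * Real.exp (-m * y 0) = 1 := fun y => by
    rw [← Real.exp_add]; simp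
  have hsq : ∀ y : E2, Real.sin (m * y 1) ^ 2 + Real.cos (m * y 1) ^ 2 = 1 := fun y =>
    Real.sin_sq_add_cos_sq _
  have f0 : ∀ y ∈ O, pd 0 f y = Real.exp (m * y 0) *
      (κ₁ * Real.cos (m * y 1) + κ₂ * Real.sin (m * y 1)) := by
    intro y hy
    rw [← i2 y hy, ← i3 y hy]
    linear_combination (-pd 0 f y) * hE y -
      pd 0 f y * (Real.exp (m * y 0) * Real.exp (-m * y 0)) * hsq y
  have f1 : ∀ y ∈ O, pd 1 f y = Real.exp (m * y 0) *
      (-κ₁ * Real.sin (m * y 1) + κ₂ * Real.cos (m * y 1)) := by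
    intro y hy
    rw [← i2 y hy, ← i3 y hy]
    linear_combination (-pd 1 f y) * hE y -
      pd 1 f y * (Real.exp (m * y 0) * Real.exp (-m * y 0)) * hsq y
  have hm2 : (if 0 < m then (0 : ℝ) else Real.pi) = 0 ∧ |m| = m ∨
      (if 0 < m then (0 : ℝ) else Real.pi) = Real.pi ∧ |m| = -m := by
    split_ifs with h
    · exact Or.inl ⟨rfl, abs_of_pos h⟩
    · exact Or.inr ⟨rfl, abs_of_nonpos (not_lt.1 h)⟩
  refine ⟨f y₀ - m⁻¹ * pd 0 f y₀, ‖κ‖ / |m|, κ.arg + if 0 < m then 0 else Real.pi, fun y hy => ?_,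
    by positivity, fun y hy => ?_⟩
  · have e := i1 y hy
    rw [f0 y hy, ← hre, (by linarith : κ₂ = -(‖κ‖ * Real.sin κ.arg))] at e
    rw [← e]
    rcases hm2 with ⟨h1, h2⟩ | ⟨h1, h2⟩ <;> rw [h1, h2]
    · rw [add_zero, Real.cos_add]; field_simp; ring
    · rw [← add_assoc, Real.cos_add_pi, Real.cos_add]; field_simp; ring
  · have hn : ‖κ‖ ^ 2 = κ₁ ^ 2 + κ₂ ^ 2 := by
      rw [← Complex.normSq_eq_norm_sq, Complex.normSq_apply, hκ]; ring
    rw [div_pow, sq_abs, div_mul_cancel₀ _ (pow_ne_zero 2 hm), hn, gradSq, f0 y hy, f1 y hy,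
      show 2 * m * y 0 = m * y 0 + m * y 0 by ring, Real.exp_add]
    linear_combination (Real.exp (m * y 0) ^ 2 * (κ₁ ^ 2 + κ₂ ^ 2)) * hsq y

end LogPolar

/-! ### Vector products and Gaussian curvature of parametrized surfaces -/

section Cross

theorem inner_e3 (u v : E3) : inner ℝ u v = u 0 * v 0 + u 1 * v 1 + u 2 * v 2 := by
  simp [PiLp.inner_apply, Fin.sum_univ_three, mul_comm]

theorem cross3_apply_zero (u v : E3) : cross3 u v 0 = u 1 * v 2 - u 2 * v 1 := by
  simp [cross3, crossProduct]

theorem cross3_apply_one (u v : E3) : cross3 u v 1 = u 2 * v 0 - u 0 * v 2 := by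
  simp [cross3, crossProduct]

theorem cross3_apply_two (u v : E3) : cross3 u v 2 = u 0 * v 1 - u 1 * v 0 := by
  simp [cross3, crossProduct]

theorem norm_sq_e3 (u : E3) : ‖u‖ ^ 2 = u 0 ^ 2 + u 1 ^ 2 + u 2 ^ 2 := by
  rw [← real_inner_self_eq_norm_sq, inner_e3]; ring

theorem norm_cross3_sq (u v : E3) :
    ‖cross3 u v‖ ^ 2 = inner ℝ u u * inner ℝ v v - inner ℝ u v ^ 2 := by
  rw [norm_sq_e3]
  simp only [cross3_apply_zero, cross3_apply_one, cross3_apply_two, inner_e3]; ring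

theorem inner_cross3_left (u v : E3) : inner ℝ (cross3 u v) u = 0 := by
  simp only [cross3_apply_zero, cross3_apply_one, cross3_apply_two, inner_e3]; ring

theorem inner_cross3_right (u v : E3) : inner ℝ (cross3 u v) v = 0 := by
  simp only [cross3_apply_zero, cross3_apply_one, cross3_apply_two, inner_e3]; ring

/-- The product of two triple products with common first two vectors is a Gram determinant; hence it
is invariant under all linear isometries, orientation-reversing ones included. -/
theorem inner_cross3_mul_inner_cross3 (a b c d : E3) :
    inner ℝ (cross3 a b) c * inner ℝ (cross3 a b) d =
      inner ℝ a a * (inner ℝ b b * inner ℝ c d - inner ℝ b d * inner ℝ c b)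
      - inner ℝ a b * (inner ℝ b a * inner ℝ c d - inner ℝ b d * inner ℝ c a)
      + inner ℝ a d * (inner ℝ b a * inner ℝ c b - inner ℝ b b * inner ℝ c a) := by
  simp only [cross3_apply_zero, cross3_apply_one, cross3_apply_two, inner_e3]; ring

theorem cross3_linear_combination (u v : E3) (a b c d : ℝ) :
    cross3 (a • u + b • v) (c • u + d • v) = (a * d - b * c) • cross3 u v := by
  ext i; fin_cases i <;>
  simp [cross3_apply_zero, cross3_apply_one, cross3_apply_two] <;> ring

theorem norm_cross3_map (L : E3 ≃ₗᵢ[ℝ] E3) (u v : E3) : ‖cross3 (L u) (L v)‖ = ‖cross3 u v‖ := by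
  rw [← sq_eq_sq₀ (norm_nonneg _) (norm_nonneg _), norm_cross3_sq, norm_cross3_sq]
  simp only [LinearIsometryEquiv.inner_map_map]

end Cross

section Curvature

/-- The normal `X_u × X_v` of a parametrized surface. -/
def crossNormal (X : E2 → E3) (y : E2) : E3 := cross3 (pd 0 X y) (pd 1 X y)

/-- The determinant of the second fundamental form relative to the normal `X_u × X_v`, which is not
normalized. -/
def rawCurv (X : E2 → E3) (y : E2) : ℝ :=
  inner ℝ (crossNormal X y) (pd 0 (pd 0 X) y) * inner ℝ (crossNormal X y) (pd 1 (pd 1 X) y) -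
    inner ℝ (crossNormal X y) (pd 0 (pd 1 X) y) ^ 2

/-- With both sides zero where the parametrization is not regular, this holds without exception. -/
theorem paramGaussianCurvature_eq (X : E2 → E3) (y : E2) :
    paramGaussianCurvature X y = rawCurv X y / ‖crossNormal X y‖ ^ 4 := by
  have hden : firstFF X y 0 0 * firstFF X y 1 1 - firstFF X y 0 1 ^ 2 = ‖crossNormal X y‖ ^ 2 := by
    rw [crossNormal, norm_cross3_sq]; rfl
  have hs : ∀ i j, secondFF X y i j =
      ‖crossNormal X y‖⁻¹ * inner ℝ (crossNormal X y) (pd i (pd j X) y) := by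
    intro i j
    unfold secondFF unitNormal
    rw [inner_smul_right, real_inner_comm]; rfl
  unfold paramGaussianCurvature
  rw [hden, hs, hs, hs]
  by_cases h : ‖crossNormal X y‖ = 0
  · simp [h]
  · unfold rawCurv; field_simp

theorem paramGaussianCurvature_congr {X Y : E2 → E3} {y : E2} (h : X =ᶠ[𝓝 y] Y) :
    paramGaussianCurvature X y = paramGaussianCurvature Y y := by
  have h2 : ∀ i j, pd i (pd j X) y = pd i (pd j Y) y := fun i j =>
    pd_congr (pd_congr_eventually h j) i
  simp only [paramGaussianCurvature_eq, rawCurv, crossNormal, h2, pd_congr h]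

/-- The second derivatives of a reparametrized surface, up to tangential terms. -/
theorem inner_pd_pd_comp {X : E2 → E3} {ψ : E2 → E2} {O V : Set E2} (hX : ContDiffOn ℝ ∞ X O)
    (hO : IsOpen O) (hψ : ContDiffOn ℝ ∞ ψ V) (hV : IsOpen V) {y : E2} (hy : y ∈ V)
    (hyO : ψ y ∈ O) (N : E3) (h0 : inner ℝ N (pd 0 X (ψ y)) = 0) (h1 : inner ℝ N (pd 1 X (ψ y)) = 0)
    (i j : Fin 2) :
    inner ℝ N (pd i (pd j fun z => X (ψ z)) y) =
      pd j ψ y 0 * (pd i ψ y 0 * inner ℝ N (pd 0 (pd 0 X) (ψ y)) +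
        pd i ψ y 1 * inner ℝ N (pd 0 (pd 1 X) (ψ y))) +
      pd j ψ y 1 * (pd i ψ y 0 * inner ℝ N (pd 0 (pd 1 X) (ψ y)) +
        pd i ψ y 1 * inner ℝ N (pd 1 (pd 1 X) (ψ y))) := by
  have dψ : ∀ z ∈ V, DifferentiableAt ℝ ψ z := fun z hz => hψ.differentiableAt_of_isOpen hV hz
  have hcont : ContinuousAt ψ y := (dψ y hy).continuousAt
  have hev : (pd j fun z => X (ψ z)) =ᶠ[𝓝 y]
      fun z => pd j ψ z 0 • pd 0 X (ψ z) + pd j ψ z 1 • pd 1 X (ψ z) := by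
    filter_upwards [hV.mem_nhds hy, hcont.preimage_mem_nhds (hO.mem_nhds hyO)] with z hz hzO
    exact pd_comp (hX.differentiableAt_of_isOpen hO hzO) (dψ z hz) j
  have dX0 := (hX.pd hO 0).differentiableAt_of_isOpen hO hyO
  have dX1 := (hX.pd hO 1).differentiableAt_of_isOpen hO hyO
  have dj := (hψ.pd hV j).differentiableAt_of_isOpen hV hy
  have dj' : ∀ k : Fin 2, DifferentiableAt ℝ (fun z => pd j ψ z k) y := fun k => by fun_prop
  have e0 : DifferentiableAt ℝ (fun z => pd 0 X (ψ z)) y := dX0.comp y (dψ y hy)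
  have e1 : DifferentiableAt ℝ (fun z => pd 1 X (ψ z)) y := dX1.comp y (dψ y hy)
  rw [pd_congr hev, pd_add ((dj' 0).fun_smul e0) ((dj' 1).fun_smul e1), pd_smul (dj' 0) e0,
    pd_smul (dj' 1) e1, pd_comp dX0 (dψ y hy), pd_comp dX1 (dψ y hy), pd_comm hX hO hyO 1 0]
  simp only [inner_add_right, inner_smul_right, h0, h1]
  ring

/-- The Gaussian curvature does not depend on the parametrization. -/
theorem paramGaussianCurvature_comp {X : E2 → E3} {ψ : E2 → E2} {O V : Set E2}
    (hX : ContDiffOn ℝ ∞ X O) (hO : IsOpen O) (hψ : ContDiffOn ℝ ∞ ψ V) (hV : IsOpen V) {y : E2}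
    (hy : y ∈ V) (hyO : ψ y ∈ O) (hN : crossNormal (fun z => X (ψ z)) y ≠ 0) :
    paramGaussianCurvature (fun z => X (ψ z)) y = paramGaussianCurvature X (ψ y) := by
  set J : ℝ := pd 0 ψ y 0 * pd 1 ψ y 1 - pd 0 ψ y 1 * pd 1 ψ y 0 with hJ
  have hcross : crossNormal (fun z => X (ψ z)) y = J • crossNormal X (ψ y) := by
    unfold crossNormal
    rw [pd_comp (hX.differentiableAt_of_isOpen hO hyO) (hψ.differentiableAt_of_isOpen hV hy),
      pd_comp (hX.differentiableAt_of_isOpen hO hyO) (hψ.differentiableAt_of_isOpen hV hy),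
      cross3_linear_combination]
  rw [hcross] at hN
  obtain ⟨hJ0, hn0⟩ := smul_ne_zero_iff.1 hN
  have hraw : rawCurv (fun z => X (ψ z)) y = J ^ 4 * rawCurv X (ψ y) := by
    unfold rawCurv
    rw [hcross]
    simp only [inner_smul_left]
    have hl : inner ℝ (crossNormal X (ψ y)) (pd 0 X (ψ y)) = 0 := inner_cross3_left _ _
    have hr : inner ℝ (crossNormal X (ψ y)) (pd 1 X (ψ y)) = 0 := inner_cross3_right _ _
    rw [inner_pd_pd_comp hX hO hψ hV hy hyO _ hl hr, inner_pd_pd_comp hX hO hψ hV hy hyO _ hl hr,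
      inner_pd_pd_comp hX hO hψ hV hy hyO _ hl hr]
    simp only [conj_trivial, hJ]; ring
  rw [paramGaussianCurvature_eq, paramGaussianCurvature_eq, hraw, hcross, norm_smul, mul_pow,
    Real.norm_eq_abs, show |J| ^ 4 = J ^ 4 by rw [← abs_pow]; exact abs_of_nonneg (by positivity)]
  exact mul_div_mul_left _ _ (pow_ne_zero 4 hJ0)

theorem pd_isometry_comp (A : E3 ≃ᵃⁱ[ℝ] E3) (X : E2 → E3) (i : Fin 2) :
    pd i (fun z => A (X z)) = fun y => A.linearIsometryEquiv (pd i X y) := by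
  funext y
  have : (fun z => A (X z)) = fun z => A.linearIsometryEquiv (X z) + A 0 := by
    funext z
    have := A.map_vadd 0 (X z)
    simpa using this
  unfold pd
  rw [this, fderiv_add_const,
    show (fun z => A.linearIsometryEquiv (X z)) = A.linearIsometryEquiv ∘ X from rfl,
    LinearIsometryEquiv.comp_fderiv]
  rfl

theorem pd_linearIsometryEquiv_comp (L : E3 ≃ₗᵢ[ℝ] E3) (X : E2 → E3) (i : Fin 2) :
    pd i (fun z => L (X z)) = fun y => L (pd i X y) := by
  funext y
  unfold pd
  rw [show (fun z => L (X z)) = L ∘ X from rfl, LinearIsometryEquiv.comp_fderiv]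
  rfl

/-- The Gaussian curvature is invariant under isometries of space. -/
theorem paramGaussianCurvature_isometry (A : E3 ≃ᵃⁱ[ℝ] E3) (X : E2 → E3) (y : E2) :
    paramGaussianCurvature (fun z => A (X z)) y = paramGaussianCurvature X y := by
  rw [paramGaussianCurvature_eq, paramGaussianCurvature_eq]
  unfold rawCurv crossNormal
  simp only [pd_isometry_comp, pd_linearIsometryEquiv_comp, norm_cross3_map, pow_two,
    inner_cross3_mul_inner_cross3, LinearIsometryEquiv.inner_map_map]

theorem ContDiffOn.crossNormal {X : E2 → E3} {O : Set E2} (hX : ContDiffOn ℝ ∞ X O)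
    (hO : IsOpen O) : ContDiffOn ℝ ∞ (crossNormal X) O := by
  have h : ∀ i (k : Fin 3), ContDiffOn ℝ ∞ (fun y => _root_.pd i X y k) O := fun i k =>
    (EuclideanSpace.proj k : E3 →L[ℝ] ℝ).contDiff.comp_contDiffOn (hX.pd hO i)
  rw [contDiffOn_euclidean]
  intro k
  fin_cases k
  · exact (((h 0 1).mul (h 1 2)).sub ((h 0 2).mul (h 1 1))).congr fun y _ => cross3_apply_zero _ _
  · exact (((h 0 2).mul (h 1 0)).sub ((h 0 0).mul (h 1 2))).congr fun y _ => cross3_apply_one _ _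
  · exact (((h 0 0).mul (h 1 1)).sub ((h 0 1).mul (h 1 0))).congr fun y _ => cross3_apply_two _ _

theorem continuousOn_paramGaussianCurvature {X : E2 → E3} {O : Set E2} (hX : ContDiffOn ℝ ∞ X O)
    (hO : IsOpen O) (hN : ∀ y ∈ O, crossNormal X y ≠ 0) :
    ContinuousOn (paramGaussianCurvature X) O := by
  have hn := (hX.crossNormal hO).continuousOn
  have h2 : ∀ i j, ContinuousOn (pd i (pd j X)) O := fun i j => ((hX.pd hO j).pd hO i).continuousOn
  rw [show paramGaussianCurvature X = fun y => rawCurv X y / ‖crossNormal X y‖ ^ 4 from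
    funext (paramGaussianCurvature_eq X)]
  refine ContinuousOn.div ?_ (hn.norm.pow 4) fun y hy => pow_ne_zero 4 (norm_ne_zero_iff.2 (hN y hy))
  exact ((hn.inner (h2 0 0)).mul (hn.inner (h2 1 1))).sub ((hn.inner (h2 0 1)).pow 2)

/-- A surface whose tangent planes are all vertical has Gaussian curvature zero: the vertical
direction lies in the kernel of the second fundamental form. -/
theorem paramGaussianCurvature_eq_zero_of_vertical {X : E2 → E3} {O : Set E2}
    (hX : ContDiffOn ℝ ∞ X O) (hO : IsOpen O) (hv : ∀ y ∈ O, crossNormal X y 2 = 0) {y : E2}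
    (hy : y ∈ O) (hN : crossNormal X y ≠ 0) : paramGaussianCurvature X y = 0 := by
  set N := crossNormal X y with hNdef
  have sN := hX.crossNormal hO
  have dN := sN.differentiableAt_of_isOpen hO hy
  have dX := fun i => (hX.pd hO i).differentiableAt_of_isOpen hO hy
  -- `⟨N, X_ij⟩ = - ⟨N_i, X_j⟩`.
  have hW : ∀ i j, inner ℝ N (pd i (pd j X) y) = - inner ℝ (pd i (crossNormal X) y) (pd j X y) := by
    intro i j
    have h0 : (fun z => inner ℝ (crossNormal X z) (pd j X z)) = fun _ => (0 : ℝ) := by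
      funext z
      fin_cases j
      · exact inner_cross3_left _ _
      · exact inner_cross3_right _ _
    have : fderiv ℝ (fun z => inner ℝ (crossNormal X z) (pd j X z)) y
        (EuclideanSpace.single i 1) = 0 := by
      rw [h0]; simp
    rw [fderiv_inner_apply ℝ dN (dX j)] at this
    have := this
    change inner ℝ N (pd i (pd j X) y) + inner ℝ (pd i (crossNormal X) y) (pd j X y) = 0 at this
    linarith
  have hN2 : ∀ i, pd i (crossNormal X) y 2 = 0 := by
    intro i
    have := pd_clm_comp (EuclideanSpace.proj 2 : E3 →L[ℝ] ℝ) dN i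
    rw [pd_congr (g := fun _ => (0 : ℝ)) (by filter_upwards [hO.mem_nhds hy] with z hz using hv z hz),
      pd_const] at this
    exact this.symm
  -- The vertical vector is a combination of the tangent vectors, with coefficients `a`, `b` up to
  -- the factor `‖N‖ ^ 2`.
  obtain ⟨a, b, hab, hne⟩ : ∃ a b : ℝ, (∀ W : E3,
      a * inner ℝ W (pd 0 X y) + b * inner ℝ W (pd 1 X y) = ‖N‖ ^ 2 * W 2) ∧ (a ≠ 0 ∨ b ≠ 0) := by
    have hv' := hv y hy
    refine ⟨N 1 * pd 1 X y 0 - N 0 * pd 1 X y 1, N 0 * pd 0 X y 1 - N 1 * pd 0 X y 0, ?_, ?_⟩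
    · intro W
      rw [norm_sq_e3, ← hNdef] at *
      have h0 : N 0 = pd 0 X y 1 * pd 1 X y 2 - pd 0 X y 2 * pd 1 X y 1 := cross3_apply_zero _ _
      have h1 : N 1 = pd 0 X y 2 * pd 1 X y 0 - pd 0 X y 0 * pd 1 X y 2 := cross3_apply_one _ _
      have h2 : N 2 = pd 0 X y 0 * pd 1 X y 1 - pd 0 X y 1 * pd 1 X y 0 := cross3_apply_two _ _
      have h2' : pd 0 X y 0 * pd 1 X y 1 - pd 0 X y 1 * pd 1 X y 0 = 0 := by rw [← h2, hv']
      rw [hv', inner_e3, inner_e3]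
      rw [h0, h1]
      linear_combination -(W 0 * (pd 0 X y 1 * pd 1 X y 2 - pd 0 X y 2 * pd 1 X y 1)
        + W 1 * (pd 0 X y 2 * pd 1 X y 0 - pd 0 X y 0 * pd 1 X y 2)) * h2'
    · by_contra hcon
      push Not at hcon
      obtain ⟨ha, hb⟩ := hcon
      have key : ‖N‖ ^ 2 = 0 := by
        rw [norm_sq_e3, hv']
        have h0 : N 0 = pd 0 X y 1 * pd 1 X y 2 - pd 0 X y 2 * pd 1 X y 1 := cross3_apply_zero _ _
        have h1 : N 1 = pd 0 X y 2 * pd 1 X y 0 - pd 0 X y 0 * pd 1 X y 2 := cross3_apply_one _ _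
        linear_combination N 0 * h0 + N 1 * h1 + pd 1 X y 2 * hb + pd 0 X y 2 * ha
      exact hN (by simpa using key)
  have k0 := hab (pd 0 (crossNormal X) y)
  have k1 := hab (pd 1 (crossNormal X) y)
  rw [hN2, mul_zero] at k0 k1
  have hc : pd 1 (pd 0 X) y = pd 0 (pd 1 X) y := pd_comm hX hO hy 1 0
  have w00 := hW 0 0
  have w01 := hW 0 1
  have w10 := hW 1 0
  have w11 := hW 1 1
  rw [hc] at w10
  rw [paramGaussianCurvature_eq]
  have hraw : rawCurv X y = 0 := by
    unfold rawCurv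
    rw [← hNdef]
    set l := inner ℝ N (pd 0 (pd 0 X) y)
    set μ := inner ℝ N (pd 0 (pd 1 X) y)
    set ν := inner ℝ N (pd 1 (pd 1 X) y)
    have r0 : a * l + b * μ = 0 := by linear_combination a * w00 + b * w01 - k0
    have r1 : a * μ + b * ν = 0 := by linear_combination a * w10 + b * w11 - k1
    rcases hne with h | h
    · exact mul_left_cancel₀ h (by linear_combination ν * r0 - μ * r1)
    · exact mul_left_cancel₀ h (by linear_combination l * r1 - μ * r0)
  rw [hraw, zero_div]

end Curvature

/-! ### Local inverses and logarithmic polar coordinates -/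

/-- The inverse function theorem for smooth maps of the plane. -/
theorem exists_local_diffeo {f : E2 → E2} {O : Set E2} (hf : ContDiffOn ℝ ∞ f O) (hO : IsOpen O)
    {y : E2} (hy : y ∈ O) (hs : Function.Surjective (fderiv ℝ f y)) :
    ∃ d : OpenPartialHomeomorph E2 E2, y ∈ d.source ∧ d.source ⊆ O ∧ (d : E2 → E2) = f ∧
      ContDiffOn ℝ ∞ d.symm d.target := by
  let O' : Set E2 := O ∩ fderiv ℝ f ⁻¹' Set.range ((↑) : (E2 ≃L[ℝ] E2) → E2 →L[ℝ] E2)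
  have hO' : IsOpen O' :=
    (hf.continuousOn_fderiv_of_isOpen hO (by simp)).isOpen_inter_preimage hO
      ContinuousLinearEquiv.isOpen
  have hinv : ∀ z ∈ O', ∃ L : E2 ≃L[ℝ] E2, HasFDerivAt f (L : E2 →L[ℝ] E2) z := by
    rintro z ⟨hz, L, hL⟩
    exact ⟨L, by rw [hL]; exact (hf.differentiableAt_of_isOpen hO hz).hasFDerivAt⟩
  have hyO' : y ∈ O' := by
    have hi : Function.Injective (fderiv ℝ f y) :=
      (LinearMap.injective_iff_surjective (f := (fderiv ℝ f y : E2 →ₗ[ℝ] E2))).2 hs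
    exact ⟨hy, (LinearEquiv.ofBijective (fderiv ℝ f y : E2 →ₗ[ℝ] E2)
      ⟨hi, hs⟩).toContinuousLinearEquiv, by ext v; rfl⟩
  obtain ⟨L, hL⟩ := hinv y hyO'
  have hc : ContDiffAt ℝ ∞ f y := hf.contDiffAt (hO.mem_nhds hy)
  let d := hc.toOpenPartialHomeomorph f hL (by simp)
  have hdf : (d : E2 → E2) = f := hc.toOpenPartialHomeomorph_coe hL (by simp)
  have hyd : y ∈ d.source := hc.mem_toOpenPartialHomeomorph_source hL (by simp)
  refine ⟨d.restrOpen O' hO', ⟨hyd, hyO'⟩, fun z hz => hz.2.1, hdf, fun v hv => ?_⟩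
  have hz := (d.restrOpen O' hO').map_target hv
  obtain ⟨L', hL'⟩ := hinv _ hz.2
  refine ((d.restrOpen O' hO').contDiffAt_symm hv (f₀' := L') ?_ ?_).contDiffWithinAt
  · change HasFDerivAt d _ _
    rw [hdf]; exact hL'
  · change ContDiffAt ℝ ∞ d _
    rw [hdf]; exact hf.contDiffAt (hO.mem_nhds hz.2.1)

section PolarMap

/-- Logarithmic polar coordinates of the punctured plane: the map `(τ, θ) ↦ exp τ (cos θ, sin θ)`,
that is, the complex exponential map. In these coordinates rotations of the plane are translations
in the direction of `θ`. -/
def polarMap (y : E2) : E2 := !₂[Real.exp (y 0) * Real.cos (y 1), Real.exp (y 0) * Real.sin (y 1)]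

/-- The rotation of the plane by the angle `t`. -/
def planeRot (t : ℝ) (v : E2) : E2 :=
  !₂[Real.cos t * v 0 - Real.sin t * v 1, Real.sin t * v 0 + Real.cos t * v 1]

theorem polarMap_zero (y : E2) : polarMap y 0 = Real.exp (y 0) * Real.cos (y 1) := by
  simp [polarMap]

theorem polarMap_one (y : E2) : polarMap y 1 = Real.exp (y 0) * Real.sin (y 1) := by
  simp [polarMap]

theorem contDiff_polarMap : ContDiff ℝ ∞ polarMap := by
  rw [contDiff_euclidean]
  intro i
  have h : ∀ j : Fin 2, ContDiff ℝ ∞ fun y : E2 => y j := fun j =>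
    (EuclideanSpace.proj j : E2 →L[ℝ] ℝ).contDiff
  fin_cases i
  · change ContDiff ℝ ∞ fun y => polarMap y 0
    simp only [polarMap_zero]
    exact (h 0).exp.mul (h 1).cos
  · change ContDiff ℝ ∞ fun y => polarMap y 1
    simp only [polarMap_one]
    exact (h 0).exp.mul (h 1).sin

theorem norm_sq_e2 (v : E2) : ‖v‖ ^ 2 = v 0 ^ 2 + v 1 ^ 2 := by
  rw [EuclideanSpace.norm_sq_eq]; simp

theorem norm_polarMap (y : E2) : ‖polarMap y‖ = Real.exp (y 0) := by
  rw [← sq_eq_sq₀ (norm_nonneg _) (Real.exp_pos _).le, norm_sq_e2, polarMap_zero, polarMap_one]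
  linear_combination (Real.exp (y 0)) ^ 2 * Real.sin_sq_add_cos_sq (y 1)

theorem polarMap_ne_zero (y : E2) : polarMap y ≠ 0 := by
  rw [← norm_ne_zero_iff, norm_polarMap]; exact (Real.exp_pos _).ne'

theorem norm_planeRot (t : ℝ) (v : E2) : ‖planeRot t v‖ = ‖v‖ := by
  rw [← sq_eq_sq₀ (norm_nonneg _) (norm_nonneg _), norm_sq_e2, norm_sq_e2]
  simp only [planeRot, PiLp.toLp_apply, Matrix.cons_val_zero, Matrix.cons_val_one]
  linear_combination (v 0 ^ 2 + v 1 ^ 2) * Real.sin_sq_add_cos_sq t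

theorem polarMap_add (y : E2) (t : ℝ) :
    polarMap (y + t • EuclideanSpace.single 1 1) = planeRot t (polarMap y) := by
  ext i; fin_cases i
  · simp [polarMap, planeRot, Real.cos_add]; ring
  · simp [polarMap, planeRot, Real.sin_add]; ring

theorem pd_polarMap_apply (y : E2) (i k : Fin 2) :
    pd i polarMap y k = pd i (fun z => polarMap z k) y :=
  (pd_clm_comp (EuclideanSpace.proj k : E2 →L[ℝ] ℝ)
    (contDiff_polarMap.differentiable (by simp) y) i).symm

theorem pd_polarMap_zero_coord (y : E2) (k : Fin 2) :
    pd 0 (fun z => polarMap z k) y = polarMap y k := by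
  have hE : ∀ i, pd i (fun z : E2 => Real.exp (z 0)) y = if i = 0 then Real.exp (y 0) else 0 :=
    fun i => pd_comp_coord i 0 (Real.hasDerivAt_exp (y 0))
  have hC := pd_comp_coord 0 1 (Real.hasDerivAt_cos (y 1))
  have hS := pd_comp_coord 0 1 (Real.hasDerivAt_sin (y 1))
  fin_cases k
  · simp only [Fin.zero_eta, polarMap_zero]
    rw [pd_mul (by fun_prop) (by fun_prop), hE, hC]; simp; ring
  · simp only [Fin.mk_one, polarMap_one]
    rw [pd_mul (by fun_prop) (by fun_prop), hE, hS]; simp; ring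

theorem pd_polarMap_one_coord_zero (y : E2) :
    pd 1 (fun z => polarMap z 0) y = - polarMap y 1 := by
  have hE : ∀ i, pd i (fun z : E2 => Real.exp (z 0)) y = if i = 0 then Real.exp (y 0) else 0 :=
    fun i => pd_comp_coord i 0 (Real.hasDerivAt_exp (y 0))
  have hC := pd_comp_coord 1 1 (Real.hasDerivAt_cos (y 1))
  simp only [polarMap_zero, polarMap_one]
  rw [pd_mul (by fun_prop) (by fun_prop), hE, hC]; simp

theorem pd_polarMap_one_coord_one (y : E2) :
    pd 1 (fun z => polarMap z 1) y = polarMap y 0 := by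
  have hE : ∀ i, pd i (fun z : E2 => Real.exp (z 0)) y = if i = 0 then Real.exp (y 0) else 0 :=
    fun i => pd_comp_coord i 0 (Real.hasDerivAt_exp (y 0))
  have hS := pd_comp_coord 1 1 (Real.hasDerivAt_sin (y 1))
  simp only [polarMap_zero, polarMap_one]
  rw [pd_mul (by fun_prop) (by fun_prop), hE, hS]; simp

theorem polarMap_normSq (y : E2) : polarMap y 0 ^ 2 + polarMap y 1 ^ 2 = Real.exp (y 0) ^ 2 := by
  rw [← norm_sq_e2, norm_polarMap]

theorem fderiv_polarMap_apply (y v : E2) :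
    fderiv ℝ polarMap y v =
      !₂[v 0 * polarMap y 0 - v 1 * polarMap y 1, v 0 * polarMap y 1 + v 1 * polarMap y 0] := by
  rw [fderiv_eq_pd]
  ext k; fin_cases k
  · simp [pd_polarMap_apply, pd_polarMap_zero_coord, pd_polarMap_one_coord_zero]; ring
  · simp [pd_polarMap_apply, pd_polarMap_zero_coord, pd_polarMap_one_coord_one]

theorem norm_fderiv_polarMap_apply (y v : E2) :
    ‖fderiv ℝ polarMap y v‖ = Real.exp (y 0) * ‖v‖ := by
  rw [← sq_eq_sq₀ (norm_nonneg _) (by positivity), mul_pow, ← polarMap_normSq, norm_sq_e2,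
    norm_sq_e2, fderiv_polarMap_apply]
  simp only [Matrix.cons_val_zero, Matrix.cons_val_one]
  ring

theorem fderiv_polarMap_injective (y : E2) : Function.Injective (fderiv ℝ polarMap y) := by
  rw [injective_iff_map_eq_zero]
  intro v hv
  have := norm_fderiv_polarMap_apply y v
  rw [hv, norm_zero] at this
  have := mul_eq_zero.1 this.symm
  exact norm_eq_zero.1 (this.resolve_left (Real.exp_pos _).ne')

theorem fderiv_polarMap_surjective (y : E2) : Function.Surjective (fderiv ℝ polarMap y) :=
  LinearMap.surjective_of_injective (f := (fderiv ℝ polarMap y : E2 →ₗ[ℝ] E2))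
    (fderiv_polarMap_injective y)

/-- The polar map has smooth local inverses. -/
theorem exists_local_inverse_polarMap (y : E2) :
    ∃ ρ : E2 → E2, ∃ V : Set E2, IsOpen V ∧ polarMap y ∈ V ∧ ContDiffOn ℝ ∞ ρ V ∧
      (∀ v ∈ V, polarMap (ρ v) = v) ∧ ρ (polarMap y) = y := by
  obtain ⟨d, hy, -, hd, hsymm⟩ := exists_local_diffeo contDiff_polarMap.contDiffOn isOpen_univ
    (Set.mem_univ y) (fderiv_polarMap_surjective y)
  exact ⟨d.symm, d.target, d.open_target, by rw [← hd]; exact d.map_source hy, hsymm,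
    fun v hv => by rw [← hd]; exact d.right_inv hv, by rw [← hd]; exact d.left_inv hy⟩

theorem exists_polarMap_eq {v : E2} (hv : v ≠ 0) : ∃ y, polarMap y = v := by
  have hz : (⟨v 0, v 1⟩ : ℂ) ≠ 0 := by
    intro h
    apply hv
    ext i; fin_cases i
    · simpa using congrArg Complex.re h
    · simpa using congrArg Complex.im h
  refine ⟨!₂[Real.log ‖(⟨v 0, v 1⟩ : ℂ)‖, (⟨v 0, v 1⟩ : ℂ).arg], ?_⟩
  ext i; fin_cases i
  · simp [polarMap, Real.exp_log (norm_pos_iff.2 hz), Complex.norm_mul_cos_arg]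
  · simp [polarMap, Real.exp_log (norm_pos_iff.2 hz), Complex.norm_mul_sin_arg]

theorem eq_add_of_polarMap_eq {y y' : E2} (h : polarMap y = polarMap y') :
    ∃ n : ℤ, y' = y + (n * (2 * Real.pi)) • EuclideanSpace.single 1 1 := by
  have h0 : Real.exp (y 0) = Real.exp (y' 0) := by rw [← norm_polarMap, ← norm_polarMap, h]
  have h1 : polarMap y 0 = polarMap y' 0 := by rw [h]
  have h2 : polarMap y 1 = polarMap y' 1 := by rw [h]
  rw [polarMap_zero, polarMap_zero, h0] at h1
  rw [polarMap_one, polarMap_one, h0] at h2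
  have hc := mul_left_cancel₀ (Real.exp_pos _).ne' h1
  have hs := mul_left_cancel₀ (Real.exp_pos _).ne' h2
  have := Real.Angle.cos_sin_inj hc hs
  obtain ⟨n, hn⟩ := Real.Angle.angle_eq_iff_two_pi_dvd_sub.1 this
  refine ⟨-n, ?_⟩
  ext i; fin_cases i
  · simp [Real.exp_injective h0]
  · simp; linarith

theorem polarMap_add_int (y : E2) (n : ℤ) :
    polarMap (y + (n * (2 * Real.pi)) • EuclideanSpace.single 1 1) = polarMap y := by
  ext i; fin_cases i
  · simp [polarMap]
  · simp [polarMap]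

theorem pd_comp_add {F : Type*} [NormedAddCommGroup F] [NormedSpace ℝ F] (f : E2 → F) (v y : E2)
    (i : Fin 2) : pd i (fun z => f (z + v)) y = pd i f (y + v) := by
  unfold pd; rw [fderiv_comp_add_right]

/-- Functions of a point of the punctured plane have the same derivatives at all logarithmic polar
coordinates of that point. -/
theorem pd_comp_polarMap_eq (F : E2 → ℝ) {y y' : E2} (h : polarMap y = polarMap y') :
    (∀ i, pd i (F ∘ polarMap) y = pd i (F ∘ polarMap) y') ∧
      ∀ i j, pd i (pd j (F ∘ polarMap)) y = pd i (pd j (F ∘ polarMap)) y' := by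
  obtain ⟨n, rfl⟩ := eq_add_of_polarMap_eq h
  set v : E2 := (n * (2 * Real.pi)) • EuclideanSpace.single 1 1
  have h0 : (fun z => (F ∘ polarMap) (z + v)) = F ∘ polarMap := by
    funext z; exact congrArg F (polarMap_add_int z n)
  have h1 : ∀ i, (fun z => pd i (F ∘ polarMap) (z + v)) = pd i (F ∘ polarMap) := by
    intro i; funext z; rw [← pd_comp_add, h0]
  exact ⟨fun i => (congrFun (h1 i) y).symm, fun i j => by rw [← pd_comp_add, h1]⟩

end PolarMap

section PolarGraph

/-- The projection of space onto the horizontal plane. -/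
def horiz (v : E3) : E2 := !₂[v 0, v 1]

theorem horiz_zero (v : E3) : horiz v 0 = v 0 := by simp [horiz]

theorem horiz_one (v : E3) : horiz v 1 = v 1 := by simp [horiz]

theorem contDiff_coord3 (j : Fin 3) : ContDiff ℝ ∞ fun y : E3 => y j :=
  (EuclideanSpace.proj j : E3 →L[ℝ] ℝ).contDiff

theorem contDiff_horiz : ContDiff ℝ ∞ horiz := by
  rw [contDiff_euclidean]
  intro i
  fin_cases i
  · change ContDiff ℝ ∞ fun y => horiz y 0
    simp only [horiz_zero]
    exact contDiff_coord3 0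
  · change ContDiff ℝ ∞ fun y => horiz y 1
    simp only [horiz_one]
    exact contDiff_coord3 1

theorem pd_apply3 {X : E2 → E3} {y : E2} (h : DifferentiableAt ℝ X y) (i : Fin 2) (k : Fin 3) :
    pd i X y k = pd i (fun z => X z k) y :=
  (pd_clm_comp (EuclideanSpace.proj k : E3 →L[ℝ] ℝ) h i).symm

variable {X : E2 → E3} {O : Set E2}

theorem pd_pd_apply3 (hX : ContDiffOn ℝ ∞ X O) (hO : IsOpen O) {y : E2} (hy : y ∈ O) (i j : Fin 2)
    (k : Fin 3) : pd i (pd j X) y k = pd i (pd j fun z => X z k) y := by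
  rw [pd_apply3 ((hX.pd hO j).differentiableAt_of_isOpen hO hy)]
  refine pd_congr ?_ i
  filter_upwards [hO.mem_nhds hy] with z hz
  exact pd_apply3 (hX.differentiableAt_of_isOpen hO hz) j k

theorem coord_eventuallyEq (hO : IsOpen O) (hp : ∀ y ∈ O, horiz (X y) = polarMap y) {y : E2}
    (hy : y ∈ O) : ((fun z => X z 0) =ᶠ[𝓝 y] fun z => polarMap z 0) ∧
      ((fun z => X z 1) =ᶠ[𝓝 y] fun z => polarMap z 1) := by
  constructor <;> filter_upwards [hO.mem_nhds hy] with z hz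
  · rw [← horiz_zero, hp z hz]
  · rw [← horiz_one, hp z hz]

/-- The tangent vectors of a graph in logarithmic polar coordinates. -/
theorem pd_polarGraph (hX : ContDiffOn ℝ ∞ X O) (hO : IsOpen O)
    (hp : ∀ y ∈ O, horiz (X y) = polarMap y) {y : E2} (hy : y ∈ O) :
    pd 0 X y = !₂[polarMap y 0, polarMap y 1, pd 0 (fun z => X z 2) y] ∧
      pd 1 X y = !₂[-polarMap y 1, polarMap y 0, pd 1 (fun z => X z 2) y] := by
  have hd := hX.differentiableAt_of_isOpen hO hy
  obtain ⟨c0, c1⟩ := coord_eventuallyEq hO hp hy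
  constructor <;> ext k <;> fin_cases k <;>
    simp [pd_apply3 hd, pd_congr c0, pd_congr c1, pd_polarMap_zero_coord,
      pd_polarMap_one_coord_zero, pd_polarMap_one_coord_one]

/-- The area element of a graph in logarithmic polar coordinates; in particular the parametrization
is regular. -/
theorem crossNormal_polarGraph (hX : ContDiffOn ℝ ∞ X O) (hO : IsOpen O)
    (hp : ∀ y ∈ O, horiz (X y) = polarMap y) {y : E2} (hy : y ∈ O) :
    ‖crossNormal X y‖ ^ 2 =
        Real.exp (y 0) ^ 2 * (gradSq (fun z => X z 2) y + Real.exp (y 0) ^ 2) ∧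
      crossNormal X y ≠ 0 := by
  have key : ‖crossNormal X y‖ ^ 2 =
        Real.exp (y 0) ^ 2 * (gradSq (fun z => X z 2) y + Real.exp (y 0) ^ 2) := by
    obtain ⟨h0, h1⟩ := pd_polarGraph hX hO hp hy
    rw [crossNormal, norm_cross3_sq, h0, h1, ← polarMap_normSq]
    simp only [inner_e3]
    simp [gradSq]
    ring
  refine ⟨key, fun h => ?_⟩
  rw [h] at key
  have : 0 < Real.exp (y 0) ^ 2 * (gradSq (fun z => X z 2) y + Real.exp (y 0) ^ 2) := by
    have := Real.exp_pos (y 0)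
    unfold gradSq; positivity
  rw [← key, norm_zero] at this
  norm_num at this

/-- The Gaussian curvature of a graph in logarithmic polar coordinates. -/
theorem paramGaussianCurvature_polarGraph (hX : ContDiffOn ℝ ∞ X O) (hO : IsOpen O)
    (hp : ∀ y ∈ O, horiz (X y) = polarMap y) {y : E2} (hy : y ∈ O) :
    paramGaussianCurvature X y =
      curvNum (fun z => X z 2) y / (gradSq (fun z => X z 2) y + Real.exp (y 0) ^ 2) ^ 2 := by
  obtain ⟨c0, c1⟩ := coord_eventuallyEq hO hp hy
  obtain ⟨h0, h1⟩ := pd_polarGraph hX hO hp hy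
  have s00 : pd 0 (pd 0 X) y =
      !₂[polarMap y 0, polarMap y 1, pd 0 (pd 0 fun z => X z 2) y] := by
    ext k; fin_cases k
    · simp [pd_pd_apply3 hX hO hy, pd_congr (pd_congr_eventually c0 0),
        show pd 0 (fun z => polarMap z 0) = fun z => polarMap z 0 from
          funext fun z => pd_polarMap_zero_coord z 0, pd_polarMap_zero_coord]
    · simp [pd_pd_apply3 hX hO hy, pd_congr (pd_congr_eventually c1 0),
        show pd 0 (fun z => polarMap z 1) = fun z => polarMap z 1 from
          funext fun z => pd_polarMap_zero_coord z 1, pd_polarMap_zero_coord]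
    · simp [pd_pd_apply3 hX hO hy]
  have e0 : pd 1 (fun z => polarMap z 0) = fun z => -polarMap z 1 :=
    funext fun z => pd_polarMap_one_coord_zero z
  have e1 : pd 1 (fun z => polarMap z 1) = fun z => polarMap z 0 :=
    funext fun z => pd_polarMap_one_coord_one z
  have s01 : pd 0 (pd 1 X) y =
      !₂[-polarMap y 1, polarMap y 0, pd 0 (pd 1 fun z => X z 2) y] := by
    ext k; fin_cases k
    · simp [pd_pd_apply3 hX hO hy, pd_congr (pd_congr_eventually c0 1), e0, pd_neg,
        pd_polarMap_zero_coord]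
    · simp [pd_pd_apply3 hX hO hy, pd_congr (pd_congr_eventually c1 1), e1,
        pd_polarMap_zero_coord]
    · simp [pd_pd_apply3 hX hO hy]
  have s11 : pd 1 (pd 1 X) y =
      !₂[-polarMap y 0, -polarMap y 1, pd 1 (pd 1 fun z => X z 2) y] := by
    ext k; fin_cases k
    · simp [pd_pd_apply3 hX hO hy, pd_congr (pd_congr_eventually c0 1), e0, pd_neg,
        pd_polarMap_one_coord_one]
    · simp [pd_pd_apply3 hX hO hy, pd_congr (pd_congr_eventually c1 1), e1,
        pd_polarMap_one_coord_zero]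
    · simp [pd_pd_apply3 hX hO hy]
  have hr := polarMap_normSq y
  have hr' : polarMap y 0 ^ 2 = Real.exp (y 0) ^ 2 - polarMap y 1 ^ 2 := by linarith
  have hraw : rawCurv X y = (Real.exp (y 0) ^ 2) ^ 2 * curvNum (fun z => X z 2) y := by
    have n0 : inner ℝ (crossNormal X y) (pd 0 (pd 0 X) y) = Real.exp (y 0) ^ 2 *
        (pd 0 (pd 0 fun z => X z 2) y - pd 0 (fun z => X z 2) y) := by
      rw [s00, crossNormal, h0, h1, ← hr]
      simp [inner_e3, cross3_apply_zero, cross3_apply_one, cross3_apply_two]; ring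
    have n1 : inner ℝ (crossNormal X y) (pd 0 (pd 1 X) y) = Real.exp (y 0) ^ 2 *
        (pd 0 (pd 1 fun z => X z 2) y - pd 1 (fun z => X z 2) y) := by
      rw [s01, crossNormal, h0, h1, ← hr]
      simp [inner_e3, cross3_apply_zero, cross3_apply_one, cross3_apply_two]; ring
    have n2 : inner ℝ (crossNormal X y) (pd 1 (pd 1 X) y) = Real.exp (y 0) ^ 2 *
        (pd 1 (pd 1 fun z => X z 2) y + pd 0 (fun z => X z 2) y) := by
      rw [s11, crossNormal, h0, h1, ← hr]
      simp [inner_e3, cross3_apply_zero, cross3_apply_one, cross3_apply_two]; ring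
    unfold rawCurv curvNum
    rw [n0, n1, n2]; ring
  have hpos := Real.exp_pos (y 0)
  rw [paramGaussianCurvature_eq, hraw,
    show ‖crossNormal X y‖ ^ 4 = (‖crossNormal X y‖ ^ 2) ^ 2 by ring,
    (crossNormal_polarGraph hX hO hp hy).1, mul_pow]
  exact mul_div_mul_left _ _ (by positivity)

end PolarGraph

/-! ### Immersed surfaces and graph charts -/

section Immersion

variable {M : Type*} [TopologicalSpace M] [ChartedSpace E2 M]

theorem gaussianCurvature_eq_chart (x : M → E3) (p : M) :
    gaussianCurvature x p =
      paramGaussianCurvature (fun z => x ((chartAt E2 p).symm z)) (chartAt E2 p p) := rfl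

theorem crossNormal_ne_zero {X : E2 → E3} {y : E2} (h : Function.Injective (fderiv ℝ X y)) :
    crossNormal X y ≠ 0 := by
  intro h0
  -- A vanishing vector product means equality in the Cauchy-Schwarz inequality.
  have hn := norm_cross3_sq (pd 0 X y) (pd 1 X y)
  rw [show cross3 (pd 0 X y) (pd 1 X y) = 0 from h0, norm_zero] at hn
  set a := inner ℝ (pd 0 X y) (pd 0 X y)
  set b := inner ℝ (pd 0 X y) (pd 1 X y) with hb
  have hv : fderiv ℝ X y (b • EuclideanSpace.single 0 1 - a • EuclideanSpace.single 1 1) = 0 := by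
    have : fderiv ℝ X y (b • EuclideanSpace.single 0 1 - a • EuclideanSpace.single 1 1) =
        b • pd 0 X y - a • pd 1 X y := by simp [pd]
    rw [this, ← inner_self_eq_zero (𝕜 := ℝ)]
    simp only [inner_sub_left, inner_sub_right, inner_smul_left, inner_smul_right,
      real_inner_comm (pd 0 X y) (pd 1 X y), conj_trivial]
    linear_combination (-a) * hn
  have hz := h (hv.trans (map_zero _).symm)
  have ha : a = 0 := by simpa using congrArg (fun v : E2 => v 1) hz
  have h1 : pd 0 X y = 0 := inner_self_eq_zero.1 ha
  have h2 : fderiv ℝ X y (EuclideanSpace.single 0 1) = 0 := h1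
  have := congrArg (fun v : E2 => v 0) (h (h2.trans (map_zero _).symm))
  simp at this

theorem fderiv_horiz_comp {X : E2 → E3} {y : E2} (hd : DifferentiableAt ℝ X y) (v : E2) :
    fderiv ℝ (fun z => horiz (X z)) y v = horiz (fderiv ℝ X y v) := by
  have hh : HasFDerivAt (fun z => horiz (X z)) ((fderiv ℝ horiz (X y)).comp (fderiv ℝ X y)) y :=
    ((contDiff_horiz.differentiable (by simp) _).hasFDerivAt).comp y hd.hasFDerivAt
  have hl : ∀ u w : E3, fderiv ℝ horiz u w = horiz w := by
    let H : E3 →ₗ[ℝ] E2 :=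
      { toFun := horiz
        map_add' := fun a b => by ext i; fin_cases i <;> simp [horiz]
        map_smul' := fun a b => by ext i; fin_cases i <;> simp [horiz] }
    have : horiz = (LinearMap.toContinuousLinearMap H : E3 → E2) := rfl
    intro u w
    rw [this, ContinuousLinearMap.fderiv]
  rw [hh.fderiv]
  exact hl _ _

/-- Where the normal is not horizontal, the horizontal projection is a submersion. -/
theorem surjective_fderiv_horiz {X : E2 → E3} {y : E2} (hd : DifferentiableAt ℝ X y)
    (h : crossNormal X y 2 ≠ 0) : Function.Surjective (fderiv ℝ (fun z => horiz (X z)) y) := by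
  intro b
  have h2 : crossNormal X y 2 = pd 0 X y 0 * pd 1 X y 1 - pd 0 X y 1 * pd 1 X y 0 :=
    cross3_apply_two _ _
  set D := crossNormal X y 2
  refine ⟨!₂[(b 0 * pd 1 X y 1 - b 1 * pd 1 X y 0) / D,
    (b 1 * pd 0 X y 0 - b 0 * pd 0 X y 1) / D], ?_⟩
  rw [fderiv_horiz_comp hd, fderiv_eq_pd]
  ext i; fin_cases i
  · simp [horiz]; field_simp; linear_combination (-b 0) * h2
  · simp [horiz]; field_simp; linear_combination (-b 1) * h2

theorem ContMDiffOn.mdifferentiableAt_of_isOpen {F : Type*} [NormedAddCommGroup F]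
    [NormedSpace ℝ F] {N : Type*} [TopologicalSpace N] {H : Type*} [TopologicalSpace H]
    [ChartedSpace H N] {I : ModelWithCorners ℝ F H} {F' : Type*} [NormedAddCommGroup F']
    [NormedSpace ℝ F'] {N' : Type*} [TopologicalSpace N'] {H' : Type*} [TopologicalSpace H']
    [ChartedSpace H' N'] {I' : ModelWithCorners ℝ F' H'} {f : N → N'} {O : Set N}
    (hf : ContMDiffOn I I' ∞ f O) (hO : IsOpen O) {y : N} (hy : y ∈ O) :
    MDifferentiableAt I I' f y :=
  (hf.contMDiffAt (hO.mem_nhds hy)).mdifferentiableAt (by simp)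

theorem contMDiff_horiz_comp {x : M → E3} (hx : IsImmersedSurface x) :
    ContMDiff (𝓡 2) (𝓡 2) ∞ (fun q => horiz (x q)) :=
  contDiff_horiz.contMDiff.comp hx.1

/-- The chain rule for functions on a parametrized surface. -/
theorem fderiv_comp_param {F : Type*} [NormedAddCommGroup F] [NormedSpace ℝ F]
    {g : M → F} {σ : E2 → M} {y : E2} (hg : MDifferentiableAt (𝓡 2) 𝓘(ℝ, F) g (σ y))
    (hσ : MDifferentiableAt (𝓡 2) (𝓡 2) σ y) (v : E2) :
    fderiv ℝ (fun z => g (σ z)) y v =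
      mfderiv (𝓡 2) 𝓘(ℝ, F) g (σ y) (mfderiv (𝓡 2) (𝓡 2) σ y v) := by
  have := mfderiv_comp y hg hσ
  rw [← mfderiv_eq_fderiv]
  exact congrArg (fun L => L v) this

theorem injective_mfderiv_of_leftInverse {σ : E2 → M} {c : M → E2} {y : E2}
    (hσ : MDifferentiableAt (𝓡 2) (𝓡 2) σ y) (hc : MDifferentiableAt (𝓡 2) (𝓡 2) c (σ y))
    (h : ∀ᶠ z in 𝓝 y, c (σ z) = z) : Function.Injective (mfderiv (𝓡 2) (𝓡 2) σ y) := by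
  intro u v huv
  have key := fun v => fderiv_comp_param (F := E2) hc hσ v
  have hid : fderiv ℝ (fun z => c (σ z)) y = ContinuousLinearMap.id ℝ E2 := by
    rw [Filter.EventuallyEq.fderiv_eq (f := fun z => z) h]; exact fderiv_fun_id
  have h1 := key u
  rw [huv, ← key v, hid] at h1
  exact h1

theorem contDiffOn_comp_param {F : Type*} [NormedAddCommGroup F] [NormedSpace ℝ F]
    {g : M → F} {σ : E2 → M} {U : Set M} {O : Set E2} (hg : ContMDiffOn (𝓡 2) 𝓘(ℝ, F) ∞ g U)
    (hσ : ContMDiffOn (𝓡 2) (𝓡 2) ∞ σ O) (hm : Set.MapsTo σ O U) :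
    ContDiffOn ℝ ∞ (fun z => g (σ z)) O :=
  contMDiffOn_iff_contDiffOn.1 (hg.comp hσ hm)

variable [IsManifold (𝓡 2) ∞ M]

theorem contMDiffOn_chartAt_symm (p : M) :
    ContMDiffOn (𝓡 2) (𝓡 2) ∞ (chartAt E2 p).symm (chartAt E2 p).target :=
  contMDiffOn_chart_symm

theorem contMDiffOn_chartAt (p : M) :
    ContMDiffOn (𝓡 2) (𝓡 2) ∞ (chartAt E2 p) (chartAt E2 p).source :=
  contMDiffOn_chart

/-- In the charts of the manifold, immersed surfaces are smooth regular parametrized surfaces. -/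
theorem chart_param_props {x : M → E3} (hx : IsImmersedSurface x) (p : M) :
    ContDiffOn ℝ ∞ (fun z => x ((chartAt E2 p).symm z)) (chartAt E2 p).target ∧
      ∀ y ∈ (chartAt E2 p).target, Function.Injective (mfderiv (𝓡 2) (𝓡 2) (chartAt E2 p).symm y) ∧
        crossNormal (fun z => x ((chartAt E2 p).symm z)) y ≠ 0 := by
  set c := chartAt E2 p
  have hs := contMDiffOn_chartAt_symm p
  refine ⟨contDiffOn_comp_param hx.1.contMDiffOn hs (Set.mapsTo_univ _ _), fun y hy => ?_⟩
  have dσ := hs.mdifferentiableAt_of_isOpen c.open_target hy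
  have dc := (contMDiffOn_chartAt p).mdifferentiableAt_of_isOpen c.open_source (c.map_target hy)
  have hi := injective_mfderiv_of_leftInverse dσ dc (by
    filter_upwards [c.open_target.mem_nhds hy] with z hz using c.right_inv hz)
  refine ⟨hi, crossNormal_ne_zero ?_⟩
  intro u v huv
  have dx := hx.1.mdifferentiable (by simp) (c.symm y)
  rw [fderiv_comp_param dx dσ, fderiv_comp_param dx dσ] at huv
  exact hi (hx.2 _ huv)

/-- The Gaussian curvature can be computed in every regular parametrization. -/
theorem gaussianCurvature_eq_param {x : M → E3} (hx : IsImmersedSurface x) {σ : E2 → M}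
    {O : Set E2} (hσ : ContMDiffOn (𝓡 2) (𝓡 2) ∞ σ O) (hO : IsOpen O) {y : E2} (hy : y ∈ O)
    (hN : crossNormal (fun z => x (σ z)) y ≠ 0) :
    gaussianCurvature x (σ y) = paramGaussianCurvature (fun z => x (σ z)) y := by
  set c := chartAt E2 (σ y) with hc
  let V := O ∩ σ ⁻¹' c.source
  have hV : IsOpen V := hσ.continuousOn.isOpen_inter_preimage hO c.open_source
  have hyc : σ y ∈ c.source := mem_chart_source E2 (σ y)
  have hyV : y ∈ V := ⟨hy, hyc⟩
  have hψ : ContDiffOn ℝ ∞ (fun z => c (σ z)) V :=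
    contDiffOn_comp_param (contMDiffOn_chartAt (σ y)) (hσ.mono Set.inter_subset_left)
      fun z hz => hz.2
  have hev : (fun z => x (σ z)) =ᶠ[𝓝 y] fun z => (fun z' => x (c.symm z')) (c (σ z)) := by
    filter_upwards [hV.mem_nhds hyV] with z hz
    simp only [c.left_inv hz.2]
  rw [gaussianCurvature_eq_chart, paramGaussianCurvature_congr hev]
  refine (paramGaussianCurvature_comp (ψ := fun z => c (σ z)) (chart_param_props hx (σ y)).1
    c.open_target hψ hV hyV (c.map_source hyc) ?_).symm
  unfold crossNormal at hN ⊢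
  rwa [← pd_congr hev, ← pd_congr hev]

theorem continuous_gaussianCurvature {x : M → E3} (hx : IsImmersedSurface x) :
    Continuous (gaussianCurvature x) := by
  rw [continuous_iff_continuousAt]
  intro p
  set c := chartAt E2 p with hc
  obtain ⟨h1, h2⟩ := chart_param_props hx p
  have hev : gaussianCurvature x =ᶠ[𝓝 p]
      fun q => paramGaussianCurvature (fun z => x (c.symm z)) (c q) := by
    filter_upwards [c.open_source.mem_nhds (mem_chart_source E2 p)] with q hq
    have := gaussianCurvature_eq_param hx (contMDiffOn_chartAt_symm p) c.open_target
      (c.map_source hq) (h2 _ (c.map_source hq)).2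
    rwa [c.left_inv hq] at this
  refine ContinuousAt.congr ?_ hev.symm
  have hp := mem_chart_source E2 p
  exact ContinuousAt.comp (f := c) (g := paramGaussianCurvature (fun z => x (c.symm z)))
    ((continuousOn_paramGaussianCurvature h1 c.open_target fun y hy => (h2 y hy).2).continuousAt
      (c.open_target.mem_nhds (c.map_source hp))) (c.continuousAt hp)

/-- An open piece of the surface all of whose tangent planes are vertical is flat. -/
theorem gaussianCurvature_eq_zero_of_vertical {x : M → E3} (hx : IsImmersedSurface x) {U : Set M}
    (hU : IsOpen U)
    (h : ∀ q ∈ U, ¬ Function.Surjective (mfderiv (𝓡 2) (𝓡 2) (fun q => horiz (x q)) q)) :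
    ∀ q ∈ U, gaussianCurvature x q = 0 := by
  intro p hp
  set c := chartAt E2 p with hc
  obtain ⟨h1, h2⟩ := chart_param_props hx p
  have hpc := mem_chart_source E2 p
  let O := c.target ∩ c.symm ⁻¹' U
  have hO : IsOpen O := c.continuousOn_symm.isOpen_inter_preimage c.open_target hU
  have hpO : c p ∈ O := ⟨c.map_source hpc, by simp only [Set.mem_preimage, c.left_inv hpc, hp]⟩
  rw [gaussianCurvature_eq_chart]
  refine paramGaussianCurvature_eq_zero_of_vertical (h1.mono Set.inter_subset_left) hO ?_ hpO
    (h2 _ hpO.1).2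
  intro y hy
  by_contra hne
  apply h _ hy.2
  intro b
  obtain ⟨v, hv⟩ := surjective_fderiv_horiz (h1.differentiableAt_of_isOpen c.open_target hy.1) hne b
  refine ⟨mfderiv (𝓡 2) (𝓡 2) c.symm y v, ?_⟩
  rw [← hv]
  exact (fderiv_comp_param (F := E2) ((contMDiff_horiz_comp hx).mdifferentiable (by simp) _)
    ((contMDiffOn_chartAt_symm p).mdifferentiableAt_of_isOpen c.open_target hy.1) v).symm

/-- A chart in which the surface is a graph over the horizontal plane: the chart is the horizontal
projection itself. -/
structure IsGraphChart (x : M → E3) (e : OpenPartialHomeomorph M E2) : Prop where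
  smooth_symm : ContMDiffOn (𝓡 2) (𝓡 2) ∞ e.symm e.target
  eq_horiz : ∀ q ∈ e.source, e q = horiz (x q)

/-- The surface is a graph near every point with a non-vertical tangent plane; this is the condition
that the horizontal projection be a submersion there. -/
theorem exists_isGraphChart {x : M → E3} (hx : IsImmersedSurface x) {p : M}
    (h : Function.Surjective (mfderiv (𝓡 2) (𝓡 2) (fun q => horiz (x q)) p)) :
    ∃ e : OpenPartialHomeomorph M E2, IsGraphChart x e ∧ p ∈ e.source := by
  set c := chartAt E2 p with hc
  have hpc : p ∈ c.source := mem_chart_source E2 p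
  have hW := contDiffOn_comp_param (contMDiff_horiz_comp hx).contMDiffOn
    (contMDiffOn_chartAt_symm p) (Set.mapsTo_univ _ _)
  have dσ := (contMDiffOn_chartAt_symm p).mdifferentiableAt_of_isOpen c.open_target (c.map_source hpc)
  have dc := (contMDiffOn_chartAt p).mdifferentiableAt_of_isOpen c.open_source hpc
  have dw := (contMDiff_horiz_comp hx).mdifferentiable (by simp)
  have hs : Function.Surjective (fderiv ℝ (fun z => horiz (x (c.symm z))) (c p)) := by
    intro b
    obtain ⟨u, hu⟩ := h b
    have dw' : MDifferentiableAt (𝓡 2) (𝓡 2) (fun z => horiz (x (c.symm z))) (c p) :=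
      (dw _).comp (c p) dσ
    have := mfderiv_comp p dw' dc
    have hev : (fun z => horiz (x (c.symm z))) ∘ c =ᶠ[𝓝 p] fun q => horiz (x q) := by
      filter_upwards [c.open_source.mem_nhds hpc] with q hq
      simp only [Function.comp, c.left_inv hq]
    rw [hev.mfderiv_eq, mfderiv_eq_fderiv] at this
    refine ⟨mfderiv (𝓡 2) (𝓡 2) c p u, ?_⟩
    rw [← hu, this]
    rfl
  obtain ⟨d, hd, hdO, hdf, hds⟩ := exists_local_diffeo hW c.open_target (c.map_source hpc) hs
  refine ⟨c.trans d, ⟨?_, ?_⟩, ?_⟩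
  · have h1 : ContMDiffOn (𝓡 2) (𝓡 2) ∞ d.symm d.target := contMDiffOn_iff_contDiffOn.2 hds
    refine ((contMDiffOn_chartAt_symm p).comp h1 fun v hv => hdO (d.map_target hv)).mono ?_
    intro v hv
    rw [OpenPartialHomeomorph.trans_target] at hv
    exact hv.1
  · intro q hq
    rw [OpenPartialHomeomorph.trans_source] at hq
    simp only [OpenPartialHomeomorph.coe_trans, Function.comp, hdf]
    rw [← hc, c.left_inv hq.1]
  · rw [OpenPartialHomeomorph.trans_source]
    exact ⟨hpc, hd⟩

end Immersion

/-! ### Local rotations of a surface -/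

section Flow

variable {M : Type*} [TopologicalSpace M] [ChartedSpace E2 M]

/-- The parametrization of a graph by logarithmic polar coordinates of the plane; it is
`2π`-periodic in the second coordinate. Outside `polarDomain e` its values are meaningless. -/
def polarParam (e : OpenPartialHomeomorph M E2) (y : E2) : M := e.symm (polarMap y)

/-- The domain of `polarParam e`. -/
def polarDomain (e : OpenPartialHomeomorph M E2) : Set E2 := polarMap ⁻¹' e.target

/-- The height of a graph as a function of logarithmic polar coordinates. -/
def polarHeight (x : M → E3) (e : OpenPartialHomeomorph M E2) (y : E2) : ℝ := x (polarParam e y) 2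

omit [ChartedSpace E2 M] in
theorem isOpen_polarDomain (e : OpenPartialHomeomorph M E2) : IsOpen (polarDomain e) :=
  e.open_target.preimage contDiff_polarMap.continuous

variable {x : M → E3} {e : OpenPartialHomeomorph M E2}

theorem IsGraphChart.horiz_polarParam (he : IsGraphChart x e) {y : E2} (hy : y ∈ polarDomain e) :
    horiz (x (polarParam e y)) = polarMap y := by
  have hy' : polarMap y ∈ e.target := hy
  rw [polarParam, ← he.eq_horiz _ (e.map_target hy'), e.right_inv hy']

theorem IsGraphChart.contMDiffOn_polarParam (he : IsGraphChart x e) :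
    ContMDiffOn (𝓡 2) (𝓡 2) ∞ (polarParam e) (polarDomain e) :=
  he.smooth_symm.comp contDiff_polarMap.contMDiff.contMDiffOn fun _ hy => hy

theorem IsGraphChart.contDiffOn_polarParam (hx : IsImmersedSurface x) (he : IsGraphChart x e) :
    ContDiffOn ℝ ∞ (fun y => x (polarParam e y)) (polarDomain e) :=
  contDiffOn_comp_param hx.1.contMDiffOn he.contMDiffOn_polarParam (Set.mapsTo_univ _ _)

theorem IsGraphChart.contDiffOn_polarHeight (hx : IsImmersedSurface x) (he : IsGraphChart x e) :
    ContDiffOn ℝ ∞ (polarHeight x e) (polarDomain e) :=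
  (contDiff_coord3 2).comp_contDiffOn (he.contDiffOn_polarParam hx)

theorem IsGraphChart.continuousAt_polarParam (he : IsGraphChart x e) {y : E2}
    (hy : y ∈ polarDomain e) : ContinuousAt (polarParam e) y :=
  he.contMDiffOn_polarParam.continuousOn.continuousAt ((isOpen_polarDomain e).mem_nhds hy)

/-- A point of a graph chart is determined by its horizontal projection. -/
theorem IsGraphChart.eq_polarParam (he : IsGraphChart x e) {q : M} (hq : q ∈ e.source) {y : E2}
    (h : horiz (x q) = polarMap y) : q = polarParam e y ∧ y ∈ polarDomain e := by
  have h1 := he.eq_horiz q hq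
  constructor
  · rw [polarParam, ← h, ← h1, e.left_inv hq]
  · change polarMap y ∈ e.target
    rw [← h, ← h1]; exact e.map_source hq

theorem IsGraphChart.gaussianCurvature_eq [IsManifold (𝓡 2) ∞ M] (hx : IsImmersedSurface x)
    (he : IsGraphChart x e) {y : E2} (hy : y ∈ polarDomain e) :
    gaussianCurvature x (polarParam e y) =
      curvNum (polarHeight x e) y / (gradSq (polarHeight x e) y + Real.exp (y 0) ^ 2) ^ 2 := by
  have hX := he.contDiffOn_polarParam hx
  have hO := isOpen_polarDomain e
  have hp : ∀ y ∈ polarDomain e, horiz (x (polarParam e y)) = polarMap y := fun y hy =>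
    he.horiz_polarParam hy
  rw [gaussianCurvature_eq_param hx he.contMDiffOn_polarParam hO hy
    (crossNormal_polarGraph hX hO hp hy).2, paramGaussianCurvature_polarGraph hX hO hp hy]
  rfl

/-- Local motions of the surface over the rotations of the horizontal plane, under which the
Gaussian curvature and the area element are invariant. -/
structure IsLocalTurn (x : M → E3) (ε : ℝ) (U : Set M) (Φ : ℝ × M → M) : Prop where
  pos : 0 < ε
  isOpen : IsOpen U
  smooth : ContMDiffOn (𝓘(ℝ, ℝ).prod (𝓡 2)) (𝓡 2) ∞ Φ (Set.Ioo (-ε) ε ×ˢ U)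
  map_zero : ∀ q ∈ U, Φ (0, q) = q
  horiz_eq : ∀ t ∈ Set.Ioo (-ε) ε, ∀ q ∈ U, horiz (x (Φ (t, q))) = planeRot t (horiz (x q))
  curv_eq : ∀ t ∈ Set.Ioo (-ε) ε, ∀ q ∈ U, gaussianCurvature x (Φ (t, q)) = gaussianCurvature x q
  area_eq : ∀ t ∈ Set.Ioo (-ε) ε, ∀ q ∈ U, ∀ u v : TangentSpace (𝓡 2) q,
    areaElement x (Φ (t, q)) (mfderiv (𝓡 2) (𝓡 2) (fun q' => Φ (t, q')) q u)
      (mfderiv (𝓡 2) (𝓡 2) (fun q' => Φ (t, q')) q v) = areaElement x q u v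

variable {ε : ℝ} {U : Set M} {Φ : ℝ × M → M}

theorem IsLocalTurn.isOpen_prod (hΦ : IsLocalTurn x ε U Φ) : IsOpen (Set.Ioo (-ε) ε ×ˢ U) :=
  isOpen_Ioo.prod hΦ.isOpen

theorem IsLocalTurn.zero_mem (hΦ : IsLocalTurn x ε U Φ) : (0 : ℝ) ∈ Set.Ioo (-ε) ε :=
  ⟨neg_lt_zero.2 hΦ.pos, hΦ.pos⟩

theorem IsLocalTurn.continuousAt (hΦ : IsLocalTurn x ε U Φ) {t : ℝ} (ht : t ∈ Set.Ioo (-ε) ε) {q : M}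
    (hq : q ∈ U) : ContinuousAt Φ (t, q) :=
  hΦ.smooth.continuousOn.continuousAt (hΦ.isOpen_prod.mem_nhds ⟨ht, hq⟩)

theorem IsLocalTurn.contMDiffOn_left (hΦ : IsLocalTurn x ε U Φ) {t : ℝ} (ht : t ∈ Set.Ioo (-ε) ε) :
    ContMDiffOn (𝓡 2) (𝓡 2) ∞ (fun q => Φ (t, q)) U :=
  hΦ.smooth.comp (contMDiff_const.prodMk contMDiff_id).contMDiffOn fun _ hq => ⟨ht, hq⟩

/-- In polar coordinates the motions are translations. -/
theorem IsLocalTurn.eventually_eq (hΦ : IsLocalTurn x ε U Φ) (he : IsGraphChart x e) {y : E2}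
    (hy : y ∈ polarDomain e) (hyU : polarParam e y ∈ U) :
    ∀ᶠ a : ℝ × E2 in 𝓝 (0, y),
      Φ (a.1, polarParam e a.2) = polarParam e (a.2 + a.1 • EuclideanSpace.single 1 1) ∧
        a.2 + a.1 • EuclideanSpace.single 1 1 ∈ polarDomain e := by
  have hσ := he.continuousAt_polarParam hy
  have hy' : polarMap y ∈ e.target := hy
  have hsrc : polarParam e y ∈ e.source := e.map_target hy'
  have h2 : ContinuousAt (fun a : ℝ × E2 => (a.1, polarParam e a.2)) (0, y) :=
    continuousAt_fst.prodMk (hσ.comp (f := Prod.snd) (x := ((0 : ℝ), y)) continuousAt_snd)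
  have hg : ContinuousAt (fun a : ℝ × E2 => Φ (a.1, polarParam e a.2)) (0, y) :=
    ContinuousAt.comp (f := fun a : ℝ × E2 => (a.1, polarParam e a.2))
      (hΦ.continuousAt hΦ.zero_mem hyU) h2
  filter_upwards [hg.preimage_mem_nhds (e.open_source.mem_nhds
      (show Φ (0, polarParam e y) ∈ e.source by rw [hΦ.map_zero _ hyU]; exact hsrc)),
    h2.preimage_mem_nhds (hΦ.isOpen_prod.mem_nhds ⟨hΦ.zero_mem, hyU⟩),
    (continuousAt_snd (X := ℝ) (Y := E2)).preimage_mem_nhds ((isOpen_polarDomain e).mem_nhds hy)]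
    with a h3 h4 h5
  refine he.eq_polarParam h3 ?_
  rw [hΦ.horiz_eq _ h4.1 _ h4.2, he.horiz_polarParam h5, polarMap_add]

/-- Slope and curvature are invariant under small rotations: the area element of a graph determines
its slope. -/
theorem IsLocalTurn.invariant [IsManifold (𝓡 2) ∞ M] (hx : IsImmersedSurface x)
    (hΦ : IsLocalTurn x ε U Φ) (he : IsGraphChart x e) {y : E2}
    (hy : y ∈ polarDomain e) (hyU : polarParam e y ∈ U) :
    ∀ᶠ t : ℝ in 𝓝 0,
      gradSq (polarHeight x e) (y + t • EuclideanSpace.single 1 1) = gradSq (polarHeight x e) y ∧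
      curvNum (polarHeight x e) (y + t • EuclideanSpace.single 1 1) =
        curvNum (polarHeight x e) y := by
  have hX := he.contDiffOn_polarParam hx
  have hO := isOpen_polarDomain e
  have hp : ∀ y ∈ polarDomain e, horiz (x (polarParam e y)) = polarMap y := fun y hy =>
    he.horiz_polarParam hy
  have hev := hΦ.eventually_eq he hy hyU
  rw [nhds_prod_eq] at hev
  filter_upwards [hev.curry, isOpen_Ioo.mem_nhds hΦ.zero_mem] with t ht htε
  have ht0 := ht.self_of_nhds
  set w : E2 := t • EuclideanSpace.single 1 1 with hw
  have hw0 : (y + w) 0 = y 0 := by simp [hw]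
  set X := fun y => x (polarParam e y) with hXdef
  have hpd : ∀ i, pd i X (y + w) = mfderiv (𝓡 2) 𝓘(ℝ, E3) x (Φ (t, polarParam e y))
      (mfderiv (𝓡 2) (𝓡 2) (fun q' => Φ (t, q')) (polarParam e y)
        (mfderiv (𝓡 2) (𝓡 2) (polarParam e) y (EuclideanSpace.single i 1))) := by
    intro i
    have dσ := he.contMDiffOn_polarParam.mdifferentiableAt_of_isOpen hO hy
    have dΦ := (hΦ.contMDiffOn_left htε).mdifferentiableAt_of_isOpen hΦ.isOpen hyU
    have dc : MDifferentiableAt (𝓡 2) (𝓡 2) (fun z => Φ (t, polarParam e z)) y := dΦ.comp y dσ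
    have h1 := fderiv_comp_param (hx.1.mdifferentiable (by simp) (Φ (t, polarParam e y))) dc
      (EuclideanSpace.single i 1)
    have h2 : mfderiv (𝓡 2) (𝓡 2) (fun z => Φ (t, polarParam e z)) y = _ :=
      mfderiv_comp (g := fun q => Φ (t, q)) y dΦ dσ
    rw [h2] at h1
    rw [← pd_comp_add, pd_congr (g := fun z => x (Φ (t, polarParam e z)))
      (by filter_upwards [ht] with z hz; simp only [hXdef]; rw [hz.1])]
    exact h1
  have hpd0 : ∀ i, pd i X y = mfderiv (𝓡 2) 𝓘(ℝ, E3) x (polarParam e y)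
        (mfderiv (𝓡 2) (𝓡 2) (polarParam e) y (EuclideanSpace.single i 1)) := fun i =>
    fderiv_comp_param (hx.1.mdifferentiable (by simp) (polarParam e y))
      (he.contMDiffOn_polarParam.mdifferentiableAt_of_isOpen hO hy) (EuclideanSpace.single i 1)
  have harea : ‖crossNormal X (y + w)‖ = ‖crossNormal X y‖ := by
    unfold crossNormal
    rw [hpd, hpd, hpd0, hpd0]
    exact hΦ.area_eq t htε _ hyU _ _
  have hpos : Real.exp (y 0) ^ 2 ≠ 0 := by positivity
  have hg : gradSq (polarHeight x e) (y + w) = gradSq (polarHeight x e) y := by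
    have h1 := (crossNormal_polarGraph hX hO hp hy).1
    have h2 := (crossNormal_polarGraph hX hO hp ht0.2).1
    rw [harea, h1, hw0] at h2
    exact (add_right_cancel (mul_left_cancel₀ hpos h2)).symm
  refine ⟨hg, ?_⟩
  have hk := hΦ.curv_eq t htε _ hyU
  rw [ht0.1, he.gaussianCurvature_eq hx hy, he.gaussianCurvature_eq hx ht0.2, hg, hw0] at hk
  have hden : (gradSq (polarHeight x e) y + Real.exp (y 0) ^ 2) ^ 2 ≠ 0 := by
    have : 0 ≤ gradSq (polarHeight x e) y := by unfold gradSq; positivity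
    have := Real.exp_pos (y 0)
    positivity
  exact (div_left_inj' hden).1 hk

/-- The infinitesimal form of the invariance. -/
theorem IsLocalTurn.pd_one_eq_zero [IsManifold (𝓡 2) ∞ M] (hx : IsImmersedSurface x)
    (hΦ : IsLocalTurn x ε U Φ) (he : IsGraphChart x e) {y : E2}
    (hy : y ∈ polarDomain e) (hyU : polarParam e y ∈ U) :
    pd 1 (gradSq (polarHeight x e)) y = 0 ∧ pd 1 (curvNum (polarHeight x e)) y = 0 := by
  have hf := he.contDiffOn_polarHeight hx
  have hO := isOpen_polarDomain e
  have h := hΦ.invariant hx he hy hyU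
  exact ⟨pd_eq_zero_of_invariant ((hf.gradSq hO).differentiableAt_of_isOpen hO hy) 1
      (h.mono fun t ht => ht.1),
    pd_eq_zero_of_invariant ((hf.curvNum hO).differentiableAt_of_isOpen hO hy) 1
      (h.mono fun t ht => ht.2)⟩

/-- The rate at which the height changes under the motions. -/
def heightRate (x : M → E3) (Φ : ℝ × M → M) (q : M) : ℝ := deriv (fun t => x (Φ (t, q)) 2) 0

/-- The second time derivative of the height under the motions. Like `heightRate` it is continuous
on all of the domain of the motions, the axis and points with vertical tangent planes included. -/
def heightRate₂ (x : M → E3) (Φ : ℝ × M → M) (q : M) : ℝ :=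
  deriv (deriv fun t => x (Φ (t, q)) 2) 0

theorem hasDerivAt_add_smul {f : E2 → ℝ} {y : E2} (hd : DifferentiableAt ℝ f y) (s : ℝ) :
    HasDerivAt (fun t : ℝ => f (y + (t - s) • EuclideanSpace.single 1 1)) (pd 1 f y) s := by
  have h1 : HasDerivAt (fun t : ℝ => y + (t - s) • (EuclideanSpace.single 1 1 : E2))
      (EuclideanSpace.single 1 1) s := by
    simpa using (((hasDerivAt_id s).sub_const s).smul_const
      (EuclideanSpace.single 1 1 : E2)).const_add y
  have hd' : HasFDerivAt f (fderiv ℝ f y) (y + (s - s) • (EuclideanSpace.single 1 1 : E2)) := by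
    simpa using hd.hasFDerivAt
  exact hd'.comp_hasDerivAt s h1

/-- On a graph, the time derivatives of the height under the motions are the `θ`-derivatives of the
height function. -/
theorem IsLocalTurn.heightRate_eq (hx : IsImmersedSurface x) (hΦ : IsLocalTurn x ε U Φ)
    (he : IsGraphChart x e) {y : E2} (hy : y ∈ polarDomain e) (hyU : polarParam e y ∈ U) :
    heightRate x Φ (polarParam e y) = pd 1 (polarHeight x e) y ∧
      heightRate₂ x Φ (polarParam e y) = pd 1 (pd 1 (polarHeight x e)) y := by
  have hf := he.contDiffOn_polarHeight hx
  have hO := isOpen_polarDomain e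
  have hev : ∀ᶠ t : ℝ in 𝓝 0,
      Φ (t, polarParam e y) = polarParam e (y + t • EuclideanSpace.single 1 1) ∧
        y + t • EuclideanSpace.single 1 1 ∈ polarDomain e := by
    have h := hΦ.eventually_eq he hy hyU
    rw [nhds_prod_eq] at h
    exact h.curry.mono fun t ht => ht.self_of_nhds
  have h1 : (fun t => x (Φ (t, polarParam e y)) 2) =ᶠ[𝓝 0]
      fun t => polarHeight x e (y + t • EuclideanSpace.single 1 1) := by
    filter_upwards [hev] with t ht
    rw [ht.1]; rfl
  have h2 : deriv (fun t => x (Φ (t, polarParam e y)) 2) =ᶠ[𝓝 0]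
      fun t => pd 1 (polarHeight x e) (y + t • EuclideanSpace.single 1 1) := by
    filter_upwards [h1.eventuallyEq_nhds, hev] with t ht ht'
    have h3 := hasDerivAt_add_smul (hf.differentiableAt_of_isOpen hO ht'.2) t
    have h4 : (fun s : ℝ => polarHeight x e (y + t • EuclideanSpace.single 1 1 +
        (s - t) • EuclideanSpace.single 1 1)) =
        fun s => polarHeight x e (y + s • EuclideanSpace.single 1 1) := by
      funext s; rw [add_assoc, ← add_smul]; congr 3; ring
    rw [h4] at h3
    rw [ht.deriv_eq, h3.deriv]
  refine ⟨?_, ?_⟩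
  · have := h2.eq_of_nhds
    simpa [heightRate] using this
  · have h3 := hasDerivAt_add_smul ((hf.pd hO 1).differentiableAt_of_isOpen hO hy) 0
    simp only [sub_zero] at h3
    rw [heightRate₂, h2.deriv_eq, h3.deriv]

/-- The height under the motions, in a chart. -/
theorem IsLocalTurn.contDiffOn_height [IsManifold (𝓡 2) ∞ M] (hx : IsImmersedSurface x)
    (hΦ : IsLocalTurn x ε U Φ) (p : M) :
    ContDiffOn ℝ ∞ (fun a : ℝ × E2 => x (Φ (a.1, (chartAt E2 p).symm a.2)) 2)
      (Set.Ioo (-ε) ε ×ˢ ((chartAt E2 p).target ∩ (chartAt E2 p).symm ⁻¹' U)) := by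
  have h1 : ContMDiff (𝓡 2) 𝓘(ℝ, ℝ) ∞ fun q => x q 2 := (contDiff_coord3 2).contMDiff.comp hx.1
  have h2 : ContMDiffOn (𝓘(ℝ, ℝ).prod (𝓡 2)) (𝓘(ℝ, ℝ).prod (𝓡 2)) ∞
      (fun a : ℝ × E2 => (a.1, (chartAt E2 p).symm a.2))
      (Set.Ioo (-ε) ε ×ˢ ((chartAt E2 p).target ∩ (chartAt E2 p).symm ⁻¹' U)) :=
    contMDiffOn_fst.prodMk
      (((contMDiffOn_chartAt_symm p).mono Set.inter_subset_left).comp contMDiffOn_snd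
        fun a ha => ha.2)
  have h3 := (h1.comp_contMDiffOn hΦ.smooth).comp h2 fun a ha => ⟨ha.1, ha.2.2⟩
  rw [← contMDiffOn_iff_contDiffOn, modelWithCornersSelf_prod, ← chartedSpaceSelf_prod]
  exact h3

/-- The rates of the height are smooth, being partial derivatives of `(t, z) ↦ x (Φ (t, z)) 2`. -/
theorem IsLocalTurn.contDiffOn_heightRate [IsManifold (𝓡 2) ∞ M] (hx : IsImmersedSurface x)
    (hΦ : IsLocalTurn x ε U Φ) (p : M) :
    ContDiffOn ℝ ∞ (fun z => heightRate x Φ ((chartAt E2 p).symm z))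
        ((chartAt E2 p).target ∩ (chartAt E2 p).symm ⁻¹' U) ∧
      ContDiffOn ℝ ∞ (fun z => heightRate₂ x Φ ((chartAt E2 p).symm z))
        ((chartAt E2 p).target ∩ (chartAt E2 p).symm ⁻¹' U) := by
  set O := (chartAt E2 p).target ∩ (chartAt E2 p).symm ⁻¹' U
  have hO : IsOpen O := (chartAt E2 p).continuousOn_symm.isOpen_inter_preimage
    (chartAt E2 p).open_target hΦ.isOpen
  have hprod : IsOpen (Set.Ioo (-ε) ε ×ˢ O) := isOpen_Ioo.prod hO
  set ζ := fun a : ℝ × E2 => x (Φ (a.1, (chartAt E2 p).symm a.2)) 2 with hζ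
  -- The partial derivative with respect to time of a function on `ℝ × E2`.
  have hpart : ∀ ξ : ℝ × E2 → ℝ, ContDiffOn ℝ ∞ ξ (Set.Ioo (-ε) ε ×ˢ O) →
      ContDiffOn ℝ ∞ (fun a => fderiv ℝ ξ a (1, 0)) (Set.Ioo (-ε) ε ×ˢ O) ∧
      ∀ t ∈ Set.Ioo (-ε) ε, ∀ z ∈ O,
        HasDerivAt (fun s => ξ (s, z)) (fderiv ℝ ξ (t, z) (1, 0)) t := by
    intro ξ hξ
    refine ⟨(hξ.fderiv_of_isOpen hprod (by simp)).clm_apply contDiffOn_const, fun t ht z hz => ?_⟩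
    have hd : DifferentiableAt ℝ ξ (t, z) :=
      (hξ.contDiffAt (hprod.mem_nhds ⟨ht, hz⟩)).differentiableAt (by simp)
    exact hd.hasFDerivAt.comp_hasDerivAt t ((hasDerivAt_id t).prodMk (hasDerivAt_const t z))
  obtain ⟨s1, d1⟩ := hpart ζ (hΦ.contDiffOn_height hx p)
  obtain ⟨s2, d2⟩ := hpart _ s1
  have hemb : ContDiff ℝ ∞ fun z : E2 => ((0 : ℝ), z) := contDiff_const.prodMk contDiff_id
  constructor
  · refine (s1.comp hemb.contDiffOn fun z hz => ⟨hΦ.zero_mem, hz⟩).congr fun z hz => ?_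
    exact (d1 0 hΦ.zero_mem z hz).deriv
  · refine (s2.comp hemb.contDiffOn fun z hz => ⟨hΦ.zero_mem, hz⟩).congr fun z hz => ?_
    have : deriv (fun s => ζ (s, z)) =ᶠ[𝓝 0] fun t => fderiv ℝ ζ (t, z) (1, 0) := by
      filter_upwards [isOpen_Ioo.mem_nhds hΦ.zero_mem] with t ht
      exact (d1 t ht z hz).deriv
    exact this.deriv_eq.trans (d2 0 hΦ.zero_mem z hz).deriv

theorem IsLocalTurn.continuousAt_heightRate [IsManifold (𝓡 2) ∞ M] (hx : IsImmersedSurface x)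
    (hΦ : IsLocalTurn x ε U Φ) {p : M} (hp : p ∈ U) :
    ContinuousAt (heightRate x Φ) p ∧ ContinuousAt (heightRate₂ x Φ) p := by
  obtain ⟨h1, h2⟩ := hΦ.contDiffOn_heightRate hx p
  set c := chartAt E2 p
  have hpc : p ∈ c.source := mem_chart_source E2 p
  have hO : IsOpen (c.target ∩ c.symm ⁻¹' U) := c.continuousOn_symm.isOpen_inter_preimage
    c.open_target hΦ.isOpen
  have hpO : c p ∈ c.target ∩ c.symm ⁻¹' U :=
    ⟨c.map_source hpc, by simp only [Set.mem_preimage, c.left_inv hpc, hp]⟩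
  have key : ∀ H : M → ℝ, ContDiffOn ℝ ∞ (fun z => H (c.symm z)) (c.target ∩ c.symm ⁻¹' U) →
      ContinuousAt H p := by
    intro H hH
    have hev : (fun z => H (c.symm z)) ∘ c =ᶠ[𝓝 p] H := by
      filter_upwards [c.open_source.mem_nhds hpc] with q hq
      simp only [Function.comp, c.left_inv hq]
    exact (ContinuousAt.comp (hH.continuousOn.continuousAt (hO.mem_nhds hpO))
      (c.continuousAt hpc)).congr hev
  exact ⟨key _ h1, key _ h2⟩

end Flow

/-! ### The classes of the surfaces x_{m,c} -/

section PowerPoints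

variable {M : Type*} [TopologicalSpace M] [ChartedSpace E2 M]

/-- The first- and second-order relations of `z₀ + c exp (m τ) cos (m θ + b)`. They do not depend on
the additive constant `z₀` and the phase `b`, that is, on the position of the graph of `x_{m,c}`. -/
def PowerRel (m c : ℝ) (f : E2 → ℝ) (y : E2) : Prop :=
  IsPowerJet m f y ∧ gradSq f y = c ^ 2 * m ^ 2 * Real.exp (2 * m * y 0)

/-- The point `p` is off the axis, and near `p` the surface is a graph congruent to `x_{m,c}` by a
screw motion about the axis. This is expressed by differential relations, so that it can be passed
to limits; they are required at all logarithmic polar coordinates of the points of a graph chart,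
which makes them independent of a choice of the angle. -/
def IsPowerPoint (x : M → E3) (m c : ℝ) (p : M) : Prop :=
  ∃ e : OpenPartialHomeomorph M E2, IsGraphChart x e ∧ p ∈ e.source ∧ horiz (x p) ≠ 0 ∧
    ∀ y ∈ polarDomain e, PowerRel m c (polarHeight x e) y

variable {x : M → E3} {e : OpenPartialHomeomorph M E2} {m c : ℝ}

theorem eq_of_frequently_eq {α : Type*} [TopologicalSpace α] {f g : α → ℝ} {a : α}
    (hf : ContinuousAt f a) (hg : ContinuousAt g a) (h : ∃ᶠ z in 𝓝 a, f z = g z) : f a = g a := by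
  by_contra hne
  exact h (hf.ne_iff_eventually_ne hg |>.1 hne)

theorem le_of_frequently_le {α : Type*} [TopologicalSpace α] {f g : α → ℝ} {a : α}
    (hf : ContinuousAt f a) (hg : ContinuousAt g a) (h : ∃ᶠ z in 𝓝 a, f z ≤ g z) : f a ≤ g a := by
  by_contra hlt
  push Not at hlt
  exact h ((hg.eventually_lt hf hlt).mono fun z hz => not_le.2 hz)

theorem PowerRel.congr {f g : E2 → ℝ} {y : E2} (h : f =ᶠ[𝓝 y] g) (hf : PowerRel m c f y) :
    PowerRel m c g y := by
  unfold PowerRel IsPowerJet gradSq at *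
  simpa only [pd_congr h, pd_congr (pd_congr_eventually h _)] using hf

theorem continuous_horiz_comp (hx : IsImmersedSurface x) : Continuous fun q => horiz (x q) :=
  contDiff_horiz.continuous.comp hx.1.continuous

theorem isOpen_isPowerPoint (hx : IsImmersedSurface x) : IsOpen {p | IsPowerPoint x m c p} := by
  rw [isOpen_iff_mem_nhds]
  rintro p ⟨e, he, hp, hne, hrel⟩
  filter_upwards [e.open_source.mem_nhds hp,
    (continuous_horiz_comp hx).continuousAt.eventually_ne hne] with q hq hqne
  exact ⟨e, he, hq, hqne, hrel⟩

/-- The inverses of two graph charts agree near common points. -/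
theorem IsGraphChart.symm_eventuallyEq {e' : OpenPartialHomeomorph M E2} (he : IsGraphChart x e)
    (he' : IsGraphChart x e') {v : E2} (hv : v ∈ e.target) (hq : e.symm v ∈ e'.source) :
    e.symm =ᶠ[𝓝 v] e'.symm := by
  have hc := e.continuousAt_symm hv
  filter_upwards [e.open_target.mem_nhds hv, hc.preimage_mem_nhds (e'.open_source.mem_nhds hq)]
    with u hu hu'
  have h1 : e' (e.symm u) = u := by
    rw [he'.eq_horiz _ hu', ← he.eq_horiz _ (e.map_target hu), e.right_inv hu]
  rw [← e'.left_inv hu', h1]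

theorem IsPowerPoint.powerRel (he : IsGraphChart x e) {y : E2} (hy : y ∈ polarDomain e)
    (hp : IsPowerPoint x m c (polarParam e y)) : PowerRel m c (polarHeight x e) y := by
  obtain ⟨e', he', hq, -, hrel⟩ := hp
  have hy' := (he'.eq_polarParam hq (he.horiz_polarParam hy)).2
  have hev := he.symm_eventuallyEq he' hy hq
  refine PowerRel.congr ?_ (hrel y hy')
  filter_upwards [contDiff_polarMap.continuous.continuousAt.preimage_mem_nhds hev] with z hz
  have hz' : e.symm (polarMap z) = e'.symm (polarMap z) := hz
  simp only [polarHeight, polarParam, hz']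

/-- Near a point off the axis, logarithmic polar coordinates can be chosen smoothly. -/
theorem IsGraphChart.exists_polar (hx : IsImmersedSurface x) (he : IsGraphChart x e) {p : M}
    (hp : p ∈ e.source) {y : E2} (hy : polarMap y = horiz (x p)) :
    ∃ ψ : M → E2, ∃ V : Set M, IsOpen V ∧ p ∈ V ∧ V ⊆ e.source ∧ ContMDiffOn (𝓡 2) (𝓡 2) ∞ ψ V ∧
      ψ p = y ∧ ∀ q ∈ V, ψ q ∈ polarDomain e ∧ polarParam e (ψ q) = q ∧
        polarMap (ψ q) = horiz (x q) := by
  obtain ⟨ρ, V, hV, hyV, hρ, hinv, hρy⟩ := exists_local_inverse_polarMap y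
  have hw := contMDiff_horiz_comp hx
  refine ⟨fun q => ρ (horiz (x q)), e.source ∩ (fun q => horiz (x q)) ⁻¹' V,
    e.open_source.inter (hV.preimage hw.continuous), ⟨hp, by simpa only [Set.mem_preimage, ← hy]⟩,
    Set.inter_subset_left, ?_,
    by change ρ (horiz (x p)) = y; rw [← hy, hρy], ?_⟩
  · exact (contMDiffOn_iff_contDiffOn.2 hρ).comp hw.contMDiffOn fun q hq => hq.2
  · rintro q ⟨hq, hqV⟩
    have h1 := hinv _ hqV
    have h2 := he.eq_polarParam hq h1.symm
    exact ⟨h2.2, h2.1.symm, h1⟩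

/-- It is enough that the relations hold for one choice of the angle, by `pd_comp_polarMap_eq`. -/
theorem isPowerPoint_of_eventually (he : IsGraphChart x e) {y : E2} (hy : y ∈ polarDomain e)
    (h : ∀ᶠ z in 𝓝 y, PowerRel m c (polarHeight x e) z) : IsPowerPoint x m c (polarParam e y) := by
  obtain ⟨N, hN, hNo, hyN⟩ := eventually_nhds_iff.1 h
  obtain ⟨ρ, V, hV, hyV, hρ, hinv, hρy⟩ := exists_local_inverse_polarMap y
  have hV' : IsOpen (V ∩ ρ ⁻¹' N) := hρ.continuousOn.isOpen_inter_preimage hV hNo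
  have hy' : polarMap y ∈ e.target := hy
  refine ⟨e.trans (OpenPartialHomeomorph.ofSet _ hV'), ⟨?_, ?_⟩, ?_, ?_, ?_⟩
  · refine he.smooth_symm.mono ?_
    intro v hv
    simp only [OpenPartialHomeomorph.trans_target] at hv
    exact hv.2
  · intro q hq
    simp only [OpenPartialHomeomorph.trans_source] at hq
    exact he.eq_horiz q hq.1
  · simp only [OpenPartialHomeomorph.trans_source]
    refine ⟨e.map_target hy', ?_⟩
    simp only [polarParam, Set.mem_preimage, e.right_inv hy']
    exact ⟨hyV, by simpa only [Set.mem_preimage, hρy]⟩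
  · rw [he.horiz_polarParam hy]; exact polarMap_ne_zero y
  · intro z hz
    have hz : polarMap z ∈ (e.trans (OpenPartialHomeomorph.ofSet _ hV')).target := hz
    simp only [OpenPartialHomeomorph.trans_target] at hz
    obtain ⟨⟨hzV, hzN⟩, -⟩ := hz
    obtain ⟨⟨r1, r2, r3⟩, r4⟩ := hN _ hzN
    have hz1 := hinv _ hzV
    obtain ⟨d1, d2⟩ := pd_comp_polarMap_eq (fun v => x (e.symm v) 2) hz1
    have h0 : ρ (polarMap z) 0 = z 0 :=
      Real.exp_injective (by rw [← norm_polarMap, ← norm_polarMap, hz1])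
    have hF : polarHeight x (e.trans (OpenPartialHomeomorph.ofSet _ hV')) =
      (fun v => x (e.symm v) 2) ∘ polarMap := rfl
    have hF' : polarHeight x e = (fun v => x (e.symm v) 2) ∘ polarMap := rfl
    rw [hF'] at r1 r2 r3 r4
    rw [hF]
    unfold PowerRel IsPowerJet gradSq at *
    rw [d1, d1, h0] at r4
    rw [d2, d1] at r1 r2 r3
    exact ⟨⟨r1, r2, r3⟩, r4⟩

theorem exp_mul_eq_rpow (a τ : ℝ) : Real.exp (a * τ) = Real.exp τ ^ a := by
  rw [mul_comm, Real.exp_mul]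

/-- At a point of the class `(m, c)` the squared slope is `c² m² r ^ (2 m - 2)`; by the
Cauchy-Schwarz inequality this bounds the vertical component of every tangent vector. Stated for an
arbitrary parametrization, the bound makes sense at limits of such points. -/
theorem IsPowerPoint.slope_le (hx : IsImmersedSurface x) {σ : E2 → M} {z : E2}
    (hσ : MDifferentiableAt (𝓡 2) (𝓡 2) σ z) (hp : IsPowerPoint x m c (σ z)) (v : E2) :
    (fderiv ℝ (fun z => x (σ z)) z v 2) ^ 2 ≤
      c ^ 2 * m ^ 2 * ‖horiz (x (σ z))‖ ^ (2 * m - 2) *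
        ‖horiz (fderiv ℝ (fun z => x (σ z)) z v)‖ ^ 2 := by
  obtain ⟨e, he, hq, hne, hrel⟩ := hp
  obtain ⟨y, hy⟩ := exists_polarMap_eq hne
  obtain ⟨hqy, hyd⟩ := he.eq_polarParam hq hy.symm
  have hyt : polarMap y ∈ e.target := hyd
  have hX : DifferentiableAt ℝ (fun z => x (σ z)) z :=
    mdifferentiableAt_iff_differentiableAt.1
      (((hx.1.mdifferentiable (by simp)) (σ z)).comp z hσ)
  set h : E2 → ℝ := fun v => x (e.symm v) 2 with hh
  have hhd : DifferentiableAt ℝ h (polarMap y) := by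
    have : ContDiffOn ℝ ∞ h e.target := (contDiff_coord3 2).comp_contDiffOn
      (contDiffOn_comp_param hx.1.contMDiffOn he.smooth_symm (Set.mapsTo_univ _ _))
    exact this.differentiableAt_of_isOpen e.open_target hyt
  have hev : (fun z => x (σ z) 2) =ᶠ[𝓝 z] fun z' => h (horiz (x (σ z'))) := by
    filter_upwards [hσ.continuousAt.preimage_mem_nhds (e.open_source.mem_nhds hq)] with z' hz'
    simp only [hh, ← he.eq_horiz _ hz', e.left_inv hz']
  have hwd : DifferentiableAt ℝ (fun z => horiz (x (σ z))) z :=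
    (contDiff_horiz.differentiable (by simp) _).comp z hX
  set u := horiz (fderiv ℝ (fun z => x (σ z)) z v) with hu
  have e1 : fderiv ℝ (fun z => x (σ z)) z v 2 = fderiv ℝ h (polarMap y) u := by
    have h1 : fderiv ℝ (fun z => x (σ z) 2) z v = fderiv ℝ (fun z => x (σ z)) z v 2 := by
      have := ((EuclideanSpace.proj 2 : E3 →L[ℝ] ℝ).hasFDerivAt.comp z hX.hasFDerivAt).fderiv
      exact congrArg (fun L => L v) this
    rw [hy] at hhd
    have h2 := fderiv_comp (g := h) z hhd hwd
    rw [← h1, hev.fderiv_eq,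
      show (fun z' => h (horiz (x (σ z')))) = h ∘ fun z => horiz (x (σ z)) from rfl,
      h2, hu, ← fderiv_horiz_comp hX, hy]
    rfl
  obtain ⟨a, ha⟩ := fderiv_polarMap_surjective y u
  have e2 : fderiv ℝ h (polarMap y) u =
      a 0 * pd 0 (polarHeight x e) y + a 1 * pd 1 (polarHeight x e) y := by
    have h2 := fderiv_comp (g := h) y hhd (contDiff_polarMap.differentiable (by simp) y)
    have h3 : polarHeight x e = h ∘ polarMap := rfl
    have h4 := fderiv_eq_pd (polarHeight x e) y a
    rw [h3, h2, ContinuousLinearMap.comp_apply, ha] at h4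
    rw [h4, h3]; rfl
  have hn : ‖u‖ ^ 2 = Real.exp (y 0) ^ 2 * (a 0 ^ 2 + a 1 ^ 2) := by
    rw [← ha, norm_fderiv_polarMap_apply, mul_pow, norm_sq_e2]
  have hg := (hrel y hyd).2
  have hexp : ‖horiz (x (σ z))‖ ^ (2 * m - 2) * Real.exp (y 0) ^ 2 = Real.exp (2 * m * y 0) := by
    rw [← hy, norm_polarMap, ← exp_mul_eq_rpow, ← Real.exp_nat_mul, ← Real.exp_add]
    congr 1; push_cast; ring
  rw [e1, e2, hn]
  calc _ ≤ gradSq (polarHeight x e) y * (a 0 ^ 2 + a 1 ^ 2) := by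
        unfold gradSq
        nlinarith [sq_nonneg (a 0 * pd 1 (polarHeight x e) y - a 1 * pd 0 (polarHeight x e) y)]
    _ = _ := by rw [hg, ← hexp]; ring

variable [IsManifold (𝓡 2) ∞ M]

/-- The tangent plane at a limit of points of the class `(m, c)` is not vertical, as the bound on
the slope passes to the limit. On the axis, `1 ≤ m` is needed for the bound to stay finite. -/
theorem exists_isGraphChart_of_mem_closure (hx : IsImmersedSurface x) {p : M}
    (hp : p ∈ closure {q | IsPowerPoint x m c q}) (h : horiz (x p) ≠ 0 ∨ 1 ≤ m) :
    ∃ e : OpenPartialHomeomorph M E2, IsGraphChart x e ∧ p ∈ e.source := by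
  set κ := chartAt E2 p
  have hpκ : p ∈ κ.source := mem_chart_source E2 p
  have hz := κ.map_source hpκ
  obtain ⟨h1, h2⟩ := chart_param_props hx p
  have hs := contMDiffOn_chartAt_symm p
  have hdX := h1.differentiableAt_of_isOpen κ.open_target hz
  have hinv : κ.symm (κ p) = p := κ.left_inv hpκ
  have hfreq : ∃ᶠ z in 𝓝 (κ p), z ∈ κ.target ∧ IsPowerPoint x m c (κ.symm z) := by
    have : Filter.Tendsto κ (𝓝 p) (𝓝 (κ p)) := κ.continuousAt hpκ
    refine this.frequently ?_
    refine ((mem_closure_iff_frequently.1 hp).and_eventually (κ.open_source.mem_nhds hpκ)).mono ?_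
    rintro q ⟨hq, hqs⟩
    exact ⟨κ.map_source hqs, by rwa [κ.left_inv hqs]⟩
  have hX : ContinuousAt (fun z => x (κ.symm z)) (κ p) := hdX.continuousAt
  have hdc : ContinuousAt (fderiv ℝ fun z => x (κ.symm z)) (κ p) :=
    (h1.continuousOn_fderiv_of_isOpen κ.open_target (by simp)).continuousAt
      (κ.open_target.mem_nhds hz)
  have hle : ∀ v : E2, (fderiv ℝ (fun z => x (κ.symm z)) (κ p) v 2) ^ 2 ≤
      c ^ 2 * m ^ 2 * ‖horiz (x (κ.symm (κ p)))‖ ^ (2 * m - 2) *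
        ‖horiz (fderiv ℝ (fun z => x (κ.symm z)) (κ p) v)‖ ^ 2 := by
    intro v
    have hdv : ContinuousAt (fun z => fderiv ℝ (fun z => x (κ.symm z)) z v) (κ p) :=
      hdc.clm_apply continuousAt_const
    refine le_of_frequently_le (f := fun z => (fderiv ℝ (fun z => x (κ.symm z)) z v 2) ^ 2)
      (g := fun z => c ^ 2 * m ^ 2 * ‖horiz (x (κ.symm z))‖ ^ (2 * m - 2) *
        ‖horiz (fderiv ℝ (fun z => x (κ.symm z)) z v)‖ ^ 2) ?_ ?_ (hfreq.mono ?_)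
    · exact (((contDiff_coord3 2).continuous.continuousAt).comp hdv).pow 2
    · refine (continuousAt_const.mul (ContinuousAt.rpow_const ?_ ?_)).mul ?_
      · exact (contDiff_horiz.continuous.continuousAt.comp hX).norm
      · rcases h with h | h
        · left; rw [hinv]; exact norm_ne_zero_iff.2 h
        · right; linarith
      · exact ((contDiff_horiz.continuous.continuousAt.comp hdv).norm).pow 2
    · rintro z ⟨hzt, hzp⟩
      exact hzp.slope_le hx (hs.mdifferentiableAt_of_isOpen κ.open_target hzt) v
  apply exists_isGraphChart hx
  have hinj : Function.Injective (fderiv ℝ (fun z => horiz (x (κ.symm z))) (κ p)) := by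
    rw [injective_iff_map_eq_zero]
    intro v hv
    rw [fderiv_horiz_comp hdX] at hv
    have h3 := hle v
    rw [hv, norm_zero] at h3
    have h4 : fderiv ℝ (fun z => x (κ.symm z)) (κ p) v 2 = 0 := by
      have : (fderiv ℝ (fun z => x (κ.symm z)) (κ p) v 2) ^ 2 ≤ 0 := by simpa using h3
      nlinarith
    have h5 : fderiv ℝ (fun z => x (κ.symm z)) (κ p) v = 0 := by
      ext i; fin_cases i
      · have := congrArg (fun v : E2 => v 0) hv
        simpa [horiz] using this
      · have := congrArg (fun v : E2 => v 1) hv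
        simpa [horiz] using this
      · exact h4
    have dσ := hs.mdifferentiableAt_of_isOpen κ.open_target hz
    have dx := hx.1.mdifferentiable (by simp) (κ.symm (κ p))
    rw [fderiv_comp_param dx dσ] at h5
    have h6 := hx.2 _ (h5.trans (map_zero _).symm)
    exact (h2 _ hz).1 (h6.trans (map_zero _).symm)
  have hsurj : Function.Surjective (fderiv ℝ (fun z => horiz (x (κ.symm z))) (κ p)) :=
    LinearMap.surjective_of_injective
      (f := (fderiv ℝ (fun z => horiz (x (κ.symm z))) (κ p) : E2 →ₗ[ℝ] E2)) hinj
  have hpoint : ∀ q : M, q = p → Function.Surjective (mfderiv (𝓡 2) (𝓡 2) (fun q => horiz (x q)) q) →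
      Function.Surjective (mfderiv (𝓡 2) (𝓡 2) (fun q => horiz (x q)) p) := by
    rintro q rfl h; exact h
  refine hpoint _ hinv fun b => ?_
  obtain ⟨v, hv⟩ := hsurj b
  have key := fderiv_comp_param (F := E2)
    ((contMDiff_horiz_comp hx).mdifferentiable (by simp) (κ.symm (κ p)))
    (hs.mdifferentiableAt_of_isOpen κ.open_target hz) v
  exact ⟨_, (hv.symm.trans key).symm⟩

/-- Off the axis, the set of points of the class `(m, c)` is closed: at a limit point the relations
hold by continuity, so that the curvature is not zero and the gradient turns, and
`isPowerJet_of_gradTurn_ne_zero` yields the relations on a neighbourhood. -/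
theorem isPowerPoint_of_mem_closure (hx : IsImmersedSurface x)
    (hflow : ∀ p : M, ∃ ε U Φ, p ∈ U ∧ IsLocalTurn x ε U Φ) (hm0 : m ≠ 0) (hm1 : m ≠ 1)
    (hc : c ≠ 0) {p : M}
    (hp : p ∈ closure {q | IsPowerPoint x m c q}) (h : horiz (x p) ≠ 0) : IsPowerPoint x m c p := by
  obtain ⟨e, he, hpe⟩ := exists_isGraphChart_of_mem_closure hx hp (Or.inl h)
  obtain ⟨y, hy⟩ := exists_polarMap_eq h
  obtain ⟨ψ, V, hV, hpV, hVe, hψ, hψp, hψV⟩ := he.exists_polar hx hpe hy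
  obtain ⟨hpy, hyd⟩ := he.eq_polarParam hpe hy.symm
  have hf := he.contDiffOn_polarHeight hx
  have hO := isOpen_polarDomain e
  set f := polarHeight x e
  have hfreq : ∃ᶠ z in 𝓝 y, PowerRel m c f z := by
    have ht : Filter.Tendsto ψ (𝓝 p) (𝓝 y) := by
      have := hψ.continuousOn.continuousAt (hV.mem_nhds hpV)
      rwa [ContinuousAt, hψp] at this
    refine ht.frequently
      (((mem_closure_iff_frequently.1 hp).and_eventually (hV.mem_nhds hpV)).mono ?_)
    rintro q ⟨hq, hqV⟩
    obtain ⟨h1, h2, -⟩ := hψV q hqV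
    exact IsPowerPoint.powerRel he h1 (by rwa [h2])
  have c1 : ∀ i, ContinuousAt (pd i f) y := fun i =>
    ((hf.pd hO i).differentiableAt_of_isOpen hO hyd).continuousAt
  have c2 : ∀ i j, ContinuousAt (pd i (pd j f)) y := fun i j =>
    (((hf.pd hO j).pd hO i).differentiableAt_of_isOpen hO hyd).continuousAt
  have hrel : PowerRel m c f y := by
    refine ⟨⟨?_, ?_, ?_⟩, ?_⟩
    · exact eq_of_frequently_eq (c2 0 0) (continuousAt_const.mul (c1 0))
        (hfreq.mono fun z hz => hz.1.1)
    · exact eq_of_frequently_eq (c2 0 1) (continuousAt_const.mul (c1 1))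
        (hfreq.mono fun z hz => hz.1.2.1)
    · exact eq_of_frequently_eq (c2 1 1) (continuousAt_const.mul (c1 0))
        (hfreq.mono fun z hz => hz.1.2.2)
    · exact eq_of_frequently_eq (f := gradSq f) (((c1 0).pow 2).add ((c1 1).pow 2))
        (g := fun z => c ^ 2 * m ^ 2 * Real.exp (2 * m * z 0)) (by fun_prop)
        (hfreq.mono fun z hz => hz.2)
  have hg : gradSq f y ≠ 0 := by rw [hrel.2]; positivity
  have hk : curvNum f y ≠ 0 := by
    rw [curvNum_of_isPowerJet hrel.1]
    exact mul_ne_zero (neg_ne_zero.2 (pow_ne_zero 2 (sub_ne_zero.2 hm1))) hg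
  have hA := gradTurn_of_isPowerJet hrel.1 hg
  obtain ⟨ε, U, Φ, hpU, hΦ⟩ := hflow p
  have hO' : IsOpen (polarDomain e ∩ polarParam e ⁻¹' U) :=
    he.contMDiffOn_polarParam.continuousOn.isOpen_inter_preimage hO hΦ.isOpen
  have hyO' : y ∈ polarDomain e ∩ polarParam e ⁻¹' U :=
    ⟨hyd, by rw [Set.mem_preimage, ← hpy]; exact hpU⟩
  have hev := isPowerJet_of_gradTurn_ne_zero (hf.mono Set.inter_subset_left) hO'
    (fun z hz => (hΦ.pd_one_eq_zero hx he hz.1 hz.2).1)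
    (fun z hz => (hΦ.pd_one_eq_zero hx he hz.1 hz.2).2) hyO' hk (by rw [hA]; simpa)
  rw [hpy]
  refine isPowerPoint_of_eventually he hyd (hev.mono fun z hz => ?_)
  rw [hA, neg_neg] at hz
  refine ⟨hz.1, ?_⟩
  rw [hz.2, hrel.2, mul_assoc, ← Real.exp_add]
  congr 2; ring

end PowerPoints

/-! ### Congruence with the surfaces x_{m,c} -/

section Congruence

/-- The rotation by the angle `β` about the vertical axis followed by the vertical translation by
`d`. -/
theorem exists_screw_isometry (β d : ℝ) : ∃ A : E3 ≃ᵃⁱ[ℝ] E3, ∀ v : E3,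
    A v = !₂[Real.cos β * v 0 - Real.sin β * v 1, Real.sin β * v 0 + Real.cos β * v 1, v 2 + d] := by
  let L₀ : E3 →ₗ[ℝ] E3 :=
    { toFun := fun v =>
        !₂[Real.cos β * v 0 - Real.sin β * v 1, Real.sin β * v 0 + Real.cos β * v 1, v 2]
      map_add' := fun a b => by ext i; fin_cases i <;> simp <;> ring
      map_smul' := fun a b => by ext i; fin_cases i <;> simp <;> ring }
  have hL₀ : ∀ v, L₀ v =
    !₂[Real.cos β * v 0 - Real.sin β * v 1, Real.sin β * v 0 + Real.cos β * v 1, v 2] := fun v => rfl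
  let L : E3 →ₗᵢ[ℝ] E3 :=
    { L₀ with
      norm_map' := fun v => by
        rw [← sq_eq_sq₀ (norm_nonneg _) (norm_nonneg _), norm_sq_e3, norm_sq_e3, hL₀]
        simp
        linear_combination (v 0 ^ 2 + v 1 ^ 2) * Real.sin_sq_add_cos_sq β }
  refine ⟨(L.toLinearIsometryEquiv rfl).toAffineIsometryEquiv.trans
    (AffineIsometryEquiv.constVAdd ℝ E3 !₂[0, 0, d]), fun v => ?_⟩
  have : (L.toLinearIsometryEquiv rfl) v = L₀ v := rfl
  simp only [AffineIsometryEquiv.coe_trans, Function.comp,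
    LinearIsometryEquiv.coe_toAffineIsometryEquiv, this, hL₀]
  ext i; fin_cases i <;> simp [add_comm]

theorem exp_add_mul_I (a b : ℝ) : Complex.exp ((a : ℝ) + (b : ℂ) * Complex.I) =
    ⟨Real.exp a * Real.cos b, Real.exp a * Real.sin b⟩ := by
  apply Complex.ext <;> simp [Complex.exp_re, Complex.exp_im]

variable {M : Type*} [TopologicalSpace M] [ChartedSpace E2 M]
variable {x : M → E3} {e : OpenPartialHomeomorph M E2} {m c : ℝ}

/-- The height of a connected graph of the class `(m, c)`; the positive amplitude can be taken to be
`c`. -/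
theorem polarHeight_eq_of_powerRel (hx : IsImmersedSurface x) (he : IsGraphChart x e) (hm : m ≠ 0)
    (hc : 0 < c) {O : Set E2} (hO : IsOpen O) (hOc : IsPreconnected O) (hne : O.Nonempty)
    (hOe : O ⊆ polarDomain e) (h : ∀ y ∈ O, PowerRel m c (polarHeight x e) y) :
    ∃ z₀ b : ℝ, ∀ y ∈ O, polarHeight x e y =
      z₀ + c * Real.exp (m * y 0) * Real.cos (m * y 1 + b) := by
  obtain ⟨z₀, a, b, h1, ha, h2⟩ := eq_power_of_isPowerJet hm
    ((he.contDiffOn_polarHeight hx).mono hOe) hO hOc hne fun y hy => (h y hy).1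
  obtain ⟨y, hy⟩ := hne
  have hac : a = c := by
    have h3 := (h2 y hy).symm.trans (h y hy).2
    have h4 := mul_right_cancel₀ (Real.exp_pos _).ne' h3
    have h5 := mul_right_cancel₀ (pow_ne_zero 2 hm) h4
    exact (sq_eq_sq₀ ha hc.le).1 h5
  exact ⟨z₀, b, fun y hy => by rw [h1 y hy, hac]⟩

/-- The rotation by the angle `b / m` and a vertical translation remove the phase `b` and the
additive constant. -/
theorem IsPowerPoint.isCongruentNear (hx : IsImmersedSurface x) (hm : m ≠ 0) (hc : 0 < c) {p : M}
    (hp : IsPowerPoint x m c p) : IsCongruentNear x p (xmcPolar m c) {w : ℝ × ℝ | 0 < w.1} := by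
  obtain ⟨e, he, hpe, hne, hrel⟩ := hp
  obtain ⟨y, hy⟩ := exists_polarMap_eq hne
  obtain ⟨ψ, V, hV, hpV, hVe, hψ, hψp, hψV⟩ := he.exists_polar hx hpe hy
  have hyd := (he.eq_polarParam hpe hy.symm).2
  obtain ⟨r, hr, hball⟩ := Metric.isOpen_iff.1 (isOpen_polarDomain e) y hyd
  obtain ⟨z₀, b, hf⟩ := polarHeight_eq_of_powerRel hx he hm hc Metric.isOpen_ball
    (convex_ball y r).isPreconnected ⟨y, Metric.mem_ball_self hr⟩ hball fun z hz => hrel z (hball hz)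
  obtain ⟨A, hA⟩ := exists_screw_isometry (b / m) (-z₀)
  refine ⟨A, V ∩ ψ ⁻¹' Metric.ball y r, hψ.continuousOn.isOpen_inter_preimage hV Metric.isOpen_ball,
    ⟨hpV, by rw [Set.mem_preimage, hψp]; exact Metric.mem_ball_self hr⟩,
    fun q => (Real.exp (ψ q 0), ψ q 1 + b / m), ?_, fun q _ => Real.exp_pos _, ?_⟩
  · have h1 : ContDiff ℝ ∞ fun z : E2 => (Real.exp (z 0), z 1 + b / m) := by
      have h : ∀ j : Fin 2, ContDiff ℝ ∞ fun y : E2 => y j := fun j =>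
        (EuclideanSpace.proj j : E2 →L[ℝ] ℝ).contDiff
      exact (h 0).exp.prodMk ((h 1).add contDiff_const)
    exact h1.contMDiff.comp_contMDiffOn (hψ.mono Set.inter_subset_left)
  · rintro q ⟨hqV, hqB⟩
    obtain ⟨h1, h2, h3⟩ := hψV q hqV
    have e0 : x q 0 = polarMap (ψ q) 0 := by rw [h3, horiz_zero]
    have e1 : x q 1 = polarMap (ψ q) 1 := by rw [h3, horiz_one]
    have e2 : x q 2 = z₀ + c * Real.exp (m * ψ q 0) * Real.cos (m * ψ q 1 + b) := by
      rw [← hf _ hqB, polarHeight, h2]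
    rw [hA, e0, e1, e2, polarMap_zero, polarMap_one, xmcPolar]
    have h4 : m * (ψ q 1 + b / m) = m * ψ q 1 + b := by field_simp
    ext i; fin_cases i
    · simp [Real.cos_add]; ring
    · simp [Real.sin_add]; ring
    · simp only [h4, ← exp_mul_eq_rpow]; simp

variable [IsManifold (𝓡 2) ∞ M]

/-- On the axis, there are no limits of points of the class `(m, c)` with `m < 1`: for `m < 0` the
first two derivatives of the height under the rotations would be unbounded, and for `0 < m < 1` the
Gaussian curvature. -/
theorem one_lt_of_mem_closure (hx : IsImmersedSurface x)
    (hflow : ∀ p : M, ∃ ε U Φ, p ∈ U ∧ IsLocalTurn x ε U Φ) (hm0 : m ≠ 0) (hm1 : m ≠ 1)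
    (hc : 0 < c) {p : M}
    (hp : p ∈ closure {q | IsPowerPoint x m c q}) (h : horiz (x p) = 0) : 1 < m := by
  have hfreq := mem_closure_iff_frequently.1 hp
  have cr : ContinuousAt (fun q => ‖horiz (x q)‖) p := (continuous_horiz_comp hx).norm.continuousAt
  have hr0 : ‖horiz (x p)‖ = 0 := by rw [h, norm_zero]
  have hcm : c ^ 2 * m ^ 2 ≠ 0 := by positivity
  by_contra hlt
  rcases lt_or_gt_of_ne hm0 with hneg | hpos
  -- The relation `h'² + (h'' / m)² = c² m² r ^ (2 m)` for the height `h` under the rotations.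
  · obtain ⟨ε, U, Φ, hpU, hΦ⟩ := hflow p
    obtain ⟨c1, c2⟩ := hΦ.continuousAt_heightRate hx hpU
    have key := eq_of_frequently_eq (f := fun _ => c ^ 2 * m ^ 2)
      (g := fun q => ‖horiz (x q)‖ ^ (-2 * m) * (heightRate x Φ q ^ 2 + (heightRate₂ x Φ q / m) ^ 2))
      (a := p) continuousAt_const
      ((cr.rpow_const (Or.inr (by linarith))).mul ((c1.pow 2).add ((c2.div_const m).pow 2))) ?_
    · simp only [hr0] at key
      rw [Real.zero_rpow (by linarith), zero_mul] at key
      exact hcm key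
    · refine (hfreq.and_eventually (hΦ.isOpen.mem_nhds hpU)).mono ?_
      rintro q ⟨⟨e, he, hqe, hne, hrel⟩, hqU⟩
      obtain ⟨y, hy⟩ := exists_polarMap_eq hne
      obtain ⟨hqy, hyd⟩ := he.eq_polarParam hqe hy.symm
      obtain ⟨h1, h2⟩ := hΦ.heightRate_eq hx he hyd (by rwa [← hqy])
      obtain ⟨⟨-, -, r3⟩, r4⟩ := hrel y hyd
      have h3 : heightRate x Φ q ^ 2 + (heightRate₂ x Φ q / m) ^ 2 = gradSq (polarHeight x e) y := by
        rw [hqy, h1, h2, r3, gradSq]; field_simp; ring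
      rw [h3, r4, ← hy, norm_polarMap, ← exp_mul_eq_rpow]
      rw [mul_left_comm, ← Real.exp_add]
      simp
  -- The relation `K (G + r²)² / G = -(m - 1)²` with `G = c² m² r ^ (2 m)`, whose left side tends to
  -- zero on the axis.
  · have hm1' : m < 1 := lt_of_le_of_ne (not_lt.1 hlt) hm1
    have key := eq_of_frequently_eq (f := fun _ => -(m - 1) ^ 2)
      (g := fun q => gaussianCurvature x q * (c ^ 2 * m ^ 2 * ‖horiz (x q)‖ ^ (2 * m) +
        2 * ‖horiz (x q)‖ ^ 2 + ‖horiz (x q)‖ ^ (4 - 2 * m) / (c ^ 2 * m ^ 2)))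
      (a := p) continuousAt_const
      ((continuous_gaussianCurvature hx).continuousAt.mul
        (((continuousAt_const.mul (cr.rpow_const (Or.inr (by linarith)))).add
          (continuousAt_const.mul (cr.pow 2))).add
          ((cr.rpow_const (Or.inr (by linarith))).div_const _))) ?_
    · simp only [hr0] at key
      rw [Real.zero_rpow (by linarith), Real.zero_rpow (by linarith)] at key
      have : (m - 1) ^ 2 ≠ 0 := pow_ne_zero 2 (sub_ne_zero.2 hm1)
      apply this
      simpa using key
    · refine hfreq.mono ?_
      rintro q ⟨e, he, hqe, hne, hrel⟩
      obtain ⟨y, hy⟩ := exists_polarMap_eq hne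
      obtain ⟨hqy, hyd⟩ := he.eq_polarParam hqe hy.symm
      obtain ⟨r1, r4⟩ := hrel y hyd
      have hr : ‖horiz (x q)‖ = Real.exp (y 0) := by rw [← hy, norm_polarMap]
      rw [hr]
      rw [hqy, he.gaussianCurvature_eq hx hyd, curvNum_of_isPowerJet r1, r4, ← exp_mul_eq_rpow,
        ← exp_mul_eq_rpow]
      have e1 : Real.exp ((4 - 2 * m) * y 0) = (Real.exp (y 0) ^ 2) ^ 2 / Real.exp (2 * m * y 0) := by
        rw [← pow_mul, ← Real.exp_nat_mul, ← Real.exp_sub]; congr 1; push_cast; ring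
      rw [e1]
      have hE := Real.exp_pos (2 * m * y 0)
      have hden : c ^ 2 * m ^ 2 * Real.exp (2 * m * y 0) + Real.exp (y 0) ^ 2 ≠ 0 := by positivity
      have hG : c ^ 2 * m ^ 2 * Real.exp (2 * m * y 0) ≠ 0 := by positivity
      set G := c ^ 2 * m ^ 2 * Real.exp (2 * m * y 0)
      set R := Real.exp (y 0) ^ 2
      have e2 : G + 2 * R + R ^ 2 / Real.exp (2 * m * y 0) / (c ^ 2 * m ^ 2) = (G + R) ^ 2 / G := by
        rw [div_div, show Real.exp (2 * m * y 0) * (c ^ 2 * m ^ 2) = G by simp only [G]; ring]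
        field_simp; ring
      rw [e2]
      field_simp

/-- At a limit on the axis of points of the class `(m, c)`, the punctured neighbourhood belongs to
the class, and since the height is single-valued around the axis, `m` is an integer. -/
theorem isCongruentNear_entire_of_mem_closure (hx : IsImmersedSurface x)
    (hflow : ∀ p : M, ∃ ε U Φ, p ∈ U ∧ IsLocalTurn x ε U Φ) (hm0 : m ≠ 0) (hm1 : m ≠ 1)
    (hc : 0 < c) {p : M}
    (hp : p ∈ closure {q | IsPowerPoint x m c q}) (h : horiz (x p) = 0) :
    closure {q | IsPowerPoint x m c q} ∈ 𝓝 p ∧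
      ∃ n : ℕ, 0 < n ∧ (n : ℝ) = m ∧ IsCongruentNear x p (xmcEntire n c) Set.univ := by
  have hm : 1 < m := one_lt_of_mem_closure hx hflow hm0 hm1 hc hp h
  obtain ⟨e, he, hpe⟩ := exists_isGraphChart_of_mem_closure hx hp (Or.inr hm.le)
  have hep : e p = 0 := by rw [he.eq_horiz p hpe, h]
  have h0t : (0 : E2) ∈ e.target := by rw [← hep]; exact e.map_source hpe
  have hep' : e.symm 0 = p := by rw [← hep, e.left_inv hpe]
  obtain ⟨R, hR, hball⟩ := Metric.isOpen_iff.1 e.open_target 0 h0t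
  set S := {q | IsPowerPoint x m c q} with hS
  -- The punctured disc in logarithmic polar coordinates is a half-plane, which is connected.
  set T : Set E2 := {y | y 0 < Real.log R} with hT
  have cproj : Continuous fun y : E2 => y 0 := (EuclideanSpace.proj 0 : E2 →L[ℝ] ℝ).continuous
  have hTo : IsOpen T := isOpen_lt cproj continuous_const
  have hTc : IsPreconnected T := by
    have : Convex ℝ T :=
      (convex_Iio (Real.log R)).linear_preimage (EuclideanSpace.proj 0 : E2 →L[ℝ] ℝ).toLinearMap
    exact this.isPreconnected
  have hTmem : ∀ y, y ∈ T ↔ ‖polarMap y‖ < R := fun y => by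
    rw [norm_polarMap, ← Real.lt_log_iff_exp_lt hR]; rfl
  have hTd : T ⊆ polarDomain e := fun y hy => hball (by simpa using (hTmem y).1 hy)
  have hσT : ContinuousOn (polarParam e) T := he.contMDiffOn_polarParam.continuousOn.mono hTd
  have hSo : IsOpen S := isOpen_isPowerPoint hx
  let u := T ∩ polarParam e ⁻¹' S
  have hu : IsOpen u := hσT.isOpen_inter_preimage hTo hSo
  let W : Set M := e.source ∩ e ⁻¹' Metric.ball 0 R
  have hW : IsOpen W := e.isOpen_inter_preimage Metric.isOpen_ball
  have hpW : p ∈ W := ⟨hpe, by rw [Set.mem_preimage, hep]; exact Metric.mem_ball_self hR⟩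
  have hWT : ∀ q ∈ W, horiz (x q) ≠ 0 → ∃ y ∈ T, polarParam e y = q ∧ polarMap y = horiz (x q) := by
    rintro q ⟨hqe, hqR⟩ hne
    obtain ⟨y, hy⟩ := exists_polarMap_eq hne
    refine ⟨y, (hTmem y).2 ?_, (he.eq_polarParam hqe hy.symm).1.symm, hy⟩
    rw [hy, ← he.eq_horiz q hqe]
    simpa using hqR
  have hTu : T ⊆ u := by
    refine hTc.subset_of_closure_inter_subset hu ?_ ?_
    · obtain ⟨q, hq, hqW⟩ := ((mem_closure_iff_frequently.1 hp).and_eventually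
        (hW.mem_nhds hpW)).exists
      obtain ⟨-, -, -, hne, -⟩ := id hq
      obtain ⟨y, hyT, hyq, -⟩ := hWT q hqW hne
      exact ⟨y, hyT, hyT, by rw [Set.mem_preimage, hyq]; exact hq⟩
    · rintro y ⟨hyc, hyT⟩
      refine ⟨hyT, isPowerPoint_of_mem_closure hx hflow hm0 hm1 hc.ne' ?_ ?_⟩
      · rw [mem_closure_iff_frequently] at hyc ⊢
        exact (he.continuousAt_polarParam (hTd hyT)).tendsto.frequently (hyc.mono fun z hz => hz.2)
      · rw [he.horiz_polarParam (hTd hyT)]; exact polarMap_ne_zero y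
  have hrel : ∀ y ∈ T, PowerRel m c (polarHeight x e) y := fun y hy =>
    IsPowerPoint.powerRel he (hTd hy) (hTu hy).2
  have hTne : T.Nonempty := ⟨!₂[Real.log R - 1, 0], by simp [hT]⟩
  obtain ⟨z₀, b, hf⟩ := polarHeight_eq_of_powerRel hx he hm0 hc hTo hTc hTne hTd hrel
  -- Going once around the axis from an angle with `cos (m θ + b) = 1` shows `cos (2 π m) = 1`.
  obtain ⟨n, hn⟩ : ∃ n : ℕ, (n : ℝ) = m := by
    set y : E2 := !₂[Real.log R - 1, -b / m] with hy
    have hyT : y ∈ T := by simp [hT, hy]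
    set y' : E2 := y + (((1 : ℤ) : ℝ) * (2 * Real.pi)) • EuclideanSpace.single 1 1 with hy'
    have hy'0 : y' 0 = y 0 := by simp [hy']
    have hy'1 : y' 1 = -b / m + 2 * Real.pi := by simp [hy', hy]
    have hy'T : y' ∈ T := by rw [hT, Set.mem_ofPred_eq, hy'0]; exact hyT
    have h1 : polarHeight x e y' = polarHeight x e y := by
      simp only [polarHeight, polarParam, hy', polarMap_add_int]
    rw [hf y hyT, hf y' hy'T, hy'0] at h1
    have h2 := mul_left_cancel₀ (by positivity) (add_left_cancel h1)
    have e1 : m * y' 1 + b = m * (2 * Real.pi) := by rw [hy'1]; field_simp; ring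
    have e2 : m * y 1 + b = 0 := by simp only [hy]; simp; field_simp; ring
    rw [e1, e2, Real.cos_zero, Real.cos_eq_one_iff] at h2
    obtain ⟨k, hk⟩ := h2
    have hkm : (k : ℝ) = m := mul_right_cancel₀ (by positivity : 2 * Real.pi ≠ 0) hk
    have hk0 : 0 ≤ k := by
      have : (0 : ℝ) < k := by rw [hkm]; linarith
      exact_mod_cast this.le
    exact ⟨k.toNat, by rw [← hkm]; exact_mod_cast Int.toNat_of_nonneg hk0⟩
  have hn0 : 0 < n := by
    have : (0 : ℝ) < n := by rw [hn]; linarith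
    exact_mod_cast this
  refine ⟨?_, n, hn0, hn, ?_⟩
  · filter_upwards [hW.mem_nhds hpW] with q hq
    by_cases hne : horiz (x q) = 0
    · have : q = p := by
        rw [← e.left_inv hq.1, he.eq_horiz q hq.1, hne, hep']
      rw [this]; exact hp
    · obtain ⟨y, hyT, hyq, -⟩ := hWT q hq hne
      rw [← hyq]; exact subset_closure (hTu hyT).2
  · obtain ⟨A, hA⟩ := exists_screw_isometry (b / m) (-z₀)
    set ζ : E3 → ℂ := fun v => ⟨Real.cos (b / m) * v 0 - Real.sin (b / m) * v 1,
      Real.sin (b / m) * v 0 + Real.cos (b / m) * v 1⟩ with hζ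
    have hζs : ContDiff ℝ ∞ ζ := by
      have : ζ = fun v => ((Real.cos (b / m) * v 0 - Real.sin (b / m) * v 1 : ℝ) : ℂ) +
          ((Real.sin (b / m) * v 0 + Real.cos (b / m) * v 1 : ℝ) : ℂ) * Complex.I := by
        funext v
        simp only [hζ]
        generalize Real.cos (b / m) * v 0 - Real.sin (b / m) * v 1 = r
        generalize Real.sin (b / m) * v 0 + Real.cos (b / m) * v 1 = s
        apply Complex.ext <;> simp
      rw [this]
      have h0 := contDiff_coord3 0
      have h1 := contDiff_coord3 1
      exact (Complex.ofRealCLM.contDiff.comp ((contDiff_const.mul h0).sub (contDiff_const.mul h1))).add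
        ((Complex.ofRealCLM.contDiff.comp
          ((contDiff_const.mul h0).add (contDiff_const.mul h1))).mul contDiff_const)
    -- The height off the axis.
    have hoff : ∀ q ∈ W, horiz (x q) ≠ 0 → x q 2 - z₀ = c * (ζ (x q) ^ n).re := by
      intro q hq hne
      obtain ⟨y, hyT, hyq, hy⟩ := hWT q hq hne
      have e0 : x q 0 = polarMap y 0 := by rw [hy, horiz_zero]
      have e1 : x q 1 = polarMap y 1 := by rw [hy, horiz_one]
      have hz : ζ (x q) = Complex.exp ((y 0 : ℝ) + ((y 1 + b / m : ℝ) : ℂ) * Complex.I) := by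
        rw [exp_add_mul_I, hζ]
        simp only [e0, e1, polarMap_zero, polarMap_one]
        apply Complex.ext
        · simp only [Real.cos_add]; ring
        · simp only [Real.sin_add]; ring
      have hz' : ζ (x q) ^ n = Complex.exp ((m * y 0 : ℝ) + ((m * y 1 + b : ℝ) : ℂ) * Complex.I) := by
        rw [hz, ← Complex.exp_nat_mul]
        congr 1
        have : (n : ℂ) = (m : ℂ) := by rw [← hn]; simp
        have hmc : (m : ℂ) ≠ 0 := by exact_mod_cast hm0
        rw [this]; push_cast; field_simp
      have e2 : x q 2 = z₀ + c * Real.exp (m * y 0) * Real.cos (m * y 1 + b) := by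
        rw [← hf y hyT, polarHeight, hyq]
      rw [hz', exp_add_mul_I, e2]
      simp only; ring
    have hcont : Continuous fun q => c * (ζ (x q) ^ n).re :=
      continuous_const.mul (Complex.continuous_re.comp
        ((hζs.continuous.comp hx.1.continuous).pow n))
    have hon : x p 2 - z₀ = c * (ζ (x p) ^ n).re := by
      refine eq_of_frequently_eq (f := fun q => x q 2 - z₀) (g := fun q => c * (ζ (x q) ^ n).re)
        ?_ hcont.continuousAt ?_
      · exact (((contDiff_coord3 2).continuous.comp hx.1.continuous).sub
          continuous_const).continuousAt
      · refine ((mem_closure_iff_frequently.1 hp).and_eventually (hW.mem_nhds hpW)).mono ?_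
        rintro q ⟨⟨-, -, -, hne, -⟩, hqW⟩
        exact hoff q hqW hne
    refine ⟨A, W, hW, hpW, fun q => ζ (x q), ?_, Set.mapsTo_univ _ _, fun q hq => ?_⟩
    · exact (hζs.contMDiff.comp hx.1).contMDiffOn
    · have e2 : x q 2 - z₀ = c * (ζ (x q) ^ n).re := by
        by_cases hne : horiz (x q) = 0
        · have : q = p := by
            rw [← e.left_inv hq.1, he.eq_horiz q hq.1, hne, hep']
          rw [this]; exact hon
        · exact hoff q hq hne
      rw [hA, xmcEntire, ← e2]
      ext i; fin_cases i <;> simp [hζ, sub_eq_add_neg]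

/-- If the class `(m, c)` is attained somewhere, then its closure is open, hence the whole surface.
-/
theorem isLocallyCongruentToXmc_of_isPowerPoint [ConnectedSpace M] (hx : IsImmersedSurface x)
    (hflow : ∀ p : M, ∃ ε U Φ, p ∈ U ∧ IsLocalTurn x ε U Φ) (hm0 : m ≠ 0) (hm1 : m ≠ 1)
    (hc : 0 < c) {p₀ : M} (hp₀ : IsPowerPoint x m c p₀) : IsLocallyCongruentToXmc x m c := by
  have hopen : IsOpen (closure {q | IsPowerPoint x m c q}) := by
    rw [isOpen_iff_mem_nhds]
    intro p hp
    by_cases h : horiz (x p) = 0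
    · exact (isCongruentNear_entire_of_mem_closure hx hflow hm0 hm1 hc hp h).1
    · exact Filter.mem_of_superset ((isOpen_isPowerPoint hx).mem_nhds
        (isPowerPoint_of_mem_closure hx hflow hm0 hm1 hc.ne' hp h)) subset_closure
  have huniv : closure {q | IsPowerPoint x m c q} = Set.univ :=
    IsClopen.eq_univ ⟨isClosed_closure, hopen⟩ ⟨p₀, subset_closure hp₀⟩
  intro p
  have hp : p ∈ closure {q | IsPowerPoint x m c q} := by rw [huniv]; trivial
  by_cases h : horiz (x p) = 0
  · exact Or.inr (isCongruentNear_entire_of_mem_closure hx hflow hm0 hm1 hc hp h).2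
  · exact Or.inl ((isPowerPoint_of_mem_closure hx hflow hm0 hm1 hc.ne' hp h).isCongruentNear hx
      hm0 hc)

end Congruence

/-! ### Helicoidal surfaces and adapted coordinates of space -/

section Helicoidal

variable {M : Type*} [TopologicalSpace M] [ChartedSpace E2 M] [IsManifold (𝓡 2) ∞ M]
variable {x : M → E3} {e : OpenPartialHomeomorph M E2}

/-- Generic points of the surface: points off the axis with non-vertical tangent plane and non-zero
curvature. -/
def IsGenericSurfacePoint (x : M → E3) (q : M) : Prop :=
  (∃ e : OpenPartialHomeomorph M E2, IsGraphChart x e ∧ q ∈ e.source) ∧ horiz (x q) ≠ 0 ∧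
    gaussianCurvature x q ≠ 0

theorem isOpen_isGenericSurfacePoint (hx : IsImmersedSurface x) :
    IsOpen {q | IsGenericSurfacePoint x q} := by
  rw [isOpen_iff_mem_nhds]
  rintro q ⟨⟨e, he, hq⟩, hne, hK⟩
  filter_upwards [e.open_source.mem_nhds hq,
    (continuous_horiz_comp hx).continuousAt.eventually_ne hne,
    (continuous_gaussianCurvature hx).continuousAt.eventually_ne hK] with z h1 h2 h3
  exact ⟨⟨e, he, h1⟩, h2, h3⟩

/-- Generic points are dense, as an open set on which the curvature is zero would consist of
critical points, and an open set with vertical tangent planes only would have curvature zero. -/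
theorem dense_isGenericSurfacePoint (hx : IsImmersedSurface x) (hK : NoOpenSetOfCriticalPoints x) :
    Dense {q | IsGenericSurfacePoint x q} := by
  rw [dense_iff_inter_open]
  intro U hU hne
  have hKc := continuous_gaussianCurvature hx
  obtain ⟨q₀, hq₀U, hq₀⟩ : ∃ q ∈ U, gaussianCurvature x q ≠ 0 := by
    by_contra hcon
    push Not at hcon
    obtain ⟨p, hpU, hp⟩ := hK U hU hne
    apply hp
    have : gaussianCurvature x =ᶠ[𝓝 p] fun _ => (0 : ℝ) := by
      filter_upwards [hU.mem_nhds hpU] with q hq using hcon q hq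
    rw [this.mfderiv_eq]
    exact mfderiv_const
  have hU' : IsOpen (U ∩ {q | gaussianCurvature x q ≠ 0}) :=
    hU.inter (isOpen_ne_fun hKc continuous_const)
  obtain ⟨q₁, hq₁, hs⟩ : ∃ q ∈ U ∩ {q | gaussianCurvature x q ≠ 0},
      Function.Surjective (mfderiv (𝓡 2) (𝓡 2) (fun q => horiz (x q)) q) := by
    by_contra hcon
    push Not at hcon
    exact hq₀ (gaussianCurvature_eq_zero_of_vertical hx hU' hcon q₀ ⟨hq₀U, hq₀⟩)
  obtain ⟨e, he, hqe⟩ := exists_isGraphChart hx hs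
  -- The horizontal projection is injective near `q₁`, so that it does not vanish identically.
  have hfreq : ∃ᶠ v in 𝓝 (e q₁), v ≠ 0 := by
    have := (dense_compl_singleton (0 : E2)) (e q₁)
    exact mem_closure_iff_frequently.1 this
  have hcs := e.continuousAt_symm (e.map_source hqe)
  have hmem : e.symm (e q₁) ∈ U ∩ {q | gaussianCurvature x q ≠ 0} := by rwa [e.left_inv hqe]
  obtain ⟨v, ⟨hv0, hvt⟩, hvU⟩ := ((hfreq.and_eventually (e.open_target.mem_nhds
    (e.map_source hqe))).and_eventually (hcs.preimage_mem_nhds (hU'.mem_nhds hmem))).exists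
  refine ⟨e.symm v, hvU.1, ⟨e, he, e.map_target hvt⟩, ?_, hvU.2⟩
  rwa [← he.eq_horiz _ (e.map_target hvt), e.right_inv hvt]

/-- At a generic point the surface is congruent to some `x_{m,c}`, or the height changes at a
locally constant rate under rotations. -/
theorem IsGenericSurfacePoint.dichotomy (hx : IsImmersedSurface x)
    (hflow : ∀ p : M, ∃ ε U Φ, p ∈ U ∧ IsLocalTurn x ε U Φ) (he : IsGraphChart x e) {y : E2}
    (hy : y ∈ polarDomain e) (hq : IsGenericSurfacePoint x (polarParam e y)) :
    (∃ m c : ℝ, m ≠ 0 ∧ m ≠ 1 ∧ 0 < c ∧ IsPowerPoint x m c (polarParam e y)) ∨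
      ∀ i, pd i (pd 1 (polarHeight x e)) y = 0 := by
  have hf := he.contDiffOn_polarHeight hx
  have hO := isOpen_polarDomain e
  obtain ⟨ε, U, Φ, hpU, hΦ⟩ := hflow (polarParam e y)
  have hO' : IsOpen (polarDomain e ∩ polarParam e ⁻¹' U) :=
    he.contMDiffOn_polarParam.continuousOn.isOpen_inter_preimage hO hΦ.isOpen
  have hyO' : y ∈ polarDomain e ∩ polarParam e ⁻¹' U := ⟨hy, hpU⟩
  have hg1 : ∀ z ∈ polarDomain e ∩ polarParam e ⁻¹' U, pd 1 (gradSq (polarHeight x e)) z = 0 :=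
    fun z hz => (hΦ.pd_one_eq_zero hx he hz.1 hz.2).1
  have hk1 : ∀ z ∈ polarDomain e ∩ polarParam e ⁻¹' U, pd 1 (curvNum (polarHeight x e)) z = 0 :=
    fun z hz => (hΦ.pd_one_eq_zero hx he hz.1 hz.2).2
  have hf' := hf.mono (Set.inter_subset_left (s := polarDomain e) (t := polarParam e ⁻¹' U))
  set f := polarHeight x e
  have hk : curvNum f y ≠ 0 := by
    intro h0
    apply hq.2.2
    rw [he.gaussianCurvature_eq hx hy, h0, zero_div]
  have hg := gradSq_ne_zero hf' hO' hg1 hyO' hk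
  by_cases hA : gradTurn f y = 0
  · exact Or.inr fun i => pd_pd_one_eq_zero hf' hO' hg1 hyO' hk hA i
  · left
    set m := -gradTurn f y with hm
    have hm0 : m ≠ 0 := neg_ne_zero.2 hA
    have hgpos : 0 < gradSq f y := lt_of_le_of_ne (by unfold gradSq; positivity) hg.symm
    refine ⟨m, Real.sqrt (gradSq f y * Real.exp (-(2 * m * y 0)) / m ^ 2), hm0, ?_,
      Real.sqrt_pos.2 (by positivity), ?_⟩
    · intro h1
      rw [curvNum_eq hf' hO' hyO' (hg1 y hyO') hg, show 1 + gradTurn f y = 0 by linarith,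
        zero_mul] at hk
      exact hk rfl
    · refine isPowerPoint_of_eventually he hy
        ((isPowerJet_of_gradTurn_ne_zero hf' hO' hg1 hk1 hyO' hk hA).mono fun z hz => ⟨hz.1, ?_⟩)
      rw [hz.2, Real.sq_sqrt (by positivity), div_mul_cancel₀ _ (pow_ne_zero 2 hm0),
        mul_assoc (gradSq f y) (Real.exp _), ← Real.exp_add]
      congr 2
      rw [hm]; ring

variable {ε : ℝ} {U : Set M} {Φ : ℝ × M → M}

/-- The rates of the height under two families of motions agree, even at points where the rotations
do not determine the motions. -/
theorem heightRate_eq_heightRate (hx : IsImmersedSurface x) (hK : NoOpenSetOfCriticalPoints x)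
    {ε' : ℝ} {U' : Set M} {Φ' : ℝ × M → M} (hΦ : IsLocalTurn x ε U Φ) (hΦ' : IsLocalTurn x ε' U' Φ')
    {q : M} (hq : q ∈ U) (hq' : q ∈ U') : heightRate x Φ q = heightRate x Φ' q := by
  refine eq_of_frequently_eq (hΦ.continuousAt_heightRate hx hq).1
    (hΦ'.continuousAt_heightRate hx hq').1 ?_
  refine ((mem_closure_iff_frequently.1 (dense_isGenericSurfacePoint hx hK q)).and_eventually
    ((hΦ.isOpen.inter hΦ'.isOpen).mem_nhds ⟨hq, hq'⟩)).mono ?_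
  rintro z ⟨⟨⟨e, he, hze⟩, hne, -⟩, hzU, hzU'⟩
  obtain ⟨y, hy⟩ := exists_polarMap_eq hne
  obtain ⟨hzy, hyd⟩ := he.eq_polarParam hze hy.symm
  rw [hzy] at hzU hzU' ⊢
  rw [(hΦ.heightRate_eq hx he hyd hzU).1, (hΦ'.heightRate_eq hx he hyd hzU').1]

/-- In the absence of points of the classes `(m, c)`, the rate is locally constant at generic
points. -/
theorem IsGenericSurfacePoint.eventually_heightRate_eq (hx : IsImmersedSurface x)
    (hflow : ∀ p : M, ∃ ε U Φ, p ∈ U ∧ IsLocalTurn x ε U Φ)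
    (hno : ∀ m c : ℝ, m ≠ 0 → m ≠ 1 → 0 < c → ∀ q, ¬ IsPowerPoint x m c q)
    (hΦ : IsLocalTurn x ε U Φ) {q : M} (hq : IsGenericSurfacePoint x q) (hqU : q ∈ U) :
    ∀ᶠ z in 𝓝 q, heightRate x Φ z = heightRate x Φ q := by
  obtain ⟨⟨e, he, hqe⟩, hne, -⟩ := id hq
  obtain ⟨y, hy⟩ := exists_polarMap_eq hne
  obtain ⟨hqy, hyd⟩ := he.eq_polarParam hqe hy.symm
  obtain ⟨ψ, V, hV, hqV, hVe, hψ, hψq, hψV⟩ := he.exists_polar hx hqe hy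
  have hf := he.contDiffOn_polarHeight hx
  have hO := isOpen_polarDomain e
  have hcont := he.contMDiffOn_polarParam.continuousOn
  have hO' : IsOpen (polarDomain e ∩ polarParam e ⁻¹' (U ∩ {z | IsGenericSurfacePoint x z})) :=
    hcont.isOpen_inter_preimage hO (hΦ.isOpen.inter (isOpen_isGenericSurfacePoint hx))
  have hyO' : y ∈ polarDomain e ∩ polarParam e ⁻¹' (U ∩ {z | IsGenericSurfacePoint x z}) :=
    ⟨hyd, by rw [Set.mem_preimage, ← hqy]; exact ⟨hqU, hq⟩⟩
  obtain ⟨r, hr, hball⟩ := Metric.isOpen_iff.1 hO' y hyO'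
  have hz : ∀ z ∈ Metric.ball y r, ∀ i, pd i (pd 1 (polarHeight x e)) z = 0 := by
    intro z hz i
    rcases IsGenericSurfacePoint.dichotomy hx hflow he (hball hz).1 (hball hz).2.2 with
      ⟨m, c, h0, h1, h2, h3⟩ | h
    · exact absurd h3 (hno m c h0 h1 h2 _)
    · exact h i
  have hconst : ∀ z ∈ Metric.ball y r, pd 1 (polarHeight x e) z = pd 1 (polarHeight x e) y :=
    fun z hzb => eq_of_pd_eq_zero Metric.isOpen_ball (convex_ball y r).isPreconnected
      (fun z hz => (hf.pd hO 1).differentiableAt_of_isOpen hO (hball hz).1)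
      (fun z hzb => hz z hzb 0) (fun z hzb => hz z hzb 1) hzb (Metric.mem_ball_self hr)
  have ht : ContinuousAt ψ q := hψ.continuousOn.continuousAt (hV.mem_nhds hqV)
  filter_upwards [hV.mem_nhds hqV, ht.preimage_mem_nhds
    (by rw [hψq]; exact Metric.ball_mem_nhds y hr)] with z hzV hzb
  obtain ⟨h1, h2, -⟩ := hψV z hzV
  have h3 := hball hzb
  have e1 := (hΦ.heightRate_eq hx he h3.1 h3.2.1).1
  have e2 := (hΦ.heightRate_eq hx he hyd hyO'.2.1).1
  rw [h2] at e1
  rw [← hqy] at e2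
  rw [e1, e2, hconst _ hzb]

/-- In the absence of points of the classes `(m, c)`, the rate is locally constant, because generic
points are dense. -/
theorem eventually_heightRate_eq (hx : IsImmersedSurface x) (hK : NoOpenSetOfCriticalPoints x)
    (hflow : ∀ p : M, ∃ ε U Φ, p ∈ U ∧ IsLocalTurn x ε U Φ)
    (hno : ∀ m c : ℝ, m ≠ 0 → m ≠ 1 → 0 < c → ∀ q, ¬ IsPowerPoint x m c q)
    (hΦ : IsLocalTurn x ε U Φ) {p : M} (hpU : p ∈ U) :
    ∀ᶠ z in 𝓝 p, heightRate x Φ z = heightRate x Φ p := by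
  have hs := (hΦ.contDiffOn_heightRate hx p).1
  set κ := chartAt E2 p
  have hpκ : p ∈ κ.source := mem_chart_source E2 p
  set O := κ.target ∩ κ.symm ⁻¹' U
  have hO : IsOpen O := κ.continuousOn_symm.isOpen_inter_preimage κ.open_target hΦ.isOpen
  have hpO : κ p ∈ O := ⟨κ.map_source hpκ, by simp only [Set.mem_preimage, κ.left_inv hpκ, hpU]⟩
  set η := fun z => heightRate x Φ (κ.symm z)
  -- The derivative vanishes on a dense set, hence everywhere.
  have hzero : ∀ z ∈ O, ∀ i, pd i η z = 0 := by
    intro z hz i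
    refine eq_of_frequently_eq (f := pd i η) (g := fun _ => (0 : ℝ))
      ((hs.pd hO i).differentiableAt_of_isOpen hO hz).continuousAt continuousAt_const ?_
    have h1 : ∃ᶠ q in 𝓝 (κ.symm z), IsGenericSurfacePoint x q :=
      mem_closure_iff_frequently.1 (dense_isGenericSurfacePoint hx hK _)
    have hzs : κ.symm z ∈ κ.source := κ.map_target hz.1
    have hκc : Filter.Tendsto κ (𝓝 (κ.symm z)) (𝓝 z) := by
      have := κ.continuousAt hzs
      rwa [ContinuousAt, κ.right_inv hz.1] at this
    refine hκc.frequently ((h1.and_eventually ((κ.open_source.inter hΦ.isOpen).mem_nhds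
      ⟨hzs, hz.2⟩)).mono ?_)
    rintro q ⟨hq, hqs, hqU⟩
    have h2 := IsGenericSurfacePoint.eventually_heightRate_eq hx hflow hno hΦ hq hqU
    have hcs : Filter.Tendsto κ.symm (𝓝 (κ q)) (𝓝 q) := by
      have := κ.continuousAt_symm (κ.map_source hqs)
      rwa [ContinuousAt, κ.left_inv hqs] at this
    rw [pd_congr (g := fun _ => heightRate x Φ q) (hcs.eventually h2), pd_const]
  obtain ⟨r, hr, hball⟩ := Metric.isOpen_iff.1 hO (κ p) hpO
  filter_upwards [κ.open_source.mem_nhds hpκ, (κ.continuousAt hpκ).preimage_mem_nhds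
    (Metric.ball_mem_nhds _ hr)] with q hq hqb
  have := eq_of_pd_eq_zero (h := η) Metric.isOpen_ball (convex_ball (κ p) r).isPreconnected
    (fun z hz => hs.differentiableAt_of_isOpen hO (hball hz))
    (fun z hz => hzero z (hball hz) 0) (fun z hz => hzero z (hball hz) 1) hqb
    (Metric.mem_ball_self hr)
  simpa only [η, κ.left_inv hq, κ.left_inv hpκ] using this

theorem planeRot_planeRot (s t : ℝ) (v : E2) : planeRot s (planeRot t v) = planeRot (s + t) v := by
  ext i; fin_cases i
  · simp [planeRot, Real.cos_add, Real.sin_add]; ring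
  · simp [planeRot, Real.cos_add, Real.sin_add]; ring

theorem planeRot_zero (v : E2) : planeRot 0 v = v := by
  ext i; fin_cases i <;> simp [planeRot]

theorem contDiff_planeRot (t : ℝ) : ContDiff ℝ ∞ (planeRot t) := by
  have h : ∀ j : Fin 2, ContDiff ℝ ∞ fun y : E2 => y j := fun j =>
    (EuclideanSpace.proj j : E2 →L[ℝ] ℝ).contDiff
  rw [contDiff_euclidean]
  intro i
  fin_cases i
  · exact (contDiff_const.mul (h 0)).sub (contDiff_const.mul (h 1))
  · exact (contDiff_const.mul (h 0)).add (contDiff_const.mul (h 1))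

/-- The motions preserve generic points. -/
theorem IsLocalTurn.isGenericSurfacePoint (hx : IsImmersedSurface x) (hΦ : IsLocalTurn x ε U Φ)
    {q : M} (hq : IsGenericSurfacePoint x q) (hqU : q ∈ U) {s : ℝ} (hs : s ∈ Set.Ioo (-ε) ε) :
    IsGenericSurfacePoint x (Φ (s, q)) := by
  obtain ⟨⟨e, he, hqe⟩, hne, hKq⟩ := hq
  refine ⟨exists_isGraphChart hx ?_, ?_, by rwa [hΦ.curv_eq s hs q hqU]⟩
  · -- `v ↦ Φ_s (e⁻¹ (R_{-s} v))` is a local section of the horizontal projection.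
    set σ : E2 → M := fun v => Φ (s, e.symm (planeRot (-s) v)) with hσ
    set v₀ := planeRot s (e q) with hv₀
    have hv₀' : planeRot (-s) v₀ = e q := by
      rw [hv₀, planeRot_planeRot, neg_add_cancel, planeRot_zero]
    have hqt := e.map_source hqe
    have hσv : σ v₀ = Φ (s, q) := by simp only [hσ, hv₀', e.left_inv hqe]
    have hO : IsOpen (planeRot (-s) ⁻¹' (e.target ∩ e.symm ⁻¹' U)) :=
      (e.continuousOn_symm.isOpen_inter_preimage e.open_target hΦ.isOpen).preimage
        (contDiff_planeRot _).continuous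
    have hv₀O : v₀ ∈ planeRot (-s) ⁻¹' (e.target ∩ e.symm ⁻¹' U) := by
      rw [Set.mem_preimage, hv₀']
      exact ⟨hqt, by rwa [Set.mem_preimage, e.left_inv hqe]⟩
    have sσ : ContMDiffOn (𝓡 2) (𝓡 2) ∞ σ (planeRot (-s) ⁻¹' (e.target ∩ e.symm ⁻¹' U)) :=
      (hΦ.contMDiffOn_left hs).comp ((he.smooth_symm.mono Set.inter_subset_left).comp
        (contDiff_planeRot (-s)).contMDiff.contMDiffOn fun v hv => hv) fun v hv => hv.2
    have dw := (contMDiff_horiz_comp hx).mdifferentiable (by simp) (σ v₀)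
    have hev : (fun v => horiz (x (σ v))) =ᶠ[𝓝 v₀] fun v => v := by
      filter_upwards [hO.mem_nhds hv₀O] with v hv
      simp only [hσ]
      rw [hΦ.horiz_eq s hs _ hv.2, ← he.eq_horiz _ (e.map_target hv.1), e.right_inv hv.1,
        planeRot_planeRot, add_neg_cancel, planeRot_zero]
    rw [← hσv]
    intro b
    have key := fderiv_comp_param (F := E2) dw (sσ.mdifferentiableAt_of_isOpen hO hv₀O) b
    rw [hev.fderiv_eq, fderiv_fun_id] at key
    exact ⟨_, key.symm⟩
  · rw [hΦ.horiz_eq s hs q hqU, ← norm_ne_zero_iff, norm_planeRot]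
    exact norm_ne_zero_iff.2 hne

omit [IsManifold (𝓡 2) ∞ M] in
theorem IsLocalTurn.continuousAt_curve (hΦ : IsLocalTurn x ε U Φ) {q : M} (hqU : q ∈ U) {s : ℝ}
    (hs : s ∈ Set.Ioo (-ε) ε) : ContinuousAt (fun t => Φ (t, q)) s :=
  ContinuousAt.comp (f := fun t : ℝ => (t, q)) (hΦ.continuousAt hs hqU)
    (continuousAt_id.prodMk continuousAt_const)

/-- Along the orbit of a generic point the height has the derivative `heightRate` at every time. -/
theorem IsLocalTurn.hasDerivAt_height (hx : IsImmersedSurface x) (hΦ : IsLocalTurn x ε U Φ) {q : M}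
    (hq : IsGenericSurfacePoint x q) (hqU : q ∈ U) {s : ℝ} (hs : s ∈ Set.Ioo (-ε) ε)
    {ε' : ℝ} {U' : Set M} {Φ' : ℝ × M → M} (hΦ' : IsLocalTurn x ε' U' Φ') (hsU' : Φ (s, q) ∈ U') :
    HasDerivAt (fun t => x (Φ (t, q)) 2) (heightRate x Φ' (Φ (s, q))) s := by
  obtain ⟨⟨e, he, hqe⟩, hne, -⟩ := hΦ.isGenericSurfacePoint hx hq hqU hs
  obtain ⟨y, hy⟩ := exists_polarMap_eq hne
  obtain ⟨hqy, hyd⟩ := he.eq_polarParam hqe hy.symm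
  have h1 := (hΦ'.heightRate_eq hx he hyd (by rwa [← hqy])).1
  rw [hqy, h1]
  refine (hasDerivAt_add_smul ((he.contDiffOn_polarHeight hx).differentiableAt_of_isOpen
    (isOpen_polarDomain e) hyd) s).congr_of_eventuallyEq ?_
  filter_upwards [isOpen_Ioo.mem_nhds hs,
    (hΦ.continuousAt_curve hqU hs).preimage_mem_nhds (e.open_source.mem_nhds hqe)] with t ht hte
  have h2 : horiz (x (Φ (t, q))) = polarMap (y + (t - s) • EuclideanSpace.single 1 1) := by
    rw [polarMap_add, hy, hΦ.horiz_eq t ht q hqU, hΦ.horiz_eq s hs q hqU, planeRot_planeRot,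
      sub_add_cancel]
  exact congrArg (fun z => x z 2) (he.eq_polarParam hte h2).1

/-- In the absence of points of the classes `(m, c)`, all local motions are restrictions of screw
motions of one and the same pitch. -/
theorem exists_screw [ConnectedSpace M] (hx : IsImmersedSurface x) (hK : NoOpenSetOfCriticalPoints x)
    (hflow : ∀ p : M, ∃ ε U Φ, p ∈ U ∧ IsLocalTurn x ε U Φ)
    (hno : ∀ m c : ℝ, m ≠ 0 → m ≠ 1 → 0 < c → ∀ q, ¬ IsPowerPoint x m c q) :
    ∃ h : ℝ, ∀ ε U Φ, IsLocalTurn x ε U Φ → ∀ t ∈ Set.Ioo (-ε) ε, ∀ q ∈ U,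
      x (Φ (t, q)) = standardScrew h t (x q) := by
  choose ε₀ U₀ Φ₀ hU₀ hΦ₀ using hflow
  have hflow : ∀ p : M, ∃ ε U Φ, p ∈ U ∧ IsLocalTurn x ε U Φ := fun p =>
    ⟨ε₀ p, U₀ p, Φ₀ p, hU₀ p, hΦ₀ p⟩
  set H : M → ℝ := fun p => heightRate x (Φ₀ p) p with hH
  have hHloc : IsLocallyConstant H := by
    rw [IsLocallyConstant.iff_eventually_eq]
    intro p
    filter_upwards [eventually_heightRate_eq hx hK hflow hno (hΦ₀ p) (hU₀ p),
      (hΦ₀ p).isOpen.mem_nhds (hU₀ p)] with q hq hqU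
    rw [hH]
    simp only
    rw [← hq]
    exact heightRate_eq_heightRate hx hK (hΦ₀ q) (hΦ₀ p) (hU₀ q) hqU
  obtain ⟨p₀⟩ : Nonempty M := inferInstance
  refine ⟨H p₀, fun ε U Φ hΦ t ht q hqU => ?_⟩
  have hconst : ∀ q, H q = H p₀ := fun q => hHloc.apply_eq_of_preconnectedSpace q p₀
  -- The height at generic points.
  have hgen : ∀ z ∈ U, IsGenericSurfacePoint x z → x (Φ (t, z)) 2 = x z 2 + H p₀ * t := by
    intro z hzU hz
    have hd : ∀ s ∈ Set.Ioo (-ε) ε,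
        HasDerivAt (fun t => x (Φ (t, z)) 2 - H p₀ * t) 0 s := by
      intro s hs
      have h1 := hΦ.hasDerivAt_height hx hz hzU hs (hΦ₀ (Φ (s, z))) (hU₀ _)
      have h2 : heightRate x (Φ₀ (Φ (s, z))) (Φ (s, z)) = H p₀ := hconst _
      rw [h2] at h1
      simpa using h1.fun_sub ((hasDerivAt_id' s).const_mul (H p₀))
    have key := isOpen_Ioo.is_const_of_deriv_eq_zero isPreconnected_Ioo
      (fun s hs => (hd s hs).differentiableAt.differentiableWithinAt)
      (fun s hs => (hd s hs).deriv) ht hΦ.zero_mem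
    simp only [hΦ.map_zero z hzU, mul_zero, sub_zero] at key
    linarith
  have hht : x (Φ (t, q)) 2 = x q 2 + H p₀ * t := by
    have c2 := contDiff_coord3 2
    refine eq_of_frequently_eq (f := fun q => x (Φ (t, q)) 2) (g := fun q => x q 2 + H p₀ * t) ?_ ?_
      (((mem_closure_iff_frequently.1 (dense_isGenericSurfacePoint hx hK q)).and_eventually
        (hΦ.isOpen.mem_nhds hqU)).mono fun z hz => hgen z hz.2 hz.1)
    · have h1 : ContinuousAt (fun q => Φ (t, q)) q :=
        (hΦ.contMDiffOn_left ht).continuousOn.continuousAt (hΦ.isOpen.mem_nhds hqU)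
      exact ContinuousAt.comp (g := fun q => x q 2)
        (c2.continuous.comp hx.1.continuous).continuousAt h1
    · exact ((c2.continuous.comp hx.1.continuous).add continuous_const).continuousAt
  have hw := hΦ.horiz_eq t ht q hqU
  ext i; fin_cases i
  · have := congrArg (fun v : E2 => v 0) hw
    simpa [horiz, planeRot, standardScrew] using this
  · have := congrArg (fun v : E2 => v 1) hw
    simpa [horiz, planeRot, standardScrew] using this
  · simpa [standardScrew] using hht

end Helicoidal

section Reduction

open EuclideanGeometry

theorem inner_rotation {V : Type*} [NormedAddCommGroup V] [InnerProductSpace ℝ V]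
    [Fact (Module.finrank ℝ V = 2)] (rot : Orientation ℝ V (Fin 2)) (b p : V) (t : ℝ) :
    inner ℝ b (rot.rotation (t : Real.Angle) p) =
      Real.cos t * inner ℝ b p + Real.sin t * inner ℝ b (rot.rightAngleRotation p) := by
  rw [rot.rotation_apply, inner_add_right, real_inner_smul_right, real_inner_smul_right,
    Real.Angle.cos_coe, Real.Angle.sin_coe]

/-- Coordinates of space in which the plane `P` is horizontal, the point `o` is the origin and the
rotations of `P` are the standard ones. -/
theorem exists_adapted_isometry (P : AffineSubspace ℝ E3) [Nonempty P]
    [Fact (Module.finrank ℝ P.direction = 2)] (o : P) (rot : Orientation ℝ P.direction (Fin 2)) :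
    ∃ A : E3 ≃ᵃⁱ[ℝ] E3, ∀ (t : ℝ) (v w : E3),
      orthogonalProjection P w -ᵥ o =
        rot.rotation (t : Real.Angle) (orthogonalProjection P v -ᵥ o) →
      horiz (A w) = planeRot t (horiz (A v)) := by
  obtain ⟨b₀, hb₀⟩ : ∃ b : P.direction, ‖b‖ = 1 := by
    have : Nontrivial P.direction := Module.nontrivial_of_finrank_pos (R := ℝ)
      (by rw [(Fact.out : Module.finrank ℝ P.direction = 2)]; norm_num)
    exact exists_norm_eq _ zero_le_one
  set b₁ : P.direction := rot.rightAngleRotation b₀ with hb₁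
  obtain ⟨n, hn⟩ : ∃ n : P.directionᗮ, ‖n‖ = 1 := by
    have h1 := Submodule.finrank_add_finrank_orthogonal P.direction
    rw [(Fact.out : Module.finrank ℝ P.direction = 2), finrank_euclideanSpace_fin] at h1
    have : Nontrivial P.directionᗮ := Module.nontrivial_of_finrank_pos (R := ℝ) (by omega)
    exact exists_norm_eq _ zero_le_one
  have hb₁n : ‖b₁‖ = 1 := by rw [hb₁, LinearIsometryEquiv.norm_map, hb₀]
  have h01 : inner ℝ (b₀ : E3) (b₁ : E3) = 0 := by
    rw [← Submodule.coe_inner, hb₁]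
    exact rot.inner_rightAngleRotation_self b₀ ▸ real_inner_comm _ _
  have h0n : inner ℝ (b₀ : E3) (n : E3) = 0 := n.2 _ b₀.2
  have h1n : inner ℝ (b₁ : E3) (n : E3) = 0 := n.2 _ b₁.2
  have hon : Orthonormal ℝ ![(b₀ : E3), b₁, n] := by
    rw [orthonormal_iff_ite]
    have e0 : inner ℝ (b₀ : E3) (b₀ : E3) = 1 := by
      rw [real_inner_self_eq_norm_sq, show ‖(b₀ : E3)‖ = 1 from hb₀]; norm_num
    have e1 : inner ℝ (b₁ : E3) (b₁ : E3) = 1 := by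
      rw [real_inner_self_eq_norm_sq, show ‖(b₁ : E3)‖ = 1 from hb₁n]; norm_num
    have e2 : inner ℝ (n : E3) (n : E3) = 1 := by
      rw [real_inner_self_eq_norm_sq, show ‖(n : E3)‖ = 1 from hn]; norm_num
    have h10 : inner ℝ (b₁ : E3) (b₀ : E3) = 0 := by rw [real_inner_comm, h01]
    have hn0 : inner ℝ (n : E3) (b₀ : E3) = 0 := by rw [real_inner_comm, h0n]
    have hn1 : inner ℝ (n : E3) (b₁ : E3) = 0 := by rw [real_inner_comm, h1n]
    intro i j
    fin_cases i <;> fin_cases j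
    · exact e0
    · exact h01
    · exact h0n
    · exact h10
    · exact e1
    · exact h1n
    · exact hn0
    · exact hn1
    · exact e2
  let B : OrthonormalBasis (Fin 3) ℝ E3 := OrthonormalBasis.mk hon (by
    rw [hon.linearIndependent.span_eq_top_of_card_eq_finrank (by simp)])
  have hB : ∀ i, B i = ![(b₀ : E3), b₁, n] i := fun i => by simp [B]
  let A : E3 ≃ᵃⁱ[ℝ] E3 :=
    (AffineIsometryEquiv.vaddConst ℝ (o : E3)).symm.trans B.repr.toAffineIsometryEquiv
  have hA : ∀ v i, A v i = inner ℝ (![(b₀ : E3), b₁, n] i) (v - o) := by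
    intro v i
    rw [← hB, ← B.repr_apply_apply]
    rfl
  -- The first two coordinates of a point only depend on its projection to `P`.
  have hproj : ∀ (v : E3) (b : P.direction),
      inner ℝ (b : E3) (v - o) = inner ℝ b (orthogonalProjection P v -ᵥ o) := by
    intro v b
    rw [Submodule.coe_inner, AffineSubspace.coe_vsub, vsub_eq_sub]
    have h1 : inner ℝ (b : E3) (v - (orthogonalProjection P v : E3)) = 0 :=
      (vsub_orthogonalProjection_mem_direction_orthogonal P v) _ b.2
    have h2 : v - (o : E3) = (v - (orthogonalProjection P v : E3)) +
        ((orthogonalProjection P v : E3) - o) := by abel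
    rw [h2, inner_add_right, h1, zero_add]
  refine ⟨A, fun t v w h => ?_⟩
  set p := orthogonalProjection P v -ᵥ o
  have a0 : ∀ u, A u 0 = inner ℝ b₀ (orthogonalProjection P u -ᵥ o) := fun u => by
    rw [hA, ← hproj]; rfl
  have a1 : ∀ u, A u 1 = inner ℝ b₁ (orthogonalProjection P u -ᵥ o) := fun u => by
    rw [hA, ← hproj]; rfl
  have hJ0 : inner ℝ b₀ (rot.rightAngleRotation p) = - inner ℝ b₁ p := by
    have := rot.inner_comp_rightAngleRotation b₀ p
    have h2 := rot.inner_rightAngleRotation_swap b₀ p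
    rw [hb₁]; linarith
  have hJ1 : inner ℝ b₁ (rot.rightAngleRotation p) = inner ℝ b₀ p := by
    rw [hb₁, LinearIsometryEquiv.inner_map_map]
  have w0 : A w 0 = Real.cos t * A v 0 - Real.sin t * A v 1 := by
    rw [a0 w, a0 v, a1 v, h, inner_rotation, hJ0]; ring
  have w1 : A w 1 = Real.sin t * A v 0 + Real.cos t * A v 1 := by
    rw [a1 w, a0 v, a1 v, h, inner_rotation, hJ1]; ring
  ext i; fin_cases i
  · simpa [horiz, planeRot] using w0
  · simpa [horiz, planeRot] using w1

end Reduction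

/-! ### Isometry invariance and conclusion -/

section Isometry

variable {M : Type*} [TopologicalSpace M] [ChartedSpace E2 M]

theorem gaussianCurvature_isometry (A : E3 ≃ᵃⁱ[ℝ] E3) (x : M → E3) :
    gaussianCurvature (fun q => A (x q)) = gaussianCurvature x := by
  funext p
  rw [gaussianCurvature_eq_chart, gaussianCurvature_eq_chart]
  exact paramGaussianCurvature_isometry A _ _

theorem NoOpenSetOfCriticalPoints.isometry {x : M → E3} (hK : NoOpenSetOfCriticalPoints x)
    (A : E3 ≃ᵃⁱ[ℝ] E3) : NoOpenSetOfCriticalPoints fun q => A (x q) := by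
  intro U hU hne
  rw [gaussianCurvature_isometry]
  exact hK U hU hne

theorem hasFDerivAt_isometry (A : E3 ≃ᵃⁱ[ℝ] E3) (v : E3) :
    HasFDerivAt A (A.linearIsometryEquiv.toContinuousLinearEquiv : E3 →L[ℝ] E3) v := by
  have h : (A : E3 → E3) = fun z => A.linearIsometryEquiv z + A 0 := by
    funext z
    simpa using A.map_vadd 0 z
  rw [h]
  exact (A.linearIsometryEquiv.toContinuousLinearEquiv.hasFDerivAt).add_const _

theorem contDiff_isometry (A : E3 ≃ᵃⁱ[ℝ] E3) : ContDiff ℝ ∞ A := by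
  have h : (A : E3 → E3) = fun z => A.linearIsometryEquiv z + A 0 := by
    funext z
    simpa using A.map_vadd 0 z
  rw [h]
  exact A.linearIsometryEquiv.contDiff.add contDiff_const

theorem mfderiv_isometry {x : M → E3} (hx : IsImmersedSurface x) (A : E3 ≃ᵃⁱ[ℝ] E3) (p : M)
    (v : TangentSpace (𝓡 2) p) :
    mfderiv (𝓡 2) 𝓘(ℝ, E3) (fun q => A (x q)) p v =
      A.linearIsometryEquiv (mfderiv (𝓡 2) 𝓘(ℝ, E3) x p v) := by
  have h := (hasFDerivAt_isometry A (x p)).hasMFDerivAt.comp p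
    ((hx.1.mdifferentiable (by simp)) p).hasMFDerivAt
  exact congrArg (fun L => L v) h.mfderiv

theorem IsImmersedSurface.isometry {x : M → E3} (hx : IsImmersedSurface x) (A : E3 ≃ᵃⁱ[ℝ] E3) :
    IsImmersedSurface fun q => A (x q) := by
  refine ⟨(contDiff_isometry A).contMDiff.comp hx.1, fun p u v huv => hx.2 p ?_⟩
  rw [mfderiv_isometry hx, mfderiv_isometry hx] at huv
  exact A.linearIsometryEquiv.injective huv

theorem areaElement_isometry {x : M → E3} (hx : IsImmersedSurface x) (A : E3 ≃ᵃⁱ[ℝ] E3) (p : M)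
    (u v : TangentSpace (𝓡 2) p) :
    areaElement (fun q => A (x q)) p u v = areaElement x p u v := by
  unfold areaElement
  rw [mfderiv_isometry hx, mfderiv_isometry hx]
  exact norm_cross3_map _ _ _

theorem IsCongruentNear.of_isometry {N : Type*} [NormedAddCommGroup N] [NormedSpace ℝ N]
    {x : M → E3} {p : M} {y : N → E3} {D : Set N} {A : E3 ≃ᵃⁱ[ℝ] E3}
    (h : IsCongruentNear (fun q => A (x q)) p y D) : IsCongruentNear x p y D := by
  obtain ⟨B, hB⟩ := h
  exact ⟨A.trans B, hB⟩

theorem IsLocallyCongruentToXmc.of_isometry {x : M → E3} {m c : ℝ} {A : E3 ≃ᵃⁱ[ℝ] E3}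
    (h : IsLocallyCongruentToXmc (fun q => A (x q)) m c) : IsLocallyCongruentToXmc x m c :=
  fun p => (h p).imp IsCongruentNear.of_isometry fun ⟨n, hn, hnm, hc⟩ => ⟨n, hn, hnm, hc.of_isometry⟩

/-- In suitable coordinates of space, the local motions that the hypothesis on the area element
provides lie over the rotations of the horizontal plane about the origin. -/
theorem AreaElementInvariantAlongKContours.exists_isLocalTurn {x : M → E3}
    (hx : IsImmersedSurface x) {P : AffineSubspace ℝ E3} [Nonempty P]
    [Fact (Module.finrank ℝ P.direction = 2)] {o : P}
    (harea : AreaElementInvariantAlongKContours x P o) :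
    ∃ A : E3 ≃ᵃⁱ[ℝ] E3, ∀ p : M, ∃ ε U Φ, p ∈ U ∧ IsLocalTurn (fun q => A (x q)) ε U Φ := by
  obtain ⟨rot, harea⟩ := harea
  obtain ⟨A, hA⟩ := exists_adapted_isometry P o rot
  refine ⟨A, fun p => ?_⟩
  obtain ⟨ε, hε, U, hU, hpU, Φ, hΦ, h0, ht⟩ := harea p
  refine ⟨ε, U, Φ, hpU, hε, hU, hΦ, h0, fun t hte q hq => hA t _ _ (ht t hte q hq).1,
    fun t hte q hq => ?_, fun t hte q hq u v => ?_⟩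
  · rw [gaussianCurvature_isometry]
    exact (ht t hte q hq).2.1
  · rw [areaElement_isometry hx, areaElement_isometry hx]
    exact (ht t hte q hq).2.2 u v

end Isometry

theorem theorem2p3 {M : Type*} [TopologicalSpace M] [T2Space M] [SecondCountableTopology M]
    [ConnectedSpace M] [ChartedSpace E2 M] [IsManifold (𝓡 2) ∞ M]
    (x : M → E3) (hx : IsImmersedSurface x) (hK : NoOpenSetOfCriticalPoints x)
    (P : AffineSubspace ℝ E3) [Nonempty P] [Fact (Module.finrank ℝ P.direction = 2)] (o : P)
    (hcontours : HasConcentricKContours x P o)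
    (harea : AreaElementInvariantAlongKContours x P o) :
    IsHelicoidalSurface x ∨
      ∃ m c : ℝ, m ≠ 0 ∧ m ≠ 1 ∧ c ≠ 0 ∧ IsLocallyCongruentToXmc x m c := by
  obtain ⟨A, hflow⟩ := harea.exists_isLocalTurn hx
  have hx' := hx.isometry A
  by_cases h : ∃ m c : ℝ, m ≠ 0 ∧ m ≠ 1 ∧ 0 < c ∧ ∃ q, IsPowerPoint (fun q => A (x q)) m c q
  · obtain ⟨m, c, hm0, hm1, hc, q, hq⟩ := h
    exact Or.inr ⟨m, c, hm0, hm1, hc.ne',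
      (isLocallyCongruentToXmc_of_isPowerPoint hx' hflow hm0 hm1 hc hq).of_isometry⟩
  · left
    obtain ⟨k, hk⟩ := exists_screw hx' (hK.isometry A) hflow fun m c hm0 hm1 hc q hq =>
      h ⟨m, c, hm0, hm1, hc, q, hq⟩
    refine ⟨A, k, fun p => ?_⟩
    obtain ⟨ε, U, Φ, hpU, hΦ⟩ := hflow p
    refine ⟨ε, hΦ.pos, U, hΦ.isOpen, hpU, Φ, hΦ.smooth, hΦ.map_zero, fun t ht q hq => ?_⟩
    rw [← hk ε U Φ hΦ t ht q hq, A.symm_apply_apply]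

end
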